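/- Let $(W_t)_{t\ge 0}$ be a standard Brownian motion and, for each $n$, let $\epsilon_{1,n},\dots,\epsilon_{n,n}$ be i.i.d., independent of $(W_t)_{t\in[0,1]}$, with $\mathrm E\,\epsilon_{i,n}=0$, $\mathrm E\,\epsilon_{i,n}^2=1$ and $\sup_{n}\mathrm E\,\epsilon_{1,n}^4<\infty$. For positive deterministic functions $\sigma,\tau$ on $[0,1]$ consider the models $$(1)\quad Y_{i,n}=\int_0^{i/n}\sigma(s)\,dW_s+\tau(i/n)\,\epsilon_{i,n},\qquad (2)\quad Y_{i,n}=\sigma(i/n)\,W_{i/n}+\tau(i/n)\,\epsilon_{i,n},\qquad i=1,\dots,n.$$ For $\alpha>0$, $C>0$ and $0<l\le u<\infty$ let $\Theta^b_s(\alpha,C,[l,u])$ be the set of all $f\in L^2[0,1]$ with $l\le f\le u$ such that $f(x)=\theta_0+2\sum_{i\ge1}\theta_i\cos(i\pi x)$ on $[0,1]$ for some real $(\theta_i)_{i\ge 0}$ with $\sum_{i\ge1}i^{2\alpha}\theta_i^2\le C$ (for $\alpha>1/2$ this is understood pointwise, i.e. $f$ is the continuous representative). Put $f_0=1$, $f_k(x)=\sqrt2\cos(k\pi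 x/2)$ for $k\ge1$, $\Delta Y^k=\big((Y_{i+1,n}-Y_{i,n})f_k(i/n)\big)_{i=1,\dots,n-1}$, $D=\big(\sqrt{2/n}\,\sin(ij\pi/n)\big)_{i,j=1,\dots,n-1}$, $\lambda_i=4\sin^2(i\pi/(2n))$, and let $J_n^\tau$ be the diagonal $(n-1)\times(n-1)$ matrix with $i$-th diagonal entry $(n-n/\log n)^{-1}\lambda_i^{-1}$ if $\lfloor n/\log n\rfloor\le i\le n-1$ and $0$ otherwise, where $\log$ is the binary logarithm. Define $$\hat t_{k,0}=(\Delta Y^k)^tDJ_n^\tau D^t\,\Delta Y^k,\qquad \hat\tau^2_N(t)=\hat t_{0,0}+2\sum_{i=1}^N(\hat t_{i,0}-\hat t_{0,0})\cos(i\pi t),$$ and $\mathrm{MISE}(\hat\tau^2_N)=\mathrm E\int_0^1\big(\hat\tau_N^2(t)-\tau^2(t)\big)^2dt$. **Theorem.** Let $\beta>1$, $Q,\bar Q>0$, $0<\sigma_{\min}\le\sigma_{\max}<\infty$, $0<\tau_{\min}\le\tau_{\max}<\infty$, and assume either model (1) and $\alpha>1/2$, or model (2) and $\alpha>3/4$.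 Below, suprema are over $\sigma^2\in\Theta^b_s(\alpha,Q,[\sigma_{\min},\sigma_{\max}])$ and $\tau^2\in\Theta^b_s(\beta,\bar Q,[\tau_{\min},\tau_{\max}])$, and $O$, $o$ refer to $n\to\infty$. (i) If $N=N_n\ge1$ are integers with $N_n=o(n^{1/2}/\log n)$, then $$\sup_{\sigma^2,\tau^2}\mathrm{MISE}(\hat\tau^2_{N})=O\big(N^{-2\beta}+N n^{-1}\big).$$ (ii) Every sequence $N^*=N^*_n$ of minimizers of $N\mapsto N^{-2\beta}+Nn^{-1}$ over the integers $N\ge1$ is of exact order $n^{1/(2\beta+1)}$, that is, $N^*_n/n^{1/(2\beta+1)}$ stays between two positive constants for all large $n$. (iii) For every sequence of integers $N^*=N^*_n$ of exact order $n^{1/(2\beta+1)}$, $$\sup_{\sigma^2,\tau^2}\mathrm{MISE}(\hat\tau^2_{N^*})=O\big(n^{-2\beta/(2\beta+1)}\big).$$ -/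

import Mathlib

open MeasureTheory ProbabilityTheory Filter Topology Set Asymptotics
open scoped NNReal ENNReal Matrix

noncomputable section

namespace NoisyVolatility

/-! ### Sobolev s-ellipsoids -/

/-- The Sobolev s-ellipsoid `Θ_s(α, C)`: square integrable functions on `[0,1]` with a cosine
expansion `f(x) = θ₀ + 2 ∑_{i ≥ 1} θ_i cos(iπx)` and `∑_{i ≥ 1} i^{2α} θ_i² ≤ C`. The expansion is
required at every point of `[0,1]`, because the models evaluate the functions at single points.
For `α > 1/2` the series converges absolutely and uniformly, so that this picks the continuous
representative of the `L²`-class. The values of `f` outside `[0,1]` play no role. -/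
def sobolevS (α C : ℝ) : Set (ℝ → ℝ) :=
  {f | MemLp f 2 (volume.restrict (Icc 0 1)) ∧
    ∃ θ : ℕ → ℝ,
      (∀ x ∈ Icc (0 : ℝ) 1,
        HasSum (fun i : ℕ => 2 * θ (i + 1) * Real.cos (((i + 1 : ℕ) : ℝ) * Real.pi * x))
          (f x - θ 0)) ∧
      Summable (fun i : ℕ => ((i + 1 : ℕ) : ℝ) ^ (2 * α) * θ (i + 1) ^ 2) ∧
      ∑' i : ℕ, ((i + 1 : ℕ) : ℝ) ^ (2 * α) * θ (i + 1) ^ 2 ≤ C}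

/-- The uniformly bounded Sobolev s-ellipsoid `Θ^b_s(α, C, [l, u])`. -/
def sobolevSBdd (α C l u : ℝ) : Set (ℝ → ℝ) :=
  {f | f ∈ sobolevS α C ∧ ∀ x ∈ Icc (0 : ℝ) 1, l ≤ f x ∧ f x ≤ u}

/-! ### The Wiener integral of a deterministic function -/

/-- A left-open step function `∑_{j < m} c_j 1_{(t_j, t_{j+1}]}` on `[0, ∞)`. -/
structure StepIntegrand where
  /-- number of intervals -/
  m : ℕ
  /-- the partition points -/
  t : ℕ → ℝ≥0
  mono : Monotone t
  /-- the values -/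
  c : ℕ → ℝ

/-- The step function as a function on the real line. -/
def StepIntegrand.eval (φ : StepIntegrand) (x : ℝ) : ℝ :=
  ∑ j ∈ Finset.range φ.m, (Ioc (φ.t j : ℝ) (φ.t (j + 1) : ℝ)).indicator (fun _ => φ.c j) x

variable {Ω : Type*} [MeasurableSpace Ω]

/-- The elementary integral `∑_{j < m} c_j (W_{t_{j+1}} - W_{t_j})`. -/
def StepIntegrand.integral (φ : StepIntegrand) (W : ℝ≥0 → Ω → ℝ) (ω : Ω) : ℝ :=
  ∑ j ∈ Finset.range φ.m, φ.c j * (W (φ.t (j + 1)) ω - W (φ.t j) ω)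

/-- `X` is (a version of) the Wiener integral `∫_0^b f(s) dW_s`: the function `f 1_{(0,b]}` is square
integrable, and `X` is the `L²(P)`-limit of the elementary integrals of step functions that
converge to `f 1_{(0,b]}` in `L²`. By the Itô isometry such an `X` exists and is almost surely
unique. -/
def IsWienerIntegral (P : Measure Ω) (W : ℝ≥0 → Ω → ℝ) (f : ℝ → ℝ) (b : ℝ≥0) (X : Ω → ℝ) : Prop :=
  MemLp ((Ioc 0 (b : ℝ)).indicator f) 2 volume ∧ MemLp X 2 P ∧
    ∃ φ : ℕ → StepIntegrand,
      Tendsto (fun r => eLpNorm (fun x => (Ioc 0 (b : ℝ)).indicator f x - (φ r).eval x) 2 volume)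
        atTop (𝓝 0) ∧
      Tendsto (fun r => eLpNorm (fun ω => X ω - (φ r).integral W ω) 2 P) atTop (𝓝 0)

/-! ### The observation models -/

/-- The two models: time-transformed Brownian motion `∫_0^t σ(s) dW_s` plus noise (threshold
`α > 1/2`), and space-transformed Brownian motion `σ(t) W_t` plus noise (threshold `α > 3/4`). -/
inductive VolModel
  | timeTransformed
  | spaceTransformed

/-- The design point `i / n`. -/
def designPt (n i : ℕ) : ℝ≥0 := (i : ℝ≥0) / (n : ℝ≥0)

/-- The errors `ε_1, …, ε_n` of one row (`e i` is `ε_{i+1}`): i.i.d., centered, with variance one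
and finite fourth moment, and independent of the Brownian motion `(W_t)_{t ∈ [0,1]}`. -/
structure IsNoiseRow (P : Measure Ω) (W : ℝ≥0 → Ω → ℝ) {n : ℕ} (e : Fin n → Ω → ℝ) : Prop where
  indep : iIndepFun e P
  ident : ∀ i j, IdentDistrib (e i) (e j) P P
  memLp_four : ∀ i, MemLp (e i) 4 P
  mean_zero : ∀ i, ∫ ω, e i ω ∂P = 0
  variance_one : ∀ i, ∫ ω, e i ω ^ 2 ∂P = 1
  indep_brownian : IndepFun (fun ω (t : Icc (0 : ℝ≥0) 1) => W (t : ℝ≥0) ω) (fun ω i => e i ω) P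

/-- `Y = (Y_1, …, Y_n)` (`Y i` is `Y_{i+1}`) is a sample from the model with `σ² = s`, `τ² = v`,
driven by the Brownian motion `W` and the errors `e`; here `σ = √s` and `τ = √v`, since `σ` and `τ`
are positive. -/
def IsSample (mod : VolModel) (P : Measure Ω) (W : ℝ≥0 → Ω → ℝ) {n : ℕ} (e : Fin n → Ω → ℝ)
    (s v : ℝ → ℝ) (Y : Fin n → Ω → ℝ) : Prop :=
  match mod with
  | .timeTransformed =>
      ∃ X : Fin n → Ω → ℝ,
        (∀ i : Fin n, IsWienerIntegral P W (fun x => √(s x)) (designPt n (i + 1)) (X i)) ∧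
        ∀ (i : Fin n) (ω : Ω), Y i ω = X i ω + √(v (designPt n (i + 1))) * e i ω
  | .spaceTransformed =>
      ∀ (i : Fin n) (ω : Ω), Y i ω = √(s (designPt n (i + 1))) * W (designPt n (i + 1)) ω
        + √(v (designPt n (i + 1))) * e i ω

/-! ### The estimator -/

/-- The cosine basis `ψ_0 = 1`, `ψ_k(t) = √2 cos(kπt)`. -/
def cosBasis (k : ℕ) (t : ℝ) : ℝ := if k = 0 then 1 else √2 * Real.cos (k * Real.pi * t)

/-- `f_k(x) = ψ_k(x / 2)`. -/
def halfBasis (k : ℕ) (x : ℝ) : ℝ := cosBasis k (x / 2)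

/-- The transformed increments `ΔY^k_i = (Y_{i+1} - Y_i) f_k(i/n)`, `i = 1, …, n-1`. Vectors and
matrices are indexed from `0`: the entry with index `i` is the one with number `i + 1`. -/
def transIncr (n k : ℕ) (y : Fin n → ℝ) (i : Fin (n - 1)) : ℝ :=
  (y ⟨(i : ℕ) + 1, by omega⟩ - y ⟨(i : ℕ), by omega⟩) * halfBasis k (designPt n (i + 1))

/-- The sine transform matrix `D` with entries `√(2/n) sin(ijπ/n)`. -/
def sineMatrix (n : ℕ) : Matrix (Fin (n - 1)) (Fin (n - 1)) ℝ :=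
  Matrix.of fun i j =>
    √(2 / (n : ℝ)) * Real.sin ((((i : ℕ) + 1 : ℕ) : ℝ) * (((j : ℕ) + 1 : ℕ) : ℝ) * Real.pi / n)

/-- The eigenvalues `λ_i = 4 sin²(iπ/(2n))`. -/
def lam (n i : ℕ) : ℝ := 4 * Real.sin (i * Real.pi / (2 * n)) ^ 2

/-- The spectral filter `J^τ_n`: diagonal, with entry `(n - n/log n)⁻¹ λ_i⁻¹` for
`[n/log n] ≤ i ≤ n - 1` and `0` otherwise, `log` being the binary logarithm. -/
def spectralFilter (n : ℕ) : Matrix (Fin (n - 1)) (Fin (n - 1)) ℝ :=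
  Matrix.diagonal fun i =>
    if ⌊(n : ℝ) / Real.logb 2 n⌋₊ ≤ (i : ℕ) + 1 then
      ((n : ℝ) - n / Real.logb 2 n)⁻¹ * (lam n (i + 1))⁻¹
    else 0

/-- `t̂_{k,0} = (ΔY^k)ᵗ D J^τ_n Dᵗ ΔY^k`. -/
def tHat (n k : ℕ) (y : Fin n → ℝ) : ℝ :=
  transIncr n k y ⬝ᵥ
    ((sineMatrix n * spectralFilter n * (sineMatrix n)ᵀ) *ᵥ transIncr n k y)

/-- The cosine series estimator
`τ̂²_N(t) = t̂_{0,0} + 2 ∑_{i=1}^N (t̂_{i,0} - t̂_{0,0}) cos(iπt)`. -/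
def tauSqEst (n N : ℕ) (y : Fin n → ℝ) (t : ℝ) : ℝ :=
  tHat n 0 y + 2 * ∑ i ∈ Finset.Icc 1 N, (tHat n i y - tHat n 0 y) * Real.cos (i * Real.pi * t)

/-! ### The risk -/

/-- The mean integrated squared error `E ∫_0^1 (τ̂²_N(t) - v(t))² dt`, as an element of `[0, ∞]`. -/
def MISE (P : Measure Ω) {n : ℕ} (N : ℕ) (Y : Fin n → Ω → ℝ) (v : ℝ → ℝ) : ℝ≥0∞ :=
  ∫⁻ ω, (∫⁻ t in Icc (0 : ℝ) 1,
    ENNReal.ofReal ((tauSqEst n N (fun i => Y i ω) t - v t) ^ 2)) ∂P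

/-- The supremum of the MISE of `τ̂²_N` over `σ² ∈ A` and `τ² ∈ B`. (The supremum over `Y` is one over
versions of the sample, all of which have the same MISE.) -/
def supMISE (mod : VolModel) (P : Measure Ω) (W : ℝ≥0 → Ω → ℝ) {n : ℕ} (e : Fin n → Ω → ℝ)
    (A B : Set (ℝ → ℝ)) (N : ℕ) : ℝ≥0∞ :=
  ⨆ (s : ℝ → ℝ) (_ : s ∈ A) (v : ℝ → ℝ) (_ : v ∈ B) (Y : Fin n → Ω → ℝ)
    (_ : IsSample mod P W e s v Y), MISE P N Y v

/-- The bound `N^{-2β} + N / n`. -/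
def riskBound (β : ℝ) (n N : ℕ) : ℝ := (N : ℝ) ^ (-(2 * β)) + (N : ℝ) / n

end NoisyVolatility

end

/-! Summation by parts turns the estimator into a squared norm: `t̂_{k,0} = ‖Z + A e‖²`, where `Z`
is the filtered sine transform of the signal increments and `A` (`noiseCoef`) acts on the errors
(`tHat_eq_normSq`). Its target is `∫ τ² f_k²`. Since `f_k² = 1 + cos(kπx)`, this equals `θ_0 + θ_k`
for `k ≥ 1` and `θ_0` for `k = 0`, so `t̂_{k,0} - t̂_{0,0}` estimates the cosine coefficient `θ_k`
(`weightedMean_eq`).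

Each coefficient has mean squared error `O(1/n)`, uniformly over the classes and over `k` with `k²
log² n ≤ n` (`integral_tHat_sub_sq_le`). Three estimates give this. Trace: `E‖Ae‖² = ‖A‖_F²`.
Differences of sines are again orthogonal, with squared norms `λ_j`, which the filter cancels. What
remains is a Riemann sum of `τ² f_k²` up to `O(n^{-1/2})` (`abs_sum_noiseCoef_sq_sub_le`), and `τ²`
is Hölder of order `1/2` because `β > 1`. Fluctuation: the squared operator norm of `A` is `O(1/n)`
(`sum_noiseCoef_mul_sq_le`). The variance of a quadratic form in independent errors is at most a
constant times the squared Frobenius norm of `AᵀA` (`integral_quadForm_sq_le`), hence also `O(1/n)`.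
Signal: cutting off the low frequencies bounds the filter weights by `2 log² n / n`. Signal
increments have fourth moments `O(n^{-4γ})` with `γ > 1/4` (`IsSample.exists_signal`), so `‖Z‖²` is
at most of order `log² n · n^{-2γ} = o(n^{-1/2})` in `L²(P)`, and the cross term is controlled by
the operator norm of `A`.

In the space-transformed model `γ` comes from the Hölder regularity of `σ²`, of any order below `α -
1/2`; this is the source of the threshold `3/4`. In the time-transformed model the increments are
Wiener integrals, whose fourth moments follow from the Gaussian law of step-function integrals, the
Itô isometry and Fatou's lemma.

Parseval's identity adds the `2N + 1` variance terms of size `1/n` and the tail `∑_{i>N} θ_i² =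
O(N^{-2β})` (`lintegral_cosSeries_sub_sq_le`, `MISE_le_of_integral_le`). The order of the minimizers
follows by comparison with the single cut-off `⌈n^{1/(2β+1)}⌉`. -/

noncomputable section

namespace NoisyVolatility

/-! ### Trigonometric sums and the discrete sine transform -/

/-- The Dirichlet kernel: after multiplication by `2 sin(x/2)` the sum telescopes. The phase `y`
serves sums over the integer grid (`y = 0`) and over the half-integer grid (`y = x/2`). -/
lemma two_sin_half_mul_sum_cos (x y : ℝ) (a b : ℕ) (hab : a ≤ b) :
    2 * Real.sin (x / 2) * ∑ p ∈ Finset.Ico a b, Real.cos (p * x + y)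
      = Real.sin (b * x - x / 2 + y) - Real.sin (a * x - x / 2 + y) := by
  induction b, hab using Nat.le_induction with
  | base => simp
  | succ b hb ih =>
    rw [Finset.sum_Ico_succ_top hb, mul_add, ih]
    have h1 : Real.sin (((b + 1 : ℕ) : ℝ) * x - x / 2 + y)
        = Real.sin ((b * x + y) + x / 2) := by
      congr 1; push_cast; ring
    have h2 : Real.sin ((b : ℝ) * x - x / 2 + y) = Real.sin ((b * x + y) - x / 2) := by
      congr 1; ring
    rw [h1, h2, Real.sin_add (b * x + y), Real.sin_sub (b * x + y)]
    ring

lemma sin_half_ne_zero {n : ℕ} {q : ℤ} (h0 : q ≠ 0) (h1 : |q| < 2 * n) :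
    Real.sin (q * Real.pi / n / 2) ≠ 0 := by
  have hn : 0 < (n : ℝ) := by
    have : 0 < n := by
      rcases Nat.eq_zero_or_pos n with h | h
      · subst h; have := abs_nonneg q; simp at h1; omega
      · exact h
    exact_mod_cast this
  intro h
  rw [Real.sin_eq_zero_iff] at h
  obtain ⟨r, hr⟩ := h
  have h2 : (r : ℝ) * (2 * n) = q := by
    field_simp at hr
    have := Real.pi_pos
    nlinarith
  have h3 : r * (2 * n) = q := by exact_mod_cast h2
  have hr0 : r ≠ 0 := by rintro rfl; simp at h3; exact h0 h3.symm
  have h4 : 1 ≤ |r| := Int.one_le_abs hr0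
  rw [← h3, abs_mul, abs_of_nonneg (by positivity : (0 : ℤ) ≤ 2 * n)] at h1
  nlinarith

lemma sum_cos_int {n : ℕ} {q : ℤ} (h0 : q ≠ 0) (h1 : |q| < 2 * n) :
    ∑ p ∈ Finset.range n, Real.cos (p * (q * Real.pi / n))
      = (1 - Real.cos (q * Real.pi)) / 2 := by
  have hs := sin_half_ne_zero h0 h1
  have hn : (n : ℝ) ≠ 0 := by
    rintro h; simp [h] at hs
  have h := two_sin_half_mul_sum_cos (q * Real.pi / n) 0 0 n (Nat.zero_le _)
  rw [← Finset.range_eq_Ico] at h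
  have e1 : Real.sin (n * (q * Real.pi / n) - q * Real.pi / n / 2 + 0)
      = - Real.cos (q * Real.pi) * Real.sin (q * Real.pi / n / 2) := by
    rw [add_zero, mul_div_cancel₀ _ hn, Real.sin_sub, Real.sin_int_mul_pi]; ring
  have e2 : Real.sin (((0 : ℕ) : ℝ) * (q * Real.pi / n) - q * Real.pi / n / 2 + 0)
      = - Real.sin (q * Real.pi / n / 2) := by
    rw [← Real.sin_neg]; congr 1; simp
  rw [e1, e2] at h
  simp only [add_zero] at h
  apply mul_left_cancel₀ (mul_ne_zero two_ne_zero hs)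
  rw [h]; ring

lemma sum_cos_half_int {n : ℕ} {q : ℤ} (h0 : q ≠ 0) (h1 : |q| < 2 * n) :
    ∑ p ∈ Finset.range n, Real.cos ((p + 1 / 2) * (q * Real.pi / n)) = 0 := by
  have hs := sin_half_ne_zero h0 h1
  have hn : (n : ℝ) ≠ 0 := by
    rintro h; simp [h] at hs
  have h := two_sin_half_mul_sum_cos (q * Real.pi / n) (q * Real.pi / n / 2) 0 n (Nat.zero_le _)
  rw [← Finset.range_eq_Ico] at h
  simp only [sub_add_cancel, mul_div_cancel₀ _ hn, Real.sin_int_mul_pi, Nat.cast_zero, zero_mul,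
    Real.sin_zero, sub_zero, mul_eq_zero] at h
  rcases h with h | h
  · exact absurd h (by simpa using hs)
  · rw [← h]; refine Finset.sum_congr rfl fun p _ => ?_
    congr 1; ring

/-- The sine transform with indices running over all natural numbers. -/
def dst (n i j : ℕ) : ℝ := √(2 / (n : ℝ)) * Real.sin (i * j * Real.pi / n)

lemma dst_comm (n i j : ℕ) : dst n i j = dst n j i := by
  unfold dst; congr 2; ring

@[simp] lemma dst_zero_left (n j : ℕ) : dst n 0 j = 0 := by simp [dst]

lemma dst_self_left (n j : ℕ) : dst n n j = 0 := by
  rcases Nat.eq_zero_or_pos n with h | h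
  · simp [h]
  have hn : (n : ℝ) ≠ 0 := by positivity
  have : (n : ℝ) * j * Real.pi / n = j * Real.pi := by field_simp
  rw [dst, this, Real.sin_nat_mul_pi, mul_zero]

lemma cos_parity (i j : ℕ) :
    Real.cos (((i : ℤ) - j : ℤ) * Real.pi) = Real.cos (((i : ℤ) + j : ℤ) * Real.pi) := by
  have : (((i : ℤ) + j : ℤ) : ℝ) * Real.pi = ((i : ℤ) - j : ℤ) * Real.pi + j * (2 * Real.pi) := by
    push_cast; ring
  rw [this, Real.cos_add_nat_mul_two_pi]

/-- The product of sines splits into the frequencies `i - j` and `i + j`. These have the same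
parity, so for `i ≠ j` the two sums `(1 - cos qπ)/2` cancel. -/
lemma sum_dst_mul_dst {n i j : ℕ} (hi : 1 ≤ i) (hin : i < n) (hj : 1 ≤ j) (hjn : j < n) :
    ∑ p ∈ Finset.range n, dst n p i * dst n p j = if i = j then 1 else 0 := by
  have hn : (0 : ℝ) < n := by exact_mod_cast (by omega : 0 < n)
  have hterm : ∀ p : ℕ, dst n p i * dst n p j
      = (1 / n) * (Real.cos (p * (((i : ℤ) - j : ℤ) * Real.pi / n))
        - Real.cos (p * (((i : ℤ) + j : ℤ) * Real.pi / n))) := by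
    intro p
    have h2 : √(2 / (n : ℝ)) * √(2 / (n : ℝ)) = 2 / n := Real.mul_self_sqrt (by positivity)
    have e1 : (p : ℝ) * (((i : ℤ) - j : ℤ) * Real.pi / n)
        = p * i * Real.pi / n - p * j * Real.pi / n := by push_cast; ring
    have e2 : (p : ℝ) * (((i : ℤ) + j : ℤ) * Real.pi / n)
        = p * i * Real.pi / n + p * j * Real.pi / n := by push_cast; ring
    rw [e1, e2, Real.cos_sub, Real.cos_add, dst, dst]
    calc _ = (√(2 / (n : ℝ)) * √(2 / (n : ℝ))) * (Real.sin (p * i * Real.pi / n)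
            * Real.sin (p * j * Real.pi / n)) := by ring
      _ = _ := by rw [h2]; ring
  simp_rw [hterm]
  rw [← Finset.mul_sum, Finset.sum_sub_distrib]
  rw [sum_cos_int (q := (i : ℤ) + j) (by omega) (by rw [abs_lt]; omega)]
  split_ifs with h
  · subst h
    have := cos_parity i i
    simp only [sub_self, Int.cast_zero, zero_mul, Real.cos_zero] at this
    rw [← this]
    simp
    field_simp
  · rw [sum_cos_int (q := (i : ℤ) - j) (by omega) (by rw [abs_lt]; omega), cos_parity]
    simp

lemma dst_succ_sub (n p j : ℕ) : dst n (p + 1) j - dst n p j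
    = √(2 / (n : ℝ)) * (2 * Real.sin (j * Real.pi / (2 * n)))
        * Real.cos ((p + 1 / 2) * (j * Real.pi / n)) := by
  unfold dst
  rw [← mul_sub, Real.sin_sub_sin]
  have e1 : (((p + 1 : ℕ) : ℝ) * j * Real.pi / n - p * j * Real.pi / n) / 2
      = j * Real.pi / (2 * n) := by
    push_cast; rw [mul_comm 2 (n : ℝ), ← div_div]; ring
  have e2 : (((p + 1 : ℕ) : ℝ) * j * Real.pi / n + p * j * Real.pi / n) / 2
      = (p + 1 / 2) * (j * Real.pi / n) := by push_cast; ring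
  rw [e1, e2]; ring

lemma dst_succ_sub_sq (n p j : ℕ) : (dst n (p + 1) j - dst n p j) ^ 2
    = 1 / n * lam n j * (1 + Real.cos (j * ((2 * p + 1) * Real.pi / n))) := by
  have h2 : √(2 / (n : ℝ)) ^ 2 = 2 / n := Real.sq_sqrt (by positivity)
  have e : (j : ℝ) * ((2 * p + 1) * Real.pi / n) = 2 * ((p + 1 / 2) * (j * Real.pi / n)) := by ring
  rw [dst_succ_sub, mul_pow, mul_pow, h2, e, Real.cos_two_mul, lam]
  ring

/-- Differencing turns sines into cosines at the half-integer points, where every nonzero frequency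
sums to zero exactly. This is the diagonalization of the discrete Laplacian: the differenced basis
stays orthogonal, with squared norms `λ_i`. -/
lemma sum_dst_sub_mul_dst_sub {n i j : ℕ} (hi : 1 ≤ i) (hin : i < n) (hj : 1 ≤ j) (hjn : j < n) :
    ∑ p ∈ Finset.range n, (dst n (p + 1) i - dst n p i) * (dst n (p + 1) j - dst n p j)
      = if i = j then lam n i else 0 := by
  have hn : (0 : ℝ) < n := by exact_mod_cast (by omega : 0 < n)
  have hterm : ∀ p : ℕ, (dst n (p + 1) i - dst n p i) * (dst n (p + 1) j - dst n p j)
      = (4 / n * Real.sin (i * Real.pi / (2 * n)) * Real.sin (j * Real.pi / (2 * n)))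
        * (Real.cos ((p + 1 / 2) * (((i : ℤ) - j : ℤ) * Real.pi / n))
        + Real.cos ((p + 1 / 2) * (((i : ℤ) + j : ℤ) * Real.pi / n))) := by
    intro p
    have h2 : √(2 / (n : ℝ)) * √(2 / (n : ℝ)) = 2 / n := Real.mul_self_sqrt (by positivity)
    have e1 : ((p : ℝ) + 1 / 2) * (((i : ℤ) - j : ℤ) * Real.pi / n)
        = (p + 1 / 2) * (i * Real.pi / n) - (p + 1 / 2) * (j * Real.pi / n) := by push_cast; ring
    have e2 : ((p : ℝ) + 1 / 2) * (((i : ℤ) + j : ℤ) * Real.pi / n)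
        = (p + 1 / 2) * (i * Real.pi / n) + (p + 1 / 2) * (j * Real.pi / n) := by push_cast; ring
    rw [e1, e2, Real.cos_sub, Real.cos_add, dst_succ_sub, dst_succ_sub]
    linear_combination (4 * Real.sin (i * Real.pi / (2 * n)) * Real.sin (j * Real.pi / (2 * n))
      * Real.cos ((p + 1 / 2) * (i * Real.pi / n)) * Real.cos ((p + 1 / 2) * (j * Real.pi / n))) * h2
  simp_rw [hterm]
  rw [← Finset.mul_sum, Finset.sum_add_distrib]
  rw [sum_cos_half_int (q := (i : ℤ) + j) (by omega) (by rw [abs_lt]; omega)]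
  split_ifs with h
  · subst h
    simp [lam]
    field_simp
  · rw [sum_cos_half_int (q := (i : ℤ) - j) (by omega) (by rw [abs_lt]; omega)]
    simp

lemma sum_sq_of_orthogonal {ι κ : Type*} [Fintype ι] [Fintype κ] [DecidableEq κ] (u : ι → κ → ℝ)
    (d : κ → ℝ)
    (h : ∀ j j', ∑ p, u p j * u p j' = if j = j' then d j else 0) (c : κ → ℝ) :
    ∑ p, (∑ j, c j * u p j) ^ 2 = ∑ j, c j ^ 2 * d j := by
  have : ∀ p, (∑ j, c j * u p j) ^ 2 = ∑ j, ∑ j', c j * c j' * (u p j * u p j') := by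
    intro p
    rw [sq, Finset.sum_mul_sum]
    exact Finset.sum_congr rfl fun _ _ => Finset.sum_congr rfl fun _ _ => by ring
  simp_rw [this]
  rw [Finset.sum_comm]
  refine Finset.sum_congr rfl fun j _ => ?_
  rw [Finset.sum_comm]
  simp_rw [← Finset.mul_sum, h]
  simp [sq]

/-- Parseval's identity for the sine transform. -/
lemma sum_dst_sq (m : ℕ) (c : Fin m → ℝ) :
    ∑ p : Fin (m + 1), (∑ j : Fin m, c j * dst (m + 1) p (j + 1)) ^ 2 = ∑ j, c j ^ 2 := by
  have := sum_sq_of_orthogonal (fun (p : Fin (m + 1)) (j : Fin m) => dst (m + 1) p (j + 1))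
    (fun _ => 1) (fun j j' => ?_) c
  · simpa using this
  · rw [Fin.sum_univ_eq_sum_range (fun p => dst (m + 1) p (j + 1) * dst (m + 1) p (j' + 1)) (m + 1),
      sum_dst_mul_dst (by omega) (by omega) (by omega) (by omega)]
    simp [Fin.ext_iff]

lemma sum_dst_sq' (m : ℕ) (c : Fin m → ℝ) :
    ∑ j : Fin m, (∑ i : Fin m, c i * dst (m + 1) (i + 1) (j + 1)) ^ 2 = ∑ j, c j ^ 2 := by
  rw [← sum_dst_sq m c, Fin.sum_univ_succ]
  simp [dst_comm (m + 1) (_ + 1) (_ + 1)]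

/-- Parseval's identity for the differences of the sine transform. -/
lemma sum_dst_sub_sq (m : ℕ) (c : Fin m → ℝ) :
    ∑ p : Fin (m + 1), (∑ j : Fin m, c j * (dst (m + 1) (p + 1) (j + 1) - dst (m + 1) p (j + 1))) ^ 2
      = ∑ j : Fin m, c j ^ 2 * lam (m + 1) (j + 1) := by
  refine sum_sq_of_orthogonal
    (fun (p : Fin (m + 1)) (j : Fin m) => dst (m + 1) (p + 1) (j + 1) - dst (m + 1) p (j + 1))
    (fun j => lam (m + 1) (j + 1)) (fun j j' => ?_) c
  rw [Fin.sum_univ_eq_sum_range (fun p => (dst (m + 1) (p + 1) (j + 1) - dst (m + 1) p (j + 1))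
      * (dst (m + 1) (p + 1) (j' + 1) - dst (m + 1) p (j' + 1))) (m + 1),
    sum_dst_sub_mul_dst_sub (by omega) (by omega) (by omega) (by omega)]
  simp [Fin.ext_iff]

/-- Moves the difference from the errors, whose increments are correlated, to the coefficients. The
sine basis vanishes at both ends, so no boundary terms arise. -/
lemma sum_by_parts (m : ℕ) (g : ℕ → ℝ) (η : Fin (m + 1) → ℝ) (h0 : g 0 = 0) (h1 : g (m + 1) = 0) :
    ∑ i : Fin m, g (i + 1) * (η i.succ - η i.castSucc) = ∑ p : Fin (m + 1), (g p - g (p + 1)) * η p := by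
  simp_rw [mul_sub, sub_mul, Finset.sum_sub_distrib]
  congr 1
  · rw [Fin.sum_univ_succ]; simp [h0]
  · rw [Fin.sum_univ_castSucc]; simp [h1]

/-! ### Quadratic forms in independent errors -/

section QuadraticForms

variable {Ω : Type*} [MeasurableSpace Ω] {P : Measure Ω}

lemma memLp_two_mul {f g : Ω → ℝ} (hf : MemLp f 4 P) (hg : MemLp g 4 P) :
    MemLp (fun ω => f ω * g ω) 2 P := by
  have : ENNReal.HolderTriple 4 4 2 := ⟨by
    rw [show (4 : ℝ≥0∞) = 2 * 2 by norm_num,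
      ENNReal.mul_inv (Or.inl (by norm_num)) (Or.inl (by norm_num)), ← mul_add,
      ENNReal.inv_two_add_inv_two, mul_one]⟩
  exact MemLp.mul (p := 4) (q := 4) hg hf

lemma memLp_two_sq {f : Ω → ℝ} (hf : MemLp f 4 P) : MemLp (fun ω => f ω ^ 2) 2 P := by
  simpa only [sq] using memLp_two_mul hf hf

lemma memLp_two_of_four [IsProbabilityMeasure P] {f : Ω → ℝ} (hf : MemLp f 4 P) : MemLp f 2 P :=
  hf.mono_exponent (by norm_num)

lemma integrable_mul_of_two {f g : Ω → ℝ} (hf : MemLp f 2 P) (hg : MemLp g 2 P) :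
    Integrable (fun ω => f ω * g ω) P :=
  MemLp.integrable_mul hf hg

lemma integrable_pow_four {f : Ω → ℝ} (hf : MemLp f 4 P) : Integrable (fun ω => f ω ^ 4) P := by
  have := (memLp_two_sq hf).integrable_sq
  simpa only [← pow_mul] using this

variable {n : ℕ} {e : Fin n → Ω → ℝ}

/-- Functions of the errors with indices below `q` are uncorrelated with functions of error `q`. -/
lemma integral_mul_of_lt (hind : iIndepFun e P) (hae : ∀ i, AEMeasurable (e i) P) (q : Fin n)
    (φ : (Fin n → ℝ) → ℝ) (hφ : Measurable φ)
    (hdep : ∀ x y : Fin n → ℝ, (∀ r < q, x r = y r) → φ x = φ y)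
    (ψ : ℝ → ℝ) (hψ : Measurable ψ) :
    ∫ ω, φ (fun i => e i ω) * ψ (e q ω) ∂P
      = (∫ ω, φ (fun i => e i ω) ∂P) * ∫ ω, ψ (e q ω) ∂P := by
  classical
  have hI := hind.indepFun_finset₀ (Finset.Iio q) {q} (by simp) hae
  -- Padding by zeros makes `φ` a function of the errors below `q` alone; by `hdep` the padded
  -- values do not matter.
  let ext : (Finset.Iio q → ℝ) → (Fin n → ℝ) := fun y r =>
    if h : r ∈ Finset.Iio q then y ⟨r, h⟩ else 0
  have hext : Measurable ext := by
    refine measurable_pi_lambda _ fun r => ?_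
    by_cases h : r ∈ Finset.Iio q
    · simp only [ext, h, dite_true]; exact measurable_pi_apply _
    · simp only [ext, h, dite_false]; exact measurable_const
  have hc := hI.comp (hφ.comp hext)
    (hψ.comp (measurable_pi_apply (⟨q, by simp⟩ : ({q} : Finset (Fin n)))))
  have e1 : (φ ∘ ext) ∘ (fun ω (i : Finset.Iio q) => e i ω) = fun ω => φ (fun i => e i ω) := by
    funext ω
    refine hdep _ _ fun r hr => ?_
    simp [ext, hr]
  rw [e1] at hc
  refine IndepFun.integral_fun_mul_eq_mul_integral hc ?_ ?_
  · exact (hφ.comp_aemeasurable (aemeasurable_pi_lambda _ hae)).aestronglyMeasurable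
  · exact (hψ.comp_aemeasurable (hae q)).aestronglyMeasurable

lemma integral_mul_error (hind : iIndepFun e P) (h2 : ∀ i, MemLp (e i) 2 P)
    (hmean : ∀ i, ∫ ω, e i ω ∂P = 0) (hvar : ∀ i, ∫ ω, e i ω ^ 2 ∂P = 1) (i j : Fin n) :
    ∫ ω, e i ω * e j ω ∂P = if i = j then 1 else 0 := by
  split_ifs with h
  · subst h; simpa only [sq] using hvar i
  · rw [(hind.indepFun h).integral_fun_mul_eq_mul_integral (h2 i).1 (h2 j).1, hmean, zero_mul]

lemma integral_linear_sq (hind : iIndepFun e P) (h2 : ∀ i, MemLp (e i) 2 P)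
    (hmean : ∀ i, ∫ ω, e i ω ∂P = 0) (hvar : ∀ i, ∫ ω, e i ω ^ 2 ∂P = 1) (s : Finset (Fin n))
    (c : Fin n → ℝ) : ∫ ω, (∑ i ∈ s, c i * e i ω) ^ 2 ∂P = ∑ i ∈ s, c i ^ 2 := by
  have : ∀ ω, (∑ i ∈ s, c i * e i ω) ^ 2
      = ∑ i ∈ s, ∑ j ∈ s, (c i * c j) * (e i ω * e j ω) := by
    intro ω
    rw [sq, Finset.sum_mul_sum]
    exact Finset.sum_congr rfl fun _ _ => Finset.sum_congr rfl fun _ _ => by ring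
  simp_rw [this]
  have hint : ∀ i j, Integrable (fun ω => (c i * c j) * (e i ω * e j ω)) P := fun i j =>
    (integrable_mul_of_two (h2 i) (h2 j)).const_mul _
  rw [integral_finsetSum _ fun i _ => integrable_finsetSum _ fun j _ => hint i j]
  refine Finset.sum_congr rfl fun i hi => ?_
  rw [integral_finsetSum _ fun j _ => hint i j]
  simp_rw [integral_const_mul, integral_mul_error hind h2 hmean hvar]
  simp [hi, sq]

/-- The grouping by the larger index, which turns a quadratic form into a sum of martingale
differences. -/
lemma sum_sum_symm (f : Fin n → Fin n → ℝ) (hf : ∀ p q, f p q = f q p) :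
    ∑ p, ∑ q, f p q = ∑ p, (f p p + 2 * ∑ r ∈ Finset.Iio p, f p r) := by
  have h1 : ∀ p, ∑ q, f p q
      = f p p + ∑ r ∈ Finset.Iio p, f p r + ∑ q, (if p < q then f q p else 0) := by
    intro p
    have e1 : ∑ r ∈ Finset.Iio p, f p r = ∑ q, if q < p then f p q else 0 := by
      rw [← Finset.sum_filter]; congr 1; ext; simp
    have e2 : f p p = ∑ q, if q = p then f p q else 0 := by simp
    rw [e1, e2, ← Finset.sum_add_distrib, ← Finset.sum_add_distrib]
    refine Finset.sum_congr rfl fun q _ => ?_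
    rcases lt_trichotomy q p with h | h | h
    · simp [h, h.ne, h.not_gt]
    · simp [h]
    · simp [h, h.ne', h.not_gt, hf p q]
  simp_rw [h1]
  rw [Finset.sum_add_distrib, Finset.sum_comm]
  rw [← Finset.sum_add_distrib]
  refine Finset.sum_congr rfl fun p _ => ?_
  have e1 : ∑ r ∈ Finset.Iio p, f p r = ∑ q, if q < p then f p q else 0 := by
    rw [← Finset.sum_filter]; congr 1; ext; simp
  rw [e1]; ring

variable [IsProbabilityMeasure P]

/-- The second moment of a centered quadratic form in independent standardized errors. -/
lemma integral_quadForm_sq_le (hind : iIndepFun e P) (h4 : ∀ i, MemLp (e i) 4 P)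
    (hmean : ∀ i, ∫ ω, e i ω ∂P = 0) (hvar : ∀ i, ∫ ω, e i ω ^ 2 ∂P = 1) {M : ℝ} (hM1 : 1 ≤ M)
    (hM : ∀ i, ∫ ω, e i ω ^ 4 ∂P ≤ M) (G : Fin n → Fin n → ℝ) (hG : ∀ p q, G p q = G q p) :
    MemLp (fun ω => ∑ p, ∑ q, G p q * (e p ω * e q ω) - ∑ p, G p p) 2 P ∧
    ∫ ω, (∑ p, ∑ q, G p q * (e p ω * e q ω) - ∑ p, G p p) ^ 2 ∂P
      ≤ 8 * M * ∑ p, ∑ q, G p q ^ 2 := by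
  have h2 : ∀ i, MemLp (e i) 2 P := fun i => memLp_two_of_four (h4 i)
  have hae : ∀ i, AEMeasurable (e i) P := fun i => (h4 i).1.aemeasurable
  let lf : Fin n → (Fin n → ℝ) → ℝ := fun q x => 2 * ∑ r ∈ Finset.Iio q, G q r * x r
  -- The martingale differences of the centered form: everything in it whose largest index is `q`.
  -- Both parts have mean zero given the errors below `q`, hence distinct differences are
  -- orthogonal.
  let df : Fin n → (Fin n → ℝ) → ℝ := fun q x => G q q * (x q ^ 2 - 1) + x q * lf q x
  have hlfm : ∀ q, Measurable (lf q) := fun q => by fun_prop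
  have hdfm : ∀ q, Measurable (df q) := fun q => by fun_prop
  have hlfd : ∀ (q : Fin n) (x y : Fin n → ℝ), (∀ r < q, x r = y r) → lf q x = lf q y := by
    intro q x y h
    simp only [lf]
    congr 1
    exact Finset.sum_congr rfl fun r hr => by rw [h r (Finset.mem_Iio.1 hr)]
  have hdfd : ∀ (p q : Fin n) (x y : Fin n → ℝ), p < q → (∀ r < q, x r = y r) →
      df p x = df p y := by
    intro p q x y hpq h
    simp only [df]
    rw [h p hpq, hlfd p x y fun r hr => h r (hr.trans hpq)]
  have hL4 : ∀ q, MemLp (fun ω => lf q (fun i => e i ω)) 4 P := fun q =>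
    (memLp_finsetSum _ fun r _ => (h4 r).const_mul _).const_mul _
  have hS2 : ∀ q, MemLp (fun ω => e q ω ^ 2 - 1) 2 P := fun q =>
    (memLp_two_sq (h4 q)).sub (memLp_const _)
  have hEL2 : ∀ q, MemLp (fun ω => e q ω * lf q (fun i => e i ω)) 2 P := fun q =>
    memLp_two_mul (h4 q) (hL4 q)
  have hD2 : ∀ q, MemLp (fun ω => df q (fun i => e i ω)) 2 P := fun q =>
    ((hS2 q).const_mul _).add (hEL2 q)
  have hint1 : ∀ q, Integrable (fun ω => e q ω) P := fun q => (h2 q).integrable (by norm_num)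
  have hsqm : ∀ q, ∫ ω, (e q ω ^ 2 - 1) ∂P = 0 := fun q => by
    rw [integral_sub (h2 q).integrable_sq (integrable_const _), hvar]; simp
  have hkey : ∀ ω, ∑ p, ∑ q, G p q * (e p ω * e q ω) - ∑ p, G p p
      = ∑ q, df q (fun i => e i ω) := by
    intro ω
    rw [sum_sum_symm (fun p q => G p q * (e p ω * e q ω)) (fun p q => by
      rw [hG p q]; ring), ← Finset.sum_sub_distrib]
    refine Finset.sum_congr rfl fun q _ => ?_
    simp only [df, lf]
    have : ∑ r ∈ Finset.Iio q, G q r * (e q ω * e r ω)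
        = e q ω * ∑ r ∈ Finset.Iio q, G q r * e r ω := by
      rw [Finset.mul_sum]; exact Finset.sum_congr rfl fun _ _ => by ring
    rw [this]; ring
  simp_rw [hkey]
  refine ⟨memLp_finsetSum _ fun q _ => hD2 q, ?_⟩
  have horth : ∀ p q, p < q → ∫ ω, df p (fun i => e i ω) * df q (fun i => e i ω) ∂P = 0 := by
    intro p q hpq
    have e1 : ∀ ω, df p (fun i => e i ω) * df q (fun i => e i ω)
        = G q q * (df p (fun i => e i ω) * (e q ω ^ 2 - 1))
          + df p (fun i => e i ω) * (e q ω * lf q (fun i => e i ω)) := by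
      intro ω; simp only [df]; ring
    simp_rw [e1]
    rw [integral_add ((integrable_mul_of_two (hD2 p) (hS2 q)).const_mul _)
      (integrable_mul_of_two (hD2 p) (hEL2 q)), integral_const_mul,
      integral_mul_of_lt hind hae q (df p) (hdfm p) (fun x y h => hdfd p q x y hpq h)
        (fun x => x ^ 2 - 1) (by fun_prop), hsqm]
    have e2 : ∀ ω, df p (fun i => e i ω) * (e q ω * lf q (fun i => e i ω))
        = (fun x => df p x * lf q x) (fun i => e i ω) * id (e q ω) := by
      intro ω; simp only [id]; ring
    simp_rw [e2]
    rw [integral_mul_of_lt hind hae q (fun x => df p x * lf q x) ((hdfm p).mul (hlfm q))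
        (fun x y h => by rw [hdfd p q x y hpq h, hlfd q x y h]) id measurable_id]
    simp [hmean]
  have hdiag : ∀ q, ∫ ω, df q (fun i => e i ω) * df q (fun i => e i ω) ∂P
      ≤ 2 * M * G q q ^ 2 + 8 * ∑ r ∈ Finset.Iio q, G q r ^ 2 := by
    intro q
    have e1 : ∀ ω, df q (fun i => e i ω) * df q (fun i => e i ω)
        ≤ 2 * G q q ^ 2 * (e q ω ^ 2 - 1) ^ 2
          + 2 * ((fun x => lf q x ^ 2) (fun i => e i ω) * (fun x => x ^ 2) (e q ω)) := by
      intro ω; simp only [df]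
      nlinarith [sq_nonneg (G q q * (e q ω ^ 2 - 1) - e q ω * lf q (fun i => e i ω))]
    have i1 : Integrable (fun ω => 2 * G q q ^ 2 * (e q ω ^ 2 - 1) ^ 2) P :=
      (hS2 q).integrable_sq.const_mul _
    have i2 : Integrable (fun ω => 2 * ((fun x => lf q x ^ 2) (fun i => e i ω)
        * (fun x => x ^ 2) (e q ω))) P := by
      refine Integrable.const_mul ?_ _
      have := (hEL2 q).integrable_sq
      refine this.congr (ae_of_all _ fun ω => ?_)
      simp only; ring
    refine (integral_mono (integrable_mul_of_two (hD2 q) (hD2 q)) (i1.add i2) e1).trans ?_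
    simp only [Pi.add_apply]
    rw [integral_add i1 i2, integral_const_mul, integral_const_mul,
      integral_mul_of_lt hind hae q (fun x => lf q x ^ 2) ((hlfm q).pow_const 2)
        (fun x y h => by rw [hlfd q x y h]) (fun x => x ^ 2) (by fun_prop), hvar]
    have e3 : ∫ ω, (fun x => lf q x ^ 2) (fun i => e i ω) ∂P
        = 4 * ∑ r ∈ Finset.Iio q, G q r ^ 2 := by
      simp only [lf, mul_pow]
      rw [integral_const_mul, integral_linear_sq hind h2 hmean hvar]
      norm_num
    have e4 : ∫ ω, (e q ω ^ 2 - 1) ^ 2 ∂P ≤ M := by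
      have : ∀ ω, (e q ω ^ 2 - 1) ^ 2 = e q ω ^ 4 - (2 * e q ω ^ 2 - 1) := fun ω => by ring
      simp_rw [this]
      have i5 : Integrable (fun ω => 2 * e q ω ^ 2 - 1) P :=
        ((h2 q).integrable_sq.const_mul 2).sub (integrable_const _)
      rw [integral_sub (integrable_pow_four (h4 q)) i5, integral_sub ((h2 q).integrable_sq.const_mul 2) (integrable_const _),
        integral_const_mul, hvar]
      have := hM q
      simp only [integral_const, probReal_univ, smul_eq_mul]
      linarith
    rw [e3]
    have := mul_le_mul_of_nonneg_left e4 (by positivity : 0 ≤ 2 * G q q ^ 2)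
    linarith
  have hexp : ∀ ω, (∑ q, df q (fun i => e i ω)) ^ 2
      = ∑ p, ∑ q, df p (fun i => e i ω) * df q (fun i => e i ω) := fun ω => by
    rw [sq, Finset.sum_mul_sum]
  simp_rw [hexp]
  rw [integral_finsetSum _ fun p _ => integrable_finsetSum _ fun q _ =>
    integrable_mul_of_two (hD2 p) (hD2 q)]
  have hrow : ∀ p, ∫ ω, ∑ q, df p (fun i => e i ω) * df q (fun i => e i ω) ∂P
      = ∫ ω, df p (fun i => e i ω) * df p (fun i => e i ω) ∂P := by
    intro p
    rw [integral_finsetSum _ fun q _ => integrable_mul_of_two (hD2 p) (hD2 q)]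
    refine Finset.sum_eq_single p (fun q _ hq => ?_) (by simp)
    rcases lt_or_gt_of_ne hq with h | h
    · rw [← horth q p h]; exact integral_congr_ae (ae_of_all _ fun ω => mul_comm _ _)
    · exact horth p q h
  simp_rw [hrow]
  -- The squared entries are grouped in the same way. Then `2M G_qq² + 8 ∑ G_qr² ≤ 8M (G_qq² + 2 ∑
  -- G_qr²)` because `M ≥ 1`.
  rw [sum_sum_symm (fun p q => G p q ^ 2) (fun p q => by rw [hG p q]), Finset.mul_sum]
  refine Finset.sum_le_sum fun q _ => (hdiag q).trans ?_
  have h0 : 0 ≤ ∑ r ∈ Finset.Iio q, G q r ^ 2 := Finset.sum_nonneg fun _ _ => sq_nonneg _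
  nlinarith [mul_nonneg (sub_nonneg.2 hM1) h0, sq_nonneg (G q q),
    mul_nonneg (sub_nonneg.2 hM1) (sq_nonneg (G q q))]

/-- Given `Z`, the sum is linear in standardized uncorrelated errors, so its second moment is the
sum of its squared coefficients. -/
lemma integral_linear_random_sq (hind : iIndepFun e P) (h4 : ∀ i, MemLp (e i) 4 P)
    (hmean : ∀ i, ∫ ω, e i ω ∂P = 0) (hvar : ∀ i, ∫ ω, e i ω ^ 2 ∂P = 1)
    {κ : Type*} [Fintype κ] (Z : κ → Ω → ℝ) (hZ : ∀ k, MemLp (Z k) 4 P)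
    (hZe : IndepFun (fun ω k => Z k ω) (fun ω i => e i ω) P) (A : κ → Fin n → ℝ) :
    ∫ ω, (∑ i, (∑ k, A k i * Z k ω) * e i ω) ^ 2 ∂P = ∫ ω, ∑ i, (∑ k, A k i * Z k ω) ^ 2 ∂P := by
  have h2 : ∀ i, MemLp (e i) 2 P := fun i => memLp_two_of_four (h4 i)
  have hV4 : ∀ i, MemLp (fun ω => ∑ k, A k i * Z k ω) 4 P := fun i =>
    memLp_finsetSum _ fun k _ => (hZ k).const_mul _
  have hexp : ∀ ω, (∑ i, (∑ k, A k i * Z k ω) * e i ω) ^ 2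
      = ∑ i, ∑ j, ((∑ k, A k i * Z k ω) * (∑ k, A k j * Z k ω)) * (e i ω * e j ω) := by
    intro ω
    rw [sq, Finset.sum_mul_sum]
    exact Finset.sum_congr rfl fun _ _ => Finset.sum_congr rfl fun _ _ => by ring
  have hint : ∀ i j, Integrable (fun ω => ((∑ k, A k i * Z k ω) * (∑ k, A k j * Z k ω))
      * (e i ω * e j ω)) P := fun i j =>
    integrable_mul_of_two (memLp_two_mul (hV4 i) (hV4 j)) (memLp_two_mul (h4 i) (h4 j))
  have hprod : ∀ i j, ∫ ω, ((∑ k, A k i * Z k ω) * (∑ k, A k j * Z k ω)) * (e i ω * e j ω) ∂P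
      = (∫ ω, (∑ k, A k i * Z k ω) * (∑ k, A k j * Z k ω) ∂P) * if i = j then 1 else 0 := by
    intro i j
    rw [← integral_mul_error hind h2 hmean hvar i j]
    have hc := hZe.comp (φ := fun z : κ → ℝ => (∑ k, A k i * z k) * (∑ k, A k j * z k))
      (ψ := fun x : Fin n → ℝ => x i * x j) (by fun_prop) (by fun_prop)
    exact IndepFun.integral_fun_mul_eq_mul_integral hc
      (memLp_two_mul (hV4 i) (hV4 j)).1 (memLp_two_mul (h4 i) (h4 j)).1
  simp_rw [hexp]
  rw [integral_finsetSum _ fun i _ => integrable_finsetSum _ fun j _ => hint i j,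
    integral_finsetSum _ fun i _ => (memLp_two_of_four (hV4 i)).integrable_sq]
  refine Finset.sum_congr rfl fun i _ => ?_
  rw [integral_finsetSum _ fun j _ => hint i j]
  simp_rw [hprod]
  simp [sq]

/-- The mean squared deviation of `‖Z + A e‖²`, where the errors `e` are independent of `Z`. -/
lemma integral_normSq_sub_sq_le (hind : iIndepFun e P) (h4 : ∀ i, MemLp (e i) 4 P)
    (hmean : ∀ i, ∫ ω, e i ω ∂P = 0) (hvar : ∀ i, ∫ ω, e i ω ^ 2 ∂P = 1) {M : ℝ} (hM1 : 1 ≤ M)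
    (hM : ∀ i, ∫ ω, e i ω ^ 4 ∂P ≤ M)
    {κ : Type*} [Fintype κ] (Z : κ → Ω → ℝ) (hZ : ∀ k, MemLp (Z k) 4 P)
    (hZe : IndepFun (fun ω k => Z k ω) (fun ω i => e i ω) P) (A : κ → Fin n → ℝ)
    {κ₀ : ℝ} (hκ : ∀ y : κ → ℝ, ∑ i, (∑ k, A k i * y k) ^ 2 ≤ κ₀ * ∑ k, y k ^ 2) (hκ0 : 0 ≤ κ₀)
    {ρ : ℝ} (hρ : 0 ≤ ρ) (hZρ : ∫ ω, (∑ k, Z k ω ^ 2) ^ 2 ∂P ≤ ρ ^ 2) (μ : ℝ) :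
    Integrable (fun ω => (∑ k, (Z k ω + ∑ i, A k i * e i ω) ^ 2 - μ) ^ 2) P ∧
    ∫ ω, (∑ k, (Z k ω + ∑ i, A k i * e i ω) ^ 2 - μ) ^ 2 ∂P
      ≤ 4 * (8 * M * (κ₀ * ∑ k, ∑ i, A k i ^ 2)) + 4 * ((∑ k, ∑ i, A k i ^ 2) - μ) ^ 2
        + 16 * (κ₀ * ρ) + 4 * ρ ^ 2 := by
  set T := ∑ k, ∑ i, A k i ^ 2 with hT
  let G : Fin n → Fin n → ℝ := fun p q => ∑ k, A k p * A k q
  have hGsymm : ∀ p q, G p q = G q p := fun p q =>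
    Finset.sum_congr rfl fun _ _ => mul_comm _ _
  obtain ⟨hQ2, hQ⟩ := integral_quadForm_sq_le hind h4 hmean hvar hM1 hM G hGsymm
  set Qf : Ω → ℝ := fun ω => ∑ p, ∑ q, G p q * (e p ω * e q ω) - ∑ p, G p p with hQf
  have hGT : ∑ p, G p p = T := by
    simp only [G]
    rw [Finset.sum_comm]
    exact Finset.sum_congr rfl fun _ _ => Finset.sum_congr rfl fun _ _ => (sq _).symm
  -- `G = AᵀA`, and row `p` of `G` is `Aᵀ` applied to column `p` of `A`. The operator norm bound
  -- therefore applies row by row.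
  have hG2 : ∑ p, ∑ q, G p q ^ 2 ≤ κ₀ * T := by
    have h1 : ∀ p, ∑ q, G p q ^ 2 ≤ κ₀ * ∑ k, A k p ^ 2 := by
      intro p
      refine le_trans (le_of_eq ?_) (hκ (fun k => A k p))
      exact Finset.sum_congr rfl fun q _ => by rw [hGsymm p q]
    refine (Finset.sum_le_sum fun p _ => h1 p).trans (le_of_eq ?_)
    rw [← Finset.mul_sum, hT, Finset.sum_comm]
  have hE4 : ∀ k, MemLp (fun ω => ∑ i, A k i * e i ω) 4 P := fun k =>
    memLp_finsetSum _ fun i _ => (h4 i).const_mul _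
  let C : Ω → ℝ := fun ω => ∑ i, (∑ k, A k i * Z k ω) * e i ω
  have hC2 : MemLp C 2 P := memLp_finsetSum _ fun i _ =>
    memLp_two_mul (memLp_finsetSum _ fun k _ => (hZ k).const_mul _) (h4 i)
  let R : Ω → ℝ := fun ω => ∑ k, Z k ω ^ 2
  have hR2 : MemLp R 2 P := memLp_finsetSum _ fun k _ => memLp_two_sq (hZ k)
  -- Centered quadratic form, deterministic bias of the trace, cross term, and pure signal term.
  have hdecomp : ∀ ω, ∑ k, (Z k ω + ∑ i, A k i * e i ω) ^ 2 - μ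
      = Qf ω + (T - μ) + 2 * C ω + R ω := by
    intro ω
    have e1 : ∀ k, (Z k ω + ∑ i, A k i * e i ω) ^ 2
        = Z k ω ^ 2 + 2 * (Z k ω * ∑ i, A k i * e i ω) + (∑ i, A k i * e i ω) ^ 2 :=
      fun k => by ring
    have e2 : ∑ k, Z k ω * ∑ i, A k i * e i ω = C ω := by
      simp only [C, Finset.mul_sum, Finset.sum_mul]
      rw [Finset.sum_comm]
      exact Finset.sum_congr rfl fun _ _ => Finset.sum_congr rfl fun _ _ => by ring
    have e3 : ∑ k, (∑ i, A k i * e i ω) ^ 2 = ∑ p, ∑ q, G p q * (e p ω * e q ω) := by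
      simp only [sq, Finset.sum_mul_sum, G]
      rw [Finset.sum_comm]
      refine Finset.sum_congr rfl fun p _ => ?_
      rw [Finset.sum_comm]
      refine Finset.sum_congr rfl fun q _ => ?_
      rw [Finset.sum_mul]
      exact Finset.sum_congr rfl fun k _ => by ring
    simp_rw [e1]
    rw [Finset.sum_add_distrib, Finset.sum_add_distrib, ← Finset.mul_sum, e2, e3]
    simp only [Qf, R, hGT]
    ring
  simp_rw [hdecomp]
  have hint : Integrable (fun ω => (Qf ω + (T - μ) + 2 * C ω + R ω) ^ 2) P :=
    (((hQ2.add (memLp_const _)).add (hC2.const_mul 2)).add hR2).integrable_sq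
  refine ⟨hint, ?_⟩
  have hle : ∀ ω, (Qf ω + (T - μ) + 2 * C ω + R ω) ^ 2
      ≤ 4 * Qf ω ^ 2 + 4 * (T - μ) ^ 2 + 16 * C ω ^ 2 + 4 * R ω ^ 2 := by
    intro ω
    nlinarith [sq_nonneg (Qf ω - (T - μ)), sq_nonneg (Qf ω - 2 * C ω), sq_nonneg (Qf ω - R ω),
      sq_nonneg ((T - μ) - 2 * C ω), sq_nonneg ((T - μ) - R ω), sq_nonneg (2 * C ω - R ω)]
  have i1 := hQ2.integrable_sq.const_mul 4
  have i2 : Integrable (fun _ : Ω => 4 * (T - μ) ^ 2) P := integrable_const _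
  have i3 := hC2.integrable_sq.const_mul 16
  have i4 := hR2.integrable_sq.const_mul 4
  refine (integral_mono hint (((i1.add i2).add i3).add i4) hle).trans ?_
  simp only [Pi.add_apply]
  have hadd : ∫ ω, (4 * Qf ω ^ 2 + 4 * (T - μ) ^ 2 + 16 * C ω ^ 2 + 4 * R ω ^ 2) ∂P
      = 4 * ∫ ω, Qf ω ^ 2 ∂P + 4 * (T - μ) ^ 2 + 16 * ∫ ω, C ω ^ 2 ∂P + 4 * ∫ ω, R ω ^ 2 ∂P := by
    have i12 : Integrable (fun ω => 4 * Qf ω ^ 2 + 4 * (T - μ) ^ 2) P := i1.add i2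
    have i13 : Integrable (fun ω => 4 * Qf ω ^ 2 + 4 * (T - μ) ^ 2 + 16 * C ω ^ 2) P := i12.add i3
    rw [integral_add i13 i4, integral_add i12 i3, integral_add i1 i2]
    simp only [integral_const_mul, integral_const, probReal_univ, smul_eq_mul, one_mul]
  rw [hadd]
  have hRm : ∫ ω, R ω ∂P ≤ ρ := by
    have hR1 : Integrable R P := hR2.integrable (by norm_num)
    have : (∫ ω, R ω ∂P) ^ 2 ≤ ρ ^ 2 := by
      refine le_trans ?_ hZρ
      have hv := variance_nonneg R P
      rw [variance_eq_sub hR2] at hv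
      simpa using sub_nonneg.1 hv
    exact le_of_sq_le_sq this hρ
  have hCm : ∫ ω, C ω ^ 2 ∂P ≤ κ₀ * ρ := by
    rw [integral_linear_random_sq hind h4 hmean hvar Z hZ hZe A]
    calc _ ≤ ∫ ω, κ₀ * R ω ∂P := by
          refine integral_mono (integrable_finsetSum _ fun i _ =>
            (memLp_two_of_four (memLp_finsetSum _ fun k _ => (hZ k).const_mul _)).integrable_sq)
            ((hR2.integrable (by norm_num)).const_mul _) fun ω => hκ (fun k => Z k ω)
      _ ≤ κ₀ * ρ := by
          rw [integral_const_mul]; exact mul_le_mul_of_nonneg_left hRm hκ0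
  have hQm : ∫ ω, Qf ω ^ 2 ∂P ≤ 8 * M * (κ₀ * T) :=
    hQ.trans (mul_le_mul_of_nonneg_left hG2 (by positivity))
  have hRR : ∫ ω, R ω ^ 2 ∂P ≤ ρ ^ 2 := hZρ
  linarith

end QuadraticForms

/-! ### The spectral filter -/

/-- The diagonal entry of the spectral filter with number `j`. -/
def filterWeight (n j : ℕ) : ℝ :=
  if ⌊(n : ℝ) / Real.logb 2 n⌋₊ ≤ j then
    ((n : ℝ) - n / Real.logb 2 n)⁻¹ * (lam n j)⁻¹
  else 0

lemma tHat_eq_sum (m k : ℕ) (y : Fin (m + 1) → ℝ) :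
    tHat (m + 1) k y = ∑ j : Fin m, filterWeight (m + 1) (j + 1) *
      (∑ i : Fin m, transIncr (m + 1) k y i * dst (m + 1) (i + 1) (j + 1)) ^ 2 := by
  have h1 : (sineMatrix (m + 1) * spectralFilter (m + 1) * (sineMatrix (m + 1))ᵀ)
      *ᵥ transIncr (m + 1) k y = sineMatrix (m + 1) *ᵥ (spectralFilter (m + 1) *ᵥ
        ((sineMatrix (m + 1))ᵀ *ᵥ transIncr (m + 1) k y)) := by
    rw [Matrix.mulVec_mulVec, Matrix.mulVec_mulVec, Matrix.mul_assoc]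
  rw [tHat, h1, Matrix.dotProduct_mulVec, ← Matrix.mulVec_transpose]
  have h2 : ∀ j : Fin m, ((sineMatrix (m + 1))ᵀ *ᵥ transIncr (m + 1) k y) j
      = ∑ i : Fin m, transIncr (m + 1) k y i * dst (m + 1) (i + 1) (j + 1) := by
    intro j
    simp only [Matrix.mulVec, dotProduct, Matrix.transpose_apply]
    refine Finset.sum_congr rfl fun i _ => ?_
    rw [mul_comm]
    congr 1
  simp only [dotProduct, spectralFilter, Matrix.mulVec_diagonal]
  refine Finset.sum_congr rfl fun j _ => ?_
  have h3 := h2 j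
  simp only [h3]
  simp only [filterWeight]
  push_cast
  ring

lemma lam_nonneg (n j : ℕ) : 0 ≤ lam n j := by unfold lam; positivity

/-- Jordan's inequality `sin x ≥ 2x/π` on `[0, π/2]`. -/
lemma le_lam {n j : ℕ} (hn : 0 < n) (hj : j ≤ n) : 4 * ((j : ℝ) / n) ^ 2 ≤ lam n j := by
  have hn' : (0 : ℝ) < n := by exact_mod_cast hn
  have hj' : (j : ℝ) ≤ n := by exact_mod_cast hj
  have h := Real.mul_le_sin (x := j * Real.pi / (2 * n)) (by positivity) (by
    rw [div_le_div_iff₀ (by positivity) (by positivity)]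
    nlinarith [Real.pi_pos])
  have e : 2 / Real.pi * (j * Real.pi / (2 * n)) = (j : ℝ) / n := by
    field_simp
  rw [e] at h
  unfold lam
  have : 0 ≤ (j : ℝ) / n := by positivity
  nlinarith

section Filter

variable {n : ℕ} (hL : 2 ≤ Real.logb 2 n)

include hL

lemma four_le_of_logb : (4 : ℝ) ≤ n := by
  have hn : (0 : ℝ) < n := by
    rcases Nat.eq_zero_or_pos n with h | h
    · subst h; norm_num at hL
    · exact_mod_cast h
  rw [Real.le_logb_iff_rpow_le (by norm_num) hn] at hL
  norm_num at hL
  exact_mod_cast hL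

lemma half_le_sub_div_logb : (n : ℝ) / 2 ≤ n - n / Real.logb 2 n := by
  have h4 := four_le_of_logb hL
  have : (n : ℝ) / Real.logb 2 n ≤ n / 2 :=
    div_le_div_of_nonneg_left (by linarith) (by norm_num) hL
  linarith

lemma filterWeight_nonneg (j : ℕ) : 0 ≤ filterWeight n j := by
  have h4 := four_le_of_logb hL
  have := half_le_sub_div_logb hL
  have h1 := lam_nonneg n j
  unfold filterWeight
  split_ifs
  · have : 0 ≤ (n : ℝ) - n / Real.logb 2 n := by linarith
    positivity
  · exact le_rfl

/-- This is where the cut-off of the low frequencies pays: for `j ≥ ⌊n / log n⌋` the eigenvalue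
`λ_j` is at least `1 / log² n`, so inverting it costs only a factor `log² n`. -/
lemma filterWeight_le {j : ℕ} (hj : 1 ≤ j) (hjn : j ≤ n) :
    filterWeight n j ≤ 2 * Real.logb 2 n ^ 2 / n := by
  have h4 := four_le_of_logb hL
  have hc := half_le_sub_div_logb hL
  have hn : (0 : ℝ) < n := by linarith
  unfold filterWeight
  split_ifs with h
  -- The floor loses less than one, and `j + 1 ≤ 2j`.
  · have h1 : (n : ℝ) / Real.logb 2 n < 2 * j := by
      refine (Nat.lt_floor_add_one _).trans_le ?_
      have : ((⌊(n : ℝ) / Real.logb 2 n⌋₊ : ℕ) : ℝ) ≤ j := by exact_mod_cast h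
      have : (1 : ℝ) ≤ j := by exact_mod_cast hj
      linarith
    have h2 := le_lam (by exact_mod_cast hn) hjn
    have h3 : 1 / Real.logb 2 n ≤ 2 * (j / n) := by
      rw [div_le_iff₀ (by linarith)]
      rw [div_lt_iff₀ (by linarith)] at h1
      rw [show 2 * ((j : ℝ) / n) * Real.logb 2 n = (2 * j * Real.logb 2 n) / n by ring,
        le_div_iff₀ hn]
      linarith
    have h5 : (1 / Real.logb 2 n) ^ 2 ≤ lam n j := by
      refine le_trans (pow_le_pow_left₀ (by positivity) h3 2) (le_trans (le_of_eq ?_) h2)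
      ring
    have h6 : (lam n j)⁻¹ ≤ Real.logb 2 n ^ 2 := by
      rw [inv_le_comm₀ (lt_of_lt_of_le (by positivity) h5) (by positivity)]
      simpa using h5
    have h7 : ((n : ℝ) - n / Real.logb 2 n)⁻¹ ≤ 2 / n := by
      rw [inv_le_comm₀ (by linarith) (by positivity), inv_div]
      exact hc
    calc _ ≤ 2 / n * Real.logb 2 n ^ 2 :=
          mul_le_mul h7 h6 (inv_nonneg.2 (lam_nonneg _ _)) (by positivity)
      _ = _ := by ring
  · positivity

lemma filterWeight_mul_lam {j : ℕ} (hj : 1 ≤ j) (hjn : j ≤ n) :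
    filterWeight n j * lam n j = if ⌊(n : ℝ) / Real.logb 2 n⌋₊ ≤ j then
      ((n : ℝ) - n / Real.logb 2 n)⁻¹ else 0 := by
  have h4 := four_le_of_logb hL
  have hn : (0 : ℝ) < n := by linarith
  have hj' : (1 : ℝ) ≤ j := by exact_mod_cast hj
  have h2 := le_lam (by exact_mod_cast hn) hjn
  have h3 : 0 < lam n j := lt_of_lt_of_le (by positivity) h2
  unfold filterWeight
  split_ifs
  · rw [mul_assoc, inv_mul_cancel₀ h3.ne', mul_one]
  · simp

lemma filterWeight_mul_lam_le {j : ℕ} (hj : 1 ≤ j) (hjn : j ≤ n) :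
    filterWeight n j * lam n j ≤ 2 / n := by
  have h4 := four_le_of_logb hL
  have hc := half_le_sub_div_logb hL
  rw [filterWeight_mul_lam hL hj hjn]
  split_ifs
  · rw [inv_le_comm₀ (by linarith) (by positivity), inv_div]
    exact hc
  · positivity

lemma one_le_floor_div_logb : 1 ≤ ⌊(n : ℝ) / Real.logb 2 n⌋₊ := by
  have h4 := four_le_of_logb hL
  rw [Nat.one_le_floor_iff, one_le_div (by linarith), Real.logb_le_iff_le_rpow (by norm_num)
    (by linarith)]
  rw [Real.rpow_natCast]
  exact_mod_cast (Nat.lt_two_pow_self).le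

lemma floor_div_logb_le : ⌊(n : ℝ) / Real.logb 2 n⌋₊ ≤ n := by
  refine Nat.floor_le_of_le ?_
  exact div_le_self (by positivity) (by linarith)

end Filter

/-! ### The trigonometric part of the bias -/

/-- The Dirichlet kernel is bounded by the inverse of the sine of the half angle `(2p+1)π/(2n)`.
That sine is small only near the two ends, where it is at least `(p+1)/n` or `(n-p)/n`; the sum of
both bounds covers both halves. -/
lemma abs_sum_cos_le {n p a b : ℕ} (hp : p < n) (hab : a ≤ b) :
    |∑ j ∈ Finset.Ico a b, Real.cos (j * ((2 * p + 1) * Real.pi / n))|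
      ≤ n / (p + 1) + n / (n - p) := by
  have hn : (0 : ℝ) < n := by exact_mod_cast (by omega : 0 < n)
  have hp' : (p : ℝ) + 1 ≤ n := by exact_mod_cast hp
  have hpi := Real.pi_pos
  set x := (2 * (p : ℝ) + 1) * Real.pi / n with hx
  have key := two_sin_half_mul_sum_cos x 0 a b hab
  simp only [add_zero] at key
  set Sg := ∑ j ∈ Finset.Ico a b, Real.cos (j * x)
  have main : ∀ s : ℝ, 0 < s → s ≤ Real.sin (x / 2) → |Sg| ≤ 1 / s := by
    intro s hs hsin
    rw [le_div_iff₀ hs]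
    have h1 : |2 * Real.sin (x / 2) * Sg| ≤ 2 := by
      rw [key]
      refine (abs_sub _ _).trans ?_
      linarith [Real.abs_sin_le_one (b * x - x / 2), Real.abs_sin_le_one (a * x - x / 2)]
    rw [abs_mul, abs_of_pos (by linarith)] at h1
    nlinarith [abs_nonneg Sg]
  have hx2 : x / 2 = (2 * p + 1) * Real.pi / (2 * n) := by
    rw [hx, div_div, mul_comm (n : ℝ) 2]
  have ha : 0 ≤ (n : ℝ) / (p + 1) := by positivity
  have hb : 0 ≤ (n : ℝ) / (n - p) := div_nonneg hn.le (by linarith)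
  rcases le_total (2 * (p : ℝ) + 1) n with h | h
  · have h1 := Real.mul_le_sin (x := x / 2) (by rw [hx2]; positivity) (by
      rw [hx2, div_le_div_iff₀ (by positivity) (by positivity)]; nlinarith)
    have e : 2 / Real.pi * (x / 2) = (2 * p + 1) / n := by rw [hx2]; field_simp
    rw [e] at h1
    have h2 : ((p : ℝ) + 1) / n ≤ Real.sin (x / 2) := by
      refine le_trans (div_le_div_of_nonneg_right ?_ hn.le) h1
      linarith [(Nat.cast_nonneg p : (0 : ℝ) ≤ p)]
    have := main _ (by positivity) h2
    rw [one_div_div] at this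
    linarith
  · have h1 := Real.mul_le_sin (x := Real.pi - x / 2) (by
      rw [hx2, sub_nonneg, div_le_iff₀ (by positivity)]; nlinarith) (by
      rw [hx2, sub_le_comm, le_div_iff₀ (by positivity)]; nlinarith)
    rw [Real.sin_pi_sub] at h1
    have e : 2 / Real.pi * (Real.pi - x / 2) = (2 * n - 2 * p - 1) / n := by
      rw [hx2]; field_simp; ring
    rw [e] at h1
    have h2 : ((n : ℝ) - p) / n ≤ Real.sin (x / 2) := by
      refine le_trans (div_le_div_of_nonneg_right ?_ hn.le) h1
      linarith
    have := main _ (div_pos (by linarith) hn) h2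
    rw [one_div_div] at this
    linarith

/-- A crude bound for a harmonic sum. It suffices because the trace is only needed up to an error of
order `n^{-1/2}`. -/
lemma sum_one_div_succ_le (n : ℕ) : ∑ p ∈ Finset.range n, 1 / ((p : ℝ) + 1) ≤ 2 * √n := by
  induction n with
  | zero => simp
  | succ n ih =>
    rw [Finset.sum_range_succ]
    have h1 : 1 / ((n : ℝ) + 1) ≤ 2 * (√((n + 1 : ℕ) : ℝ) - √n) := by
      have hs : 0 ≤ √(n : ℝ) := Real.sqrt_nonneg _
      have ht : √(n : ℝ) ≤ √((n + 1 : ℕ) : ℝ) := Real.sqrt_le_sqrt (by push_cast; linarith)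
      have hs2 : √(n : ℝ) ^ 2 = n := Real.sq_sqrt (by positivity)
      have ht2 : √((n + 1 : ℕ) : ℝ) ^ 2 = n + 1 := by
        rw [Real.sq_sqrt (by positivity)]; push_cast; ring
      have ht1 : 1 ≤ √((n + 1 : ℕ) : ℝ) := by
        rw [Real.one_le_sqrt]; push_cast; linarith [(Nat.cast_nonneg n : (0 : ℝ) ≤ n)]
      set t := √((n + 1 : ℕ) : ℝ)
      set s := √(n : ℝ)
      rw [← ht2, div_le_iff₀ (by positivity)]
      have : (t - s) * (t + s) = 1 := by nlinarith
      nlinarith [mul_nonneg (sub_nonneg.2 ht) (sub_nonneg.2 ht1), mul_nonneg (sub_nonneg.2 ht) hs,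
        mul_nonneg (mul_nonneg (sub_nonneg.2 ht) (sub_nonneg.2 ht1)) (by linarith : 0 ≤ t)]
    linarith

lemma sum_dirichlet_le (n : ℕ) :
    ∑ p ∈ Finset.range n, ((n : ℝ) / (p + 1) + n / (n - p)) ≤ 4 * n * √n := by
  have h1 := sum_one_div_succ_le n
  have h2 : ∑ p ∈ Finset.range n, 1 / ((n : ℝ) - p) = ∑ p ∈ Finset.range n, 1 / ((p : ℝ) + 1) := by
    rw [← Finset.sum_range_reflect]
    refine Finset.sum_congr rfl fun p hp => ?_
    have hp := Finset.mem_range.1 hp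
    have : ((n - 1 - p : ℕ) : ℝ) = n - 1 - p := by
      rw [Nat.cast_sub (by omega), Nat.cast_sub (by omega)]; simp
    rw [this]; congr 1; ring
  have e : ∀ p : ℕ, (n : ℝ) / (p + 1) + n / (n - p)
      = n * (1 / ((p : ℝ) + 1)) + n * (1 / ((n : ℝ) - p)) := fun p => by ring
  simp_rw [e]
  rw [Finset.sum_add_distrib, ← Finset.mul_sum, ← Finset.mul_sum, h2]
  have hn : (0 : ℝ) ≤ n := by positivity
  nlinarith

/-! ### The coefficients of the errors -/

/-- The coefficient of error `p` in the spectral statistic `j`, for the basis values `F` and the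
squared noise levels `v` at the design points. -/
def noiseCoef (m : ℕ) (F v : ℕ → ℝ) (j : Fin m) (p : Fin (m + 1)) : ℝ :=
  √(filterWeight (m + 1) (j + 1)) * (√(v (p + 1)) *
    (dst (m + 1) p (j + 1) * F p - dst (m + 1) (p + 1) (j + 1) * F (p + 1)))

section NoiseCoef

variable {m : ℕ} (hL : 2 ≤ Real.logb 2 (m + 1 : ℕ)) {F v : ℕ → ℝ} {K τ : ℝ}
  (hKL : K ^ 2 * Real.logb 2 (m + 1 : ℕ) ^ 2 ≤ (m + 1 : ℕ)) (hF : ∀ p, F p ^ 2 ≤ 2)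
  (hdF : ∀ p, (F (p + 1) - F p) ^ 2 ≤ 9 * K ^ 2 / (m + 1 : ℕ) ^ 2)
  (hv0 : ∀ p : Fin (m + 1), 0 ≤ v (p + 1)) (hv : ∀ p : Fin (m + 1), v (p + 1) ≤ τ)

include hL hKL hF hdF hv0 hv

/-- The operator norm of the coefficient matrix. By the product rule the difference of `dst · F` is
`F` times the difference of `dst` plus the difference of `F` times `dst`, and each part is summed by
Parseval. The first meets `w_j λ_j ≤ 2/n`. The second meets `w_j ≤ 2L²/n` and the small factor
`9K²/n²`, where `K²L² ≤ n` is more than enough. In total `2τ (4/n + 18/n)`. -/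
lemma sum_noiseCoef_mul_sq_le (y : Fin m → ℝ) :
    ∑ p, (∑ j, noiseCoef m F v j p * y j) ^ 2 ≤ 44 * τ / (m + 1 : ℕ) * ∑ j, y j ^ 2 := by
  have h4 := four_le_of_logb hL
  set n : ℕ := m + 1 with hn
  set L := Real.logb 2 (n : ℕ)
  have hτ : 0 ≤ τ := (hv0 0).trans (hv 0)
  let c : Fin m → ℝ := fun j => √(filterWeight n (j + 1)) * y j
  have hc2 : ∀ j, c j ^ 2 = filterWeight n (j + 1) * y j ^ 2 := fun j => by
    simp only [c, mul_pow, Real.sq_sqrt (filterWeight_nonneg hL _)]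
  have hpt : ∀ p : Fin (m + 1), (∑ j, noiseCoef m F v j p * y j) ^ 2
      ≤ 2 * τ * (2 * (∑ j, c j * (dst n (p + 1) (j + 1) - dst n p (j + 1))) ^ 2
        + 9 * K ^ 2 / n ^ 2 * (∑ j, c j * dst n p (j + 1)) ^ 2) := by
    intro p
    set α := ∑ j, c j * (dst n (p + 1) (j + 1) - dst n p (j + 1))
    set β := ∑ j, c j * dst n p (j + 1)
    have e : ∑ j, noiseCoef m F v j p * y j
        = √(v (p + 1)) * (-(F (p + 1) * α + (F (p + 1) - F p) * β)) := by
      simp only [α, β, Finset.mul_sum, ← Finset.sum_add_distrib, ← Finset.sum_neg_distrib]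
      refine Finset.sum_congr rfl fun j _ => ?_
      simp only [noiseCoef, c, ← hn]
      ring
    rw [e, mul_pow, Real.sq_sqrt (hv0 p), neg_sq]
    have h1 : (F (p + 1) * α + (F (p + 1) - F p) * β) ^ 2
        ≤ 2 * (2 * α ^ 2 + 9 * K ^ 2 / n ^ 2 * β ^ 2) := by
      have a1 := mul_le_mul_of_nonneg_right (hF (p + 1)) (sq_nonneg α)
      have a2 := mul_le_mul_of_nonneg_right (hdF p) (sq_nonneg β)
      nlinarith [sq_nonneg (F (p + 1) * α - (F (p + 1) - F p) * β)]
    calc _ ≤ τ * (2 * (2 * α ^ 2 + 9 * K ^ 2 / n ^ 2 * β ^ 2)) :=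
          mul_le_mul (hv p) h1 (sq_nonneg _) hτ
      _ = _ := by ring
  refine (Finset.sum_le_sum fun p _ => hpt p).trans ?_
  rw [← Finset.mul_sum, Finset.sum_add_distrib, ← Finset.mul_sum, ← Finset.mul_sum,
    sum_dst_sub_sq, sum_dst_sq]
  have hn0 : (0 : ℝ) < n := by linarith
  have b1 : ∑ j, c j ^ 2 * lam (m + 1) (j + 1) ≤ 2 / n * ∑ j, y j ^ 2 := by
    rw [Finset.mul_sum]
    refine Finset.sum_le_sum fun j _ => ?_
    rw [hc2, mul_right_comm]
    exact mul_le_mul_of_nonneg_right (filterWeight_mul_lam_le hL (by omega) (by omega))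
      (sq_nonneg _)
  have b2 : ∑ j, c j ^ 2 ≤ 2 * L ^ 2 / n * ∑ j, y j ^ 2 := by
    rw [Finset.mul_sum]
    refine Finset.sum_le_sum fun j _ => ?_
    rw [hc2]
    exact mul_le_mul_of_nonneg_right (filterWeight_le hL (by omega) (by omega)) (sq_nonneg _)
  have hY : 0 ≤ ∑ j, y j ^ 2 := Finset.sum_nonneg fun _ _ => sq_nonneg _
  have b3 : 9 * K ^ 2 / n ^ 2 * (2 * L ^ 2 / n) ≤ 18 / n := by
    rw [div_mul_div_comm, div_le_div_iff₀ (by positivity) hn0]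
    have : K ^ 2 * L ^ 2 * n ≤ n ^ 2 * n := by
      refine mul_le_mul_of_nonneg_right (hKL.trans ?_) hn0.le
      nlinarith
    nlinarith
  have b4 := mul_le_mul_of_nonneg_left b2 (by positivity : 0 ≤ 9 * K ^ 2 / (n : ℝ) ^ 2)
  have b5 := mul_le_mul_of_nonneg_right b3 hY
  calc _ ≤ 2 * τ * (2 * (2 / n * ∑ j, y j ^ 2) + 18 / n * ∑ j, y j ^ 2) := by
        refine mul_le_mul_of_nonneg_left (add_le_add (by linarith) ?_) (by positivity)
        refine b4.trans (le_trans (le_of_eq ?_) b5)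
        ring
    _ = _ := by ring

/-- In the Frobenius norm the part with the difference of `F` is negligible: with weights its square
sum is `O(1/n)`, while that of the main part is `O(1)`. -/
lemma abs_sum_noiseCoef_sq_sub_sum_le :
    |∑ j, ∑ p, noiseCoef m F v j p ^ 2 - ∑ j : Fin m, ∑ p : Fin (m + 1),
        filterWeight (m + 1) (j + 1) * v (p + 1)
          * (F (p + 1) * (dst (m + 1) (p + 1) (j + 1) - dst (m + 1) p (j + 1))) ^ 2|
      ≤ 40 * τ / √(m + 1 : ℕ) := by
  have h4 := four_le_of_logb hL
  have hhalf := half_le_sub_div_logb hL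
  set n : ℕ := m + 1 with hn
  set L := Real.logb 2 (n : ℕ) with hLdef
  have hτ : 0 ≤ τ := (hv0 0).trans (hv 0)
  have hn0 : (0 : ℝ) < n := by linarith
  have hs0 : 0 < √(n : ℝ) := Real.sqrt_pos.2 hn0
  have hs2 : √(n : ℝ) ^ 2 = n := Real.sq_sqrt hn0.le
  have hs1 : 1 ≤ √(n : ℝ) := by rw [Real.one_le_sqrt]; linarith
  let w : Fin m → ℝ := fun j => filterWeight n (j + 1)
  have hw0 : ∀ j, 0 ≤ w j := fun j => filterWeight_nonneg hL _
  let a : Fin m → Fin (m + 1) → ℝ := fun j p =>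
    F (p + 1) * (dst n (p + 1) (j + 1) - dst n p (j + 1))
  let b : Fin m → Fin (m + 1) → ℝ := fun j p => (F (p + 1) - F p) * dst n p (j + 1)
  have hcoef : ∀ j p, noiseCoef m F v j p ^ 2 = w j * v (p + 1) * (a j p + b j p) ^ 2 := by
    intro j p
    simp only [noiseCoef, ← hn, mul_pow, Real.sq_sqrt (filterWeight_nonneg hL _),
      Real.sq_sqrt (hv0 p), w, a, b]
    ring
  -- the two quadratic sums
  have hA : ∑ j, ∑ p : Fin (m + 1), w j * v (p + 1) * a j p ^ 2 ≤ 4 * τ := by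
    have h1 : ∀ j, ∑ p : Fin (m + 1), w j * v (p + 1) * a j p ^ 2 ≤ 2 * τ * (2 / n) := by
      intro j
      have h2 : ∀ p : Fin (m + 1), w j * v (p + 1) * a j p ^ 2
          ≤ 2 * τ * (w j * (dst n (p + 1) (j + 1) - dst n p (j + 1)) ^ 2) := by
        intro p
        have h3 : v (p + 1) * F (p + 1) ^ 2 ≤ τ * 2 :=
          mul_le_mul (hv p) (hF _) (sq_nonneg _) hτ
        have h4 : 0 ≤ w j * (dst n (p + 1) (j + 1) - dst n p (j + 1)) ^ 2 :=
          mul_nonneg (hw0 j) (sq_nonneg _)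
        have := mul_le_mul_of_nonneg_right h3 h4
        refine le_trans (le_of_eq ?_) (this.trans (le_of_eq ?_))
        · simp only [a]; ring
        · ring
      refine (Finset.sum_le_sum fun p _ => h2 p).trans ?_
      rw [← Finset.mul_sum, ← Finset.mul_sum]
      have h5 : ∑ p : Fin (m + 1), (dst n (p + 1) (j + 1) - dst n p (j + 1)) ^ 2
          = lam n (j + 1) := by
        simp_rw [sq]
        rw [Fin.sum_univ_eq_sum_range (fun p => (dst n (p + 1) (j + 1) - dst n p (j + 1))
          * (dst n (p + 1) (j + 1) - dst n p (j + 1))) (m + 1), ← hn,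
          sum_dst_sub_mul_dst_sub (by omega) (by omega) (by omega) (by omega), if_pos rfl]
      rw [h5]
      exact mul_le_mul_of_nonneg_left (filterWeight_mul_lam_le hL (by omega) (by omega))
        (by positivity)
    refine (Finset.sum_le_sum fun j _ => h1 j).trans ?_
    rw [Finset.sum_const, Finset.card_univ, Fintype.card_fin, nsmul_eq_mul]
    have hm : (m : ℝ) ≤ n := by rw [hn]; push_cast; linarith
    calc (m : ℝ) * (2 * τ * (2 / n)) ≤ n * (2 * τ * (2 / n)) :=
          mul_le_mul_of_nonneg_right hm (by positivity)
      _ = 4 * τ := by field_simp; ring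
  have hB : ∑ j, ∑ p : Fin (m + 1), w j * v (p + 1) * b j p ^ 2 ≤ 18 * τ / n := by
    have h1 : ∀ j, ∑ p : Fin (m + 1), w j * v (p + 1) * b j p ^ 2
        ≤ 2 * L ^ 2 / n * τ * (9 * K ^ 2 / n ^ 2) := by
      intro j
      have hwj : w j ≤ 2 * L ^ 2 / n := filterWeight_le hL (by omega) (by omega)
      have h2 : ∀ p : Fin (m + 1), w j * v (p + 1) * b j p ^ 2
          ≤ 2 * L ^ 2 / n * τ * (9 * K ^ 2 / n ^ 2) * dst n p (j + 1) ^ 2 := by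
        intro p
        have h3 : w j * v (p + 1) ≤ 2 * L ^ 2 / n * τ :=
          mul_le_mul hwj (hv p) (hv0 p) (by positivity)
        have h4 : b j p ^ 2 ≤ 9 * K ^ 2 / n ^ 2 * dst n p (j + 1) ^ 2 := by
          simp only [b, mul_pow]
          exact mul_le_mul_of_nonneg_right (hdF p) (sq_nonneg _)
        refine (mul_le_mul h3 h4 (sq_nonneg _) (by positivity)).trans (le_of_eq ?_)
        ring
      refine (Finset.sum_le_sum fun p _ => h2 p).trans (le_of_eq ?_)
      rw [← Finset.mul_sum]
      have h5 : ∑ p : Fin (m + 1), dst n p (j + 1) ^ 2 = 1 := by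
        simp_rw [sq]
        rw [Fin.sum_univ_eq_sum_range (fun p => dst n p (j + 1) * dst n p (j + 1)) (m + 1), ← hn,
          sum_dst_mul_dst (by omega) (by omega) (by omega) (by omega), if_pos rfl]
      rw [h5, mul_one]
    refine (Finset.sum_le_sum fun j _ => h1 j).trans ?_
    rw [Finset.sum_const, Finset.card_univ, Fintype.card_fin, nsmul_eq_mul]
    have hm : (m : ℝ) ≤ n := by rw [hn]; push_cast; linarith
    calc (m : ℝ) * (2 * L ^ 2 / n * τ * (9 * K ^ 2 / n ^ 2))
        ≤ n * (2 * L ^ 2 / n * τ * (9 * K ^ 2 / n ^ 2)) :=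
          mul_le_mul_of_nonneg_right hm (by positivity)
      _ = 18 * τ * (K ^ 2 * L ^ 2) / n ^ 2 := by field_simp; ring
      _ ≤ 18 * τ * n / n ^ 2 := by
          gcongr
      _ = 18 * τ / n := by field_simp
  change |∑ j, ∑ p, noiseCoef m F v j p ^ 2 - ∑ j, ∑ p : Fin (m + 1), w j * v (p + 1) * a j p ^ 2|
      ≤ 40 * τ / √n
  · rw [← Finset.sum_sub_distrib]
    have h1 : ∀ j, |∑ p, noiseCoef m F v j p ^ 2 - ∑ p : Fin (m + 1), w j * v (p + 1) * a j p ^ 2|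
        ≤ ∑ p : Fin (m + 1), (1 / √n * (w j * v (p + 1) * a j p ^ 2)
          + (1 + √n) * (w j * v (p + 1) * b j p ^ 2)) := by
      intro j
      rw [← Finset.sum_sub_distrib]
      refine (Finset.abs_sum_le_sum_abs _ _).trans (Finset.sum_le_sum fun p _ => ?_)
      rw [hcoef, ← mul_sub, abs_mul, abs_of_nonneg (mul_nonneg (hw0 j) (hv0 p))]
      -- Young's inequality for `2ab`. The weight `1/√n` balances a sum of `a²` of order one against
      -- a sum of `b²` of order `1/n`, so that both contribute order `n^{-1/2}`.
      have h2 : |(a j p + b j p) ^ 2 - a j p ^ 2|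
          ≤ 1 / √n * a j p ^ 2 + (1 + √n) * b j p ^ 2 := by
        have e1 : (1 / √(n : ℝ) * a j p + b j p) ^ 2 * √n
            = 1 / √n * a j p ^ 2 + 2 * (a j p * b j p) + √n * b j p ^ 2 := by
          field_simp; ring
        have e2 : (1 / √(n : ℝ) * a j p - b j p) ^ 2 * √n
            = 1 / √n * a j p ^ 2 - 2 * (a j p * b j p) + √n * b j p ^ 2 := by
          field_simp; ring
        have p1 : 0 ≤ (1 / √(n : ℝ) * a j p + b j p) ^ 2 * √n := by positivity
        have p2 : 0 ≤ (1 / √(n : ℝ) * a j p - b j p) ^ 2 * √n := by positivity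
        rw [e1] at p1
        rw [e2] at p2
        rw [abs_le]
        constructor <;> nlinarith [sq_nonneg (b j p)]
      refine (mul_le_mul_of_nonneg_left h2 (mul_nonneg (hw0 j) (hv0 p))).trans (le_of_eq ?_)
      ring
    refine (Finset.abs_sum_le_sum_abs _ _).trans ((Finset.sum_le_sum fun j _ => h1 j).trans ?_)
    simp_rw [Finset.sum_add_distrib, ← Finset.mul_sum]
    calc _ ≤ 1 / √n * (4 * τ) + (1 + √n) * (18 * τ / n) := by gcongr
      _ ≤ 1 / √n * (4 * τ) + (√n + √n) * (18 * τ / n) := by gcongr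
      _ = 40 * τ / √n := by
        have e : 18 * τ / (n : ℝ) = 18 * τ / (√n * √n) := by rw [← sq, hs2]
        rw [e]
        field_simp
        ring

/-- The sum of the squared coefficients is close to a Riemann sum of `v F²`. -/
lemma abs_sum_noiseCoef_sq_sub_le :
    |∑ j, ∑ p, noiseCoef m F v j p ^ 2
        - 1 / (m + 1 : ℕ) * ∑ p : Fin (m + 1), v (p + 1) * F (p + 1) ^ 2|
      ≤ 60 * τ / √(m + 1 : ℕ) := by
  have h4 := four_le_of_logb hL
  have hhalf := half_le_sub_div_logb hL
  have hstep1 := abs_sum_noiseCoef_sq_sub_sum_le hL hKL hF hdF hv0 hv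
  set n : ℕ := m + 1 with hn
  set L := Real.logb 2 (n : ℕ) with hLdef
  have hτ : 0 ≤ τ := (hv0 0).trans (hv 0)
  have hn0 : (0 : ℝ) < n := by linarith
  have hs0 : 0 < √(n : ℝ) := Real.sqrt_pos.2 hn0
  have hs2 : √(n : ℝ) ^ 2 = n := Real.sq_sqrt hn0.le
  have hs1 : 1 ≤ √(n : ℝ) := by rw [Real.one_le_sqrt]; linarith
  let w : Fin m → ℝ := fun j => filterWeight n (j + 1)
  have hw0 : ∀ j, 0 ≤ w j := fun j => filterWeight_nonneg hL _
  let a : Fin m → Fin (m + 1) → ℝ := fun j p =>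
    F (p + 1) * (dst n (p + 1) (j + 1) - dst n p (j + 1))
  -- the main sum
  set c := ((n : ℝ) - n / L)⁻¹ with hc
  set j0 := ⌊(n : ℝ) / L⌋₊ with hj0
  have hj01 : 1 ≤ j0 := one_le_floor_div_logb hL
  have hj0n : j0 ≤ n := floor_div_logb_le hL
  have hc0 : 0 ≤ c := inv_nonneg.2 (by linarith)
  have hc2 : c ≤ 2 / n := by
    rw [hc, inv_le_comm₀ (by linarith) (by positivity), inv_div]
    exact hhalf
  -- The filter times the eigenvalue is the constant `c` on the retained band `j0 ≤ j < n`.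
  have hfold : ∀ f : ℕ → ℝ, ∑ j : Fin m, (w j * lam n (j + 1)) * f (j + 1)
      = c * ∑ j ∈ Finset.Ico j0 n, f j := by
    intro f
    have h1 : ∀ j : Fin m, (w j * lam n (j + 1)) * f (j + 1)
        = (fun i : ℕ => if j0 ≤ i + 1 then c * f (i + 1) else 0) j := by
      intro j
      simp only [w]
      rw [filterWeight_mul_lam hL (by omega) (by omega)]
      split_ifs
      · rfl
      · simp
    simp_rw [h1]
    rw [Fin.sum_univ_eq_sum_range (fun i : ℕ => if j0 ≤ i + 1 then c * f (i + 1) else 0) m,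
      Finset.range_eq_Ico, Finset.sum_Ico_add' (fun i => if j0 ≤ i then c * f i else 0) 0 m 1,
      ← Finset.sum_filter, Finset.mul_sum]
    congr 1
    ext i
    simp only [Finset.mem_filter, Finset.mem_Ico]
    omega
  let H : ℕ → ℝ := fun p => v (p + 1) * F (p + 1) ^ 2
  have hH0 : ∀ p : Fin (m + 1), 0 ≤ H p := fun p => mul_nonneg (hv0 p) (sq_nonneg _)
  have hH : ∀ p : Fin (m + 1), H p ≤ 2 * τ := fun p =>
    (mul_le_mul (hv p) (hF _) (sq_nonneg _) hτ).trans (by linarith)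
  let D : ℕ → ℝ := fun p => ∑ j ∈ Finset.Ico j0 n, Real.cos (j * ((2 * p + 1) * Real.pi / n))
  -- By `dst_succ_sub_sq` the squared differences are `(λ_j / n)(1 + cos)`. The constant gives the
  -- Riemann sum, the cosine gives the Dirichlet sums `D p`.
  have hmain : ∑ j, ∑ p : Fin (m + 1), w j * v (p + 1) * a j p ^ 2
      = (c * (n - j0)) * (1 / n * ∑ p : Fin (m + 1), H p)
        + c * (1 / n) * ∑ p : Fin (m + 1), H p * D p := by
    rw [Finset.sum_comm]
    have h1 : ∀ p : Fin (m + 1), ∑ j, w j * v (p + 1) * a j p ^ 2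
        = (c * (n - j0)) * (1 / n * H p) + c * (1 / n) * (H p * D p) := by
      intro p
      have h2 : ∀ j : Fin m, w j * v (p + 1) * a j p ^ 2
          = (1 / n * H p) * ((w j * lam n (j + 1))
            * (fun i : ℕ => 1 + Real.cos (i * ((2 * (p : ℕ) + 1) * Real.pi / n))) (j + 1)) := by
        intro j
        simp only [a, mul_pow, dst_succ_sub_sq, H]
        ring
      simp_rw [h2]
      have h3 := hfold (fun i : ℕ => 1 + Real.cos (i * ((2 * (p : ℕ) + 1) * Real.pi / n)))
      rw [← Finset.mul_sum, h3, Finset.sum_add_distrib, Finset.sum_const, Nat.card_Ico,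
        nsmul_eq_mul, mul_one, Nat.cast_sub hj0n]
      simp only [D]
      ring
    simp_rw [h1]
    rw [Finset.sum_add_distrib, ← Finset.mul_sum, ← Finset.mul_sum, ← Finset.mul_sum]
  have hRsum : 1 / (n : ℝ) * ∑ p : Fin (m + 1), H p ≤ 2 * τ := by
    have : ∑ p : Fin (m + 1), H p ≤ n * (2 * τ) := by
      refine (Finset.sum_le_sum fun p _ => hH p).trans ?_
      simp [hn]
    rw [one_div, inv_mul_le_iff₀ hn0]
    exact this
  have hRsum0 : 0 ≤ 1 / (n : ℝ) * ∑ p : Fin (m + 1), H p :=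
    mul_nonneg (by positivity) (Finset.sum_nonneg fun p _ => hH0 p)
  -- The band holds `n - j0` frequencies, whereas the filter is normalized by `n - n / L`; the two
  -- differ by less than one.
  have hcount : |c * (n - j0) - 1| ≤ 2 / n := by
    have hden : ((n : ℝ) - n / L) ≠ 0 := by linarith
    have e : c * (n - j0) - 1 = c * (n / L - j0) := by
      have : c * (n - n / L) = 1 := inv_mul_cancel₀ hden
      linear_combination this
    have f1 : (j0 : ℝ) ≤ n / L := Nat.floor_le (div_nonneg hn0.le (by linarith))
    have f2 : (n : ℝ) / L < j0 + 1 := Nat.lt_floor_add_one _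
    rw [e, abs_mul, abs_of_nonneg hc0, abs_of_nonneg (by linarith)]
    nlinarith
  have hDsum : |c * (1 / n) * ∑ p : Fin (m + 1), H p * D p| ≤ 16 * τ / √n := by
    rw [abs_mul, abs_of_nonneg (by positivity : 0 ≤ c * (1 / (n : ℝ)))]
    have h1 : |∑ p : Fin (m + 1), H p * D p| ≤ 2 * τ * (4 * n * √n) := by
      refine (Finset.abs_sum_le_sum_abs _ _).trans ?_
      have h2 : ∀ p : Fin (m + 1), |H p * D p|
          ≤ 2 * τ * (fun p : ℕ => ((n : ℝ) / (p + 1) + n / (n - p))) p := by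
        intro p
        rw [abs_mul, abs_of_nonneg (hH0 p)]
        exact mul_le_mul (hH p) (abs_sum_cos_le p.2 hj0n) (abs_nonneg _) (by positivity)
      refine (Finset.sum_le_sum fun p _ => h2 p).trans ?_
      rw [← Finset.mul_sum, Fin.sum_univ_eq_sum_range
        (fun p : ℕ => ((n : ℝ) / (p + 1) + n / (n - p))) (m + 1)]
      exact mul_le_mul_of_nonneg_left (sum_dirichlet_le n) (by positivity)
    calc _ ≤ 2 / n * (1 / n) * (2 * τ * (4 * n * √n)) := by gcongr
      _ = 16 * τ / √n := by
        rw [show 2 / (n : ℝ) * (1 / n) * (2 * τ * (4 * n * √n)) = 16 * τ * √n / n by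
          field_simp; ring]
        rw [div_eq_div_iff hn0.ne' hs0.ne']
        rw [mul_assoc, ← sq, hs2]
  have hfin : |(c * (n - j0)) * (1 / n * ∑ p : Fin (m + 1), H p) - 1 / n * ∑ p : Fin (m + 1), H p|
      ≤ 4 * τ / √n := by
    rw [← sub_one_mul, abs_mul, abs_of_nonneg hRsum0]
    calc _ ≤ 2 / n * (2 * τ) := mul_le_mul hcount hRsum hRsum0 (by positivity)
      _ = 4 * τ / n := by ring
      _ ≤ 4 * τ / √n := by
        refine div_le_div_of_nonneg_left (by positivity) hs0 ?_
        nlinarith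
  change |∑ j, ∑ p, noiseCoef m F v j p ^ 2
    - ∑ j, ∑ p : Fin (m + 1), w j * v (p + 1) * a j p ^ 2| ≤ 40 * τ / √n at hstep1
  rw [hmain] at hstep1
  set R := 1 / (n : ℝ) * ∑ p : Fin (m + 1), H p
  set E := c * (1 / (n : ℝ)) * ∑ p : Fin (m + 1), H p * D p
  change |∑ j, ∑ p, noiseCoef m F v j p ^ 2 - R| ≤ _
  have e60 : 60 * τ / √(n : ℝ) = 40 * τ / √n + 16 * τ / √n + 4 * τ / √n := by ring
  rw [e60]
  rw [abs_le] at hstep1 hDsum hfin ⊢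
  constructor <;> linarith [hstep1.1, hstep1.2, hDsum.1, hDsum.2, hfin.1, hfin.2]

end NoiseCoef

/-! ### Functions in Sobolev ellipsoids -/

/-- Interpolation between the Lipschitz bound, for close arguments, and the trivial bound `2`. -/
lemma abs_cos_sub_cos_le {γ : ℝ} (h0 : 0 ≤ γ) (h1 : γ ≤ 1) (a b : ℝ) :
    |Real.cos a - Real.cos b| ≤ 2 * |a - b| ^ γ := by
  rcases le_total |a - b| 1 with h | h
  · have h2 : |a - b| ≤ |a - b| ^ γ := by
      rcases eq_or_lt_of_le (abs_nonneg (a - b)) with h' | h'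
      · rw [← h']; exact Real.rpow_nonneg le_rfl _
      · simpa using Real.rpow_le_rpow_of_exponent_ge h' h h1
    have h3 : |Real.cos a - Real.cos b| ≤ |a - b| := by
      have := Real.abs_sin_le_one ((a + b) / 2)
      have h4 : |Real.sin ((a - b) / 2)| ≤ |(a - b) / 2| := Real.abs_sin_le_abs
      rw [Real.cos_sub_cos, abs_mul, abs_mul, abs_neg, abs_two]
      rw [abs_div, abs_two] at h4
      nlinarith [abs_nonneg (Real.sin ((a + b) / 2)), abs_nonneg (Real.sin ((a - b) / 2))]
    linarith [abs_nonneg (a - b)]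
  · have h2 : 1 ≤ |a - b| ^ γ := Real.one_le_rpow h h0
    have := abs_sub (Real.cos a) (Real.cos b)
    linarith [Real.abs_cos_le_one a, Real.abs_cos_le_one b]

lemma summable_succ_rpow {s : ℝ} (hs : s < -1) :
    Summable (fun i : ℕ => ((i + 1 : ℕ) : ℝ) ^ s) :=
  (summable_nat_add_iff 1).2 (Real.summable_nat_rpow.2 hs)

/-- Termwise `i^γ |θ_i| = (i^α |θ_i|) · i^{γ-α}`, and `xy ≤ x² + y²`. The bound depends on the
ellipsoid only, which makes the Hölder constants uniform. -/
lemma summable_rpow_mul_abs {α γ C : ℝ} (hγ : 2 * γ - 2 * α < -1) {θ : ℕ → ℝ}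
    (hs : Summable (fun i : ℕ => ((i + 1 : ℕ) : ℝ) ^ (2 * α) * θ (i + 1) ^ 2))
    (hC : ∑' i : ℕ, ((i + 1 : ℕ) : ℝ) ^ (2 * α) * θ (i + 1) ^ 2 ≤ C) :
    Summable (fun i : ℕ => ((i + 1 : ℕ) : ℝ) ^ γ * |θ (i + 1)|) ∧
    ∑' i : ℕ, ((i + 1 : ℕ) : ℝ) ^ γ * |θ (i + 1)|
      ≤ C + ∑' i : ℕ, ((i + 1 : ℕ) : ℝ) ^ (2 * γ - 2 * α) := by
  have hle : ∀ i : ℕ, ((i + 1 : ℕ) : ℝ) ^ γ * |θ (i + 1)|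
      ≤ ((i + 1 : ℕ) : ℝ) ^ (2 * α) * θ (i + 1) ^ 2 + ((i + 1 : ℕ) : ℝ) ^ (2 * γ - 2 * α) := by
    intro i
    have hx : (0 : ℝ) < ((i + 1 : ℕ) : ℝ) := by positivity
    set x := ((i + 1 : ℕ) : ℝ)
    have e1 : x ^ (2 * α) = (x ^ α) ^ 2 := by rw [mul_comm, Real.rpow_mul hx.le, Real.rpow_two]
    have e2 : x ^ (2 * γ - 2 * α) = (x ^ (γ - α)) ^ 2 := by
      rw [show 2 * γ - 2 * α = (γ - α) * 2 by ring, Real.rpow_mul hx.le, Real.rpow_two]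
    have e3 : x ^ γ = x ^ α * x ^ (γ - α) := by rw [← Real.rpow_add hx]; congr 1; ring
    rw [e1, e2, e3, ← sq_abs (θ (i + 1))]
    have := Real.rpow_nonneg hx.le α
    have := Real.rpow_nonneg hx.le (γ - α)
    nlinarith [sq_nonneg (x ^ α * |θ (i + 1)| - x ^ (γ - α)), abs_nonneg (θ (i + 1)),
      mul_nonneg (mul_nonneg ‹0 ≤ x ^ α› ‹0 ≤ x ^ (γ - α)›) (abs_nonneg (θ (i + 1)))]
  have hsum := hs.add (summable_succ_rpow hγ)
  have h1 : Summable (fun i : ℕ => ((i + 1 : ℕ) : ℝ) ^ γ * |θ (i + 1)|) :=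
    Summable.of_nonneg_of_le (fun i => by positivity) hle hsum
  refine ⟨h1, (h1.tsum_le_tsum hle hsum).trans ?_⟩
  rw [hs.tsum_add (summable_succ_rpow hγ)]
  linarith

/-- Functions in a Sobolev ellipsoid of order `α` are uniformly Hölder of every order below
`α - 1/2`. -/
lemma sobolevS_holder {α γ C : ℝ} (h0 : 0 ≤ γ) (h1 : γ ≤ 1) (hγ : 2 * γ - 2 * α < -1) :
    ∃ K : ℝ, 0 ≤ K ∧ ∀ f ∈ sobolevS α C, ∀ x ∈ Icc (0 : ℝ) 1, ∀ y ∈ Icc (0 : ℝ) 1,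
      |f x - f y| ≤ K * |x - y| ^ γ := by
  set S := C + ∑' i : ℕ, ((i + 1 : ℕ) : ℝ) ^ (2 * γ - 2 * α)
  refine ⟨4 * Real.pi ^ γ * |S|, by positivity, ?_⟩
  rintro f ⟨-, θ, hθ, hs, hC⟩ x hx y hy
  obtain ⟨hs1, hs2⟩ := summable_rpow_mul_abs hγ hs hC
  have hsub := (hθ x hx).sub (hθ y hy)
  rw [sub_sub_sub_cancel_right] at hsub
  have hb : ∀ i : ℕ, ‖2 * θ (i + 1) * Real.cos (((i + 1 : ℕ) : ℝ) * Real.pi * x)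
      - 2 * θ (i + 1) * Real.cos (((i + 1 : ℕ) : ℝ) * Real.pi * y)‖
      ≤ 4 * Real.pi ^ γ * |x - y| ^ γ * (((i + 1 : ℕ) : ℝ) ^ γ * |θ (i + 1)|) := by
    intro i
    rw [← mul_sub, Real.norm_eq_abs, abs_mul, abs_mul, abs_two]
    have h := abs_cos_sub_cos_le h0 h1 (((i + 1 : ℕ) : ℝ) * Real.pi * x)
      (((i + 1 : ℕ) : ℝ) * Real.pi * y)
    rw [← mul_sub, abs_mul, abs_of_nonneg (by positivity : 0 ≤ ((i + 1 : ℕ) : ℝ) * Real.pi),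
      Real.mul_rpow (by positivity) (abs_nonneg _), Real.mul_rpow (by positivity)
      Real.pi_pos.le] at h
    calc _ ≤ 2 * |θ (i + 1)| * (2 * (((i + 1 : ℕ) : ℝ) ^ γ * Real.pi ^ γ * |x - y| ^ γ)) :=
          mul_le_mul_of_nonneg_left h (by positivity)
      _ = _ := by ring
  have hbd := tsum_of_norm_bounded (hs1.hasSum.mul_left (4 * Real.pi ^ γ * |x - y| ^ γ)) hb
  rw [hsub.tsum_eq, Real.norm_eq_abs] at hbd
  refine hbd.trans ?_
  have : ∑' i : ℕ, ((i + 1 : ℕ) : ℝ) ^ γ * |θ (i + 1)| ≤ |S| := hs2.trans (le_abs_self _)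
  calc _ ≤ 4 * Real.pi ^ γ * |x - y| ^ γ * |S| :=
        mul_le_mul_of_nonneg_left this (by positivity)
    _ = _ := by ring

lemma continuousOn_of_holder {f : ℝ → ℝ} {K γ : ℝ} (hγ : 0 < γ)
    (hf : ∀ x ∈ Icc (0 : ℝ) 1, ∀ y ∈ Icc (0 : ℝ) 1, |f x - f y| ≤ K * |x - y| ^ γ) :
    ContinuousOn f (Icc 0 1) := by
  intro x hx
  rw [ContinuousWithinAt, tendsto_iff_norm_sub_tendsto_zero]
  have hlim : Tendsto (fun y => K * |y - x| ^ γ) (𝓝[Icc 0 1] x) (𝓝 0) := by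
    have hc : Continuous (fun y : ℝ => K * |y - x| ^ γ) :=
      continuous_const.mul ((continuous_abs.comp (continuous_id.sub continuous_const)).rpow_const
        fun _ => Or.inr hγ.le)
    have := (hc.tendsto x).mono_left (nhdsWithin_le_nhds (s := Icc (0 : ℝ) 1))
    simpa [Real.zero_rpow hγ.ne'] using this
  refine tendsto_of_tendsto_of_tendsto_of_le_of_le' tendsto_const_nhds hlim
    (Eventually.of_forall fun _ => norm_nonneg _) ?_
  filter_upwards [self_mem_nhdsWithin] with y hy
  exact hf y hy x hx

/-- The error of a Riemann sum over `[0,1]` is bounded by the modulus of continuity. -/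
lemma abs_riemannSum_sub_integral_le {H : ℝ → ℝ} (hH : ContinuousOn H (Icc 0 1)) {n : ℕ}
    (hn : 0 < n) {ω : ℝ}
    (hω : ∀ x ∈ Icc (0 : ℝ) 1, ∀ y ∈ Icc (0 : ℝ) 1, |x - y| ≤ 1 / n → |H x - H y| ≤ ω) :
    |1 / (n : ℝ) * ∑ p ∈ Finset.range n, H ((p + 1 : ℕ) / n) - ∫ x in (0 : ℝ)..1, H x| ≤ ω := by
  have hn' : (0 : ℝ) < n := by exact_mod_cast hn
  have hmem : ∀ p : ℕ, p ≤ n → (p : ℝ) / n ∈ Icc (0 : ℝ) 1 := fun p hp =>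
    ⟨by positivity, by rw [div_le_one hn']; exact_mod_cast hp⟩
  have hle : ∀ p : ℕ, (p : ℝ) / n ≤ (p + 1 : ℕ) / n := fun p => by
    gcongr; linarith
  have hint : ∀ p < n, IntervalIntegrable H volume ((p : ℝ) / n) ((p + 1 : ℕ) / n) := fun p hp =>
    (hH.mono (Icc_subset_Icc (hmem p hp.le).1 (hmem (p + 1) hp).2)).intervalIntegrable_of_Icc (hle p)
  have hsum := intervalIntegral.sum_integral_adjacent_intervals
    (a := fun p : ℕ => (p : ℝ) / n) (f := H) (μ := volume) (n := n) hint
  simp only [Nat.cast_zero, zero_div, div_self hn'.ne'] at hsum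
  rw [← hsum, Finset.mul_sum, ← Finset.sum_sub_distrib]
  -- On each cell the summand is the integral of the value at the right end point, which differs
  -- from `H` by at most `ω` there.
  have hterm : ∀ p ∈ Finset.range n, |1 / (n : ℝ) * H ((p + 1 : ℕ) / n)
      - ∫ x in ((p : ℝ) / n)..((p + 1 : ℕ) / n), H x| ≤ ω / n := by
    intro p hp
    have hp := Finset.mem_range.1 hp
    have hlen : ((p + 1 : ℕ) : ℝ) / n - p / n = 1 / n := by push_cast; ring
    have e : 1 / (n : ℝ) * H ((p + 1 : ℕ) / n)
        = ∫ _ in ((p : ℝ) / n)..((p + 1 : ℕ) / n), H ((p + 1 : ℕ) / n) := by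
      rw [intervalIntegral.integral_const, hlen, smul_eq_mul]
    rw [e, ← intervalIntegral.integral_sub (by simp) (hint p hp)]
    have hb := intervalIntegral.norm_integral_le_of_norm_le_const
      (f := fun x => H ((p + 1 : ℕ) / n) - H x) (a := (p : ℝ) / n) (b := (p + 1 : ℕ) / n) (C := ω)
      (fun x hx => by
        rw [uIoc_of_le (hle p)] at hx
        have hx1 : x ∈ Icc (0 : ℝ) 1 :=
          ⟨(hmem p hp.le).1.trans hx.1.le, hx.2.trans (hmem (p + 1) hp).2⟩
        refine hω _ (hmem (p + 1) hp) _ hx1 ?_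
        rw [abs_of_nonneg (by linarith [hx.2])]
        linarith [hx.1])
    rw [hlen, abs_of_nonneg (by positivity)] at hb
    rw [Real.norm_eq_abs] at hb
    linarith [hb, (by ring : ω * (1 / (n : ℝ)) = ω / n)]
  refine (Finset.abs_sum_le_sum_abs _ _).trans ((Finset.sum_le_sum hterm).trans (le_of_eq ?_))
  rw [Finset.sum_const, Finset.card_range, nsmul_eq_mul]
  field_simp

/-! ### The cosine basis -/

lemma integral_cos_int {q : ℤ} (hq : q ≠ 0) : ∫ t in (0 : ℝ)..1, Real.cos (q * Real.pi * t) = 0 := by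
  have hc : (q : ℝ) * Real.pi ≠ 0 := mul_ne_zero (by exact_mod_cast hq) Real.pi_ne_zero
  rw [intervalIntegral.integral_comp_mul_left (fun x => Real.cos x) hc, integral_cos]
  simp [Real.sin_int_mul_pi]

lemma integral_cos_nat (i : ℕ) : ∫ t in (0 : ℝ)..1, Real.cos ((i + 1 : ℕ) * Real.pi * t) = 0 := by
  have := integral_cos_int (q := ((i + 1 : ℕ) : ℤ)) (by positivity)
  exact_mod_cast this

lemma integral_cos_mul_cos (i j : ℕ) :
    ∫ t in (0 : ℝ)..1, Real.cos ((i + 1 : ℕ) * Real.pi * t) * Real.cos ((j + 1 : ℕ) * Real.pi * t)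
      = if i = j then 1 / 2 else 0 := by
  have e : ∀ t : ℝ, Real.cos ((i + 1 : ℕ) * Real.pi * t) * Real.cos ((j + 1 : ℕ) * Real.pi * t)
      = 1 / 2 * (Real.cos ((((i : ℤ) - j : ℤ) : ℝ) * Real.pi * t)
        + Real.cos ((((i : ℤ) + j + 2 : ℤ) : ℝ) * Real.pi * t)) := by
    intro t
    have e1 : ((((i : ℤ) - j : ℤ) : ℝ) * Real.pi * t)
        = (i + 1 : ℕ) * Real.pi * t - (j + 1 : ℕ) * Real.pi * t := by push_cast; ring
    have e2 : ((((i : ℤ) + j + 2 : ℤ) : ℝ) * Real.pi * t)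
        = (i + 1 : ℕ) * Real.pi * t + (j + 1 : ℕ) * Real.pi * t := by push_cast; ring
    rw [e1, e2, Real.cos_sub, Real.cos_add]; ring
  simp_rw [e]
  rw [intervalIntegral.integral_const_mul, intervalIntegral.integral_add
    (by apply Continuous.intervalIntegrable; fun_prop)
    (by apply Continuous.intervalIntegrable; fun_prop),
    integral_cos_int (q := (i : ℤ) + j + 2) (by positivity)]
  split_ifs with h
  · subst h; simp
  · rw [integral_cos_int (by omega)]; simp

/-- Parseval's identity for finite cosine sums. -/
lemma integral_cosSum_sq (K : ℕ) (b₀ : ℝ) (b : ℕ → ℝ) :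
    ∫ t in (0 : ℝ)..1, (b₀ + 2 * ∑ i ∈ Finset.range K, b i * Real.cos ((i + 1 : ℕ) * Real.pi * t)) ^ 2
      = b₀ ^ 2 + 2 * ∑ i ∈ Finset.range K, b i ^ 2 := by
  have hexp : ∀ t : ℝ,
      (b₀ + 2 * ∑ i ∈ Finset.range K, b i * Real.cos ((i + 1 : ℕ) * Real.pi * t)) ^ 2
      = b₀ ^ 2 + 4 * b₀ * ∑ i ∈ Finset.range K, b i * Real.cos ((i + 1 : ℕ) * Real.pi * t)
        + 4 * ∑ i ∈ Finset.range K, ∑ j ∈ Finset.range K, (b i * b j)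
          * (Real.cos ((i + 1 : ℕ) * Real.pi * t) * Real.cos ((j + 1 : ℕ) * Real.pi * t)) := by
    intro t
    have : (∑ i ∈ Finset.range K, b i * Real.cos ((i + 1 : ℕ) * Real.pi * t)) ^ 2
        = ∑ i ∈ Finset.range K, ∑ j ∈ Finset.range K, (b i * b j)
          * (Real.cos ((i + 1 : ℕ) * Real.pi * t) * Real.cos ((j + 1 : ℕ) * Real.pi * t)) := by
      rw [sq, Finset.sum_mul_sum]
      exact Finset.sum_congr rfl fun _ _ => Finset.sum_congr rfl fun _ _ => by ring
    rw [← this]; ring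
  simp_rw [hexp]
  rw [intervalIntegral.integral_add (by apply Continuous.intervalIntegrable; fun_prop)
    (by apply Continuous.intervalIntegrable; fun_prop),
    intervalIntegral.integral_add (by simp) (by apply Continuous.intervalIntegrable; fun_prop),
    intervalIntegral.integral_const_mul, intervalIntegral.integral_const_mul,
    intervalIntegral.integral_finsetSum (fun i _ => by
      apply Continuous.intervalIntegrable; fun_prop),
    intervalIntegral.integral_finsetSum (fun i _ => by
      apply Continuous.intervalIntegrable; fun_prop)]
  have h1 : ∀ i ∈ Finset.range K, ∫ t in (0 : ℝ)..1, b i * Real.cos ((i + 1 : ℕ) * Real.pi * t)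
      = 0 := fun i _ => by
    rw [intervalIntegral.integral_const_mul, integral_cos_nat, mul_zero]
  have h2 : ∀ i ∈ Finset.range K, ∫ t in (0 : ℝ)..1, ∑ j ∈ Finset.range K, (b i * b j)
      * (Real.cos ((i + 1 : ℕ) * Real.pi * t) * Real.cos ((j + 1 : ℕ) * Real.pi * t))
      = b i ^ 2 * (1 / 2) := fun i hi => by
    rw [intervalIntegral.integral_finsetSum (fun i _ => by
      apply Continuous.intervalIntegrable; fun_prop)]
    simp_rw [intervalIntegral.integral_const_mul, integral_cos_mul_cos]
    simp [Finset.mem_range.1 hi, sq]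
  rw [Finset.sum_congr rfl h1, Finset.sum_congr rfl h2, ← Finset.sum_mul]
  simp
  ring

lemma halfBasis_zero (x : ℝ) : halfBasis 0 x = 1 := by simp [halfBasis, cosBasis]

/-- The reason for halving the argument: the squares of the `f_k`, which are what a quadratic
statistic sees, produce the full cosine basis. -/
lemma halfBasis_sq {k : ℕ} (hk : k ≠ 0) (x : ℝ) :
    halfBasis k x ^ 2 = 1 + Real.cos (k * Real.pi * x) := by
  have e : (k : ℝ) * Real.pi * x = 2 * (k * Real.pi * (x / 2)) := by ring
  rw [halfBasis, cosBasis, if_neg hk, mul_pow, Real.sq_sqrt (by norm_num), e, Real.cos_two_mul]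
  ring

lemma halfBasis_sq_le (k : ℕ) (x : ℝ) : halfBasis k x ^ 2 ≤ 2 := by
  by_cases hk : k = 0
  · subst hk; rw [halfBasis_zero]; norm_num
  · rw [halfBasis_sq hk]; linarith [Real.cos_le_one (k * Real.pi * x)]

lemma abs_halfBasis_sub_le (k : ℕ) (x y : ℝ) :
    (halfBasis k x - halfBasis k y) ^ 2 ≤ 9 * (k : ℝ) ^ 2 * (x - y) ^ 2 := by
  by_cases hk : k = 0
  · subst hk; simp [halfBasis_zero]
  · have h := abs_cos_sub_cos_le zero_le_one le_rfl (k * Real.pi * (x / 2)) (k * Real.pi * (y / 2))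
    have h' : |Real.cos (k * Real.pi * (x / 2)) - Real.cos (k * Real.pi * (y / 2))|
        ≤ |k * Real.pi * (x / 2) - k * Real.pi * (y / 2)| := by
      have := Real.abs_sin_le_one ((k * Real.pi * (x / 2) + k * Real.pi * (y / 2)) / 2)
      have h4 : |Real.sin ((k * Real.pi * (x / 2) - k * Real.pi * (y / 2)) / 2)|
          ≤ |(k * Real.pi * (x / 2) - k * Real.pi * (y / 2)) / 2| := Real.abs_sin_le_abs
      rw [Real.cos_sub_cos, abs_mul, abs_mul, abs_neg, abs_two]
      rw [abs_div, abs_two] at h4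
      nlinarith [abs_nonneg (Real.sin ((k * Real.pi * (x / 2) + k * Real.pi * (y / 2)) / 2)),
        abs_nonneg (Real.sin ((k * Real.pi * (x / 2) - k * Real.pi * (y / 2)) / 2))]
    have h2 := sq_le_sq.2 (by rwa [abs_abs, abs_abs] :
      |(|Real.cos (k * Real.pi * (x / 2)) - Real.cos (k * Real.pi * (y / 2))|)|
        ≤ |(|k * Real.pi * (x / 2) - k * Real.pi * (y / 2)|)|)
    rw [sq_abs, sq_abs] at h2
    simp only [halfBasis, cosBasis, if_neg hk]
    rw [← mul_sub, mul_pow, Real.sq_sqrt (by norm_num)]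
    have e : (k * Real.pi * (x / 2) - k * Real.pi * (y / 2)) ^ 2
        = (k : ℝ) ^ 2 * (x - y) ^ 2 * Real.pi ^ 2 / 4 := by ring
    rw [e] at h2
    -- With `π ≤ 4` the factor is at most `2 · 16 / 4 = 8`, below the stated `9`.
    have hpi : Real.pi ^ 2 ≤ 16 := by nlinarith [Real.pi_pos, Real.pi_le_four]
    have h5 : 0 ≤ (k : ℝ) ^ 2 * (x - y) ^ 2 := by positivity
    nlinarith

/-! ### Fourier coefficients and the integrated squared error -/

/-- The weighted mean `∫₀¹ f f_k²`, which `t̂_{k,0}` estimates. -/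
def weightedMean (f : ℝ → ℝ) (k : ℕ) : ℝ := ∫ x in (0 : ℝ)..1, f x * halfBasis k x ^ 2

lemma continuous_halfBasis (k : ℕ) : Continuous (halfBasis k) := by
  by_cases hk : k = 0
  · subst hk; exact continuous_const.congr fun x => (halfBasis_zero x).symm
  · have : halfBasis k = fun x => √2 * Real.cos (k * Real.pi * (x / 2)) := by
      funext x; simp [halfBasis, cosBasis, hk]
    rw [this]; fun_prop

lemma summable_abs_coef {α : ℝ} (hα : 1 / 2 < α) {θ : ℕ → ℝ}
    (hs : Summable (fun i : ℕ => ((i + 1 : ℕ) : ℝ) ^ (2 * α) * θ (i + 1) ^ 2)) :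
    Summable (fun i : ℕ => |θ (i + 1)|) := by
  have := (summable_rpow_mul_abs (γ := 0) (by linarith) hs le_rfl).1
  simpa using this

/-- The cosine series may be integrated term by term against `f_k²`, since `∑ |θ_i| < ∞` for `α >
1/2`. The summand `1` of `f_k²` leaves `θ_0` and the summand `cos(kπx)` picks out `θ_k`. -/
lemma weightedMean_eq {α : ℝ} (hα : 1 / 2 < α) {f : ℝ → ℝ} {θ : ℕ → ℝ}
    (hf : ContinuousOn f (Icc 0 1))
    (hθ : ∀ x ∈ Icc (0 : ℝ) 1,
      HasSum (fun i : ℕ => 2 * θ (i + 1) * Real.cos (((i + 1 : ℕ) : ℝ) * Real.pi * x))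
        (f x - θ 0))
    (hs : Summable (fun i : ℕ => ((i + 1 : ℕ) : ℝ) ^ (2 * α) * θ (i + 1) ^ 2)) (k : ℕ) :
    weightedMean f k = θ 0 + if k = 0 then 0 else θ k := by
  have habs := summable_abs_coef hα hs
  have hsum := intervalIntegral.hasSum_integral_of_dominated_convergence (μ := volume)
    (a := (0 : ℝ)) (b := 1)
    (F := fun (i : ℕ) t => 2 * θ (i + 1) * Real.cos (((i + 1 : ℕ) : ℝ) * Real.pi * t)
      * halfBasis k t ^ 2)
    (f := fun t => (f t - θ 0) * halfBasis k t ^ 2)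
    (fun i _ => 4 * |θ (i + 1)|)
    (fun i => by
      have := continuous_halfBasis k
      exact Continuous.aestronglyMeasurable (by fun_prop))
    (fun i => ae_of_all _ fun t _ => by
      have h1 := halfBasis_sq_le k t
      have h2 := Real.abs_cos_le_one (((i + 1 : ℕ) : ℝ) * Real.pi * t)
      rw [Real.norm_eq_abs, abs_mul, abs_mul, abs_mul, abs_two, abs_of_nonneg (sq_nonneg
        (halfBasis k t))]
      calc _ ≤ 2 * |θ (i + 1)| * 1 * 2 := by gcongr
        _ = _ := by ring)
    (ae_of_all _ fun t _ => habs.mul_left 4)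
    (by simp)
    (ae_of_all _ fun t ht => by
      rw [uIoc_of_le zero_le_one] at ht
      exact (hθ t ⟨ht.1.le, ht.2⟩).mul_right _)
  have hterm : ∀ i : ℕ, ∫ t in (0 : ℝ)..1, 2 * θ (i + 1)
      * Real.cos (((i + 1 : ℕ) : ℝ) * Real.pi * t) * halfBasis k t ^ 2
      = if i + 1 = k then θ (i + 1) else 0 := by
    intro i
    by_cases hk : k = 0
    · subst hk
      simp only [halfBasis_zero, one_pow, mul_one]
      rw [intervalIntegral.integral_const_mul, integral_cos_nat]
      simp
    · obtain ⟨k', rfl⟩ := Nat.exists_eq_succ_of_ne_zero hk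
      have e : ∀ t : ℝ, 2 * θ (i + 1) * Real.cos (((i + 1 : ℕ) : ℝ) * Real.pi * t)
          * halfBasis k'.succ t ^ 2
          = 2 * θ (i + 1) * Real.cos (((i + 1 : ℕ) : ℝ) * Real.pi * t)
            + 2 * θ (i + 1) * (Real.cos (((i + 1 : ℕ) : ℝ) * Real.pi * t)
              * Real.cos (((k' + 1 : ℕ) : ℝ) * Real.pi * t)) := fun t => by
        rw [halfBasis_sq hk]; ring
      simp_rw [e]
      rw [intervalIntegral.integral_add (by apply Continuous.intervalIntegrable; fun_prop)
        (by apply Continuous.intervalIntegrable; fun_prop), intervalIntegral.integral_const_mul,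
        intervalIntegral.integral_const_mul, integral_cos_nat, integral_cos_mul_cos]
      by_cases h : i = k'
      · simp only [h, if_true]; ring
      · simp [h]
  simp_rw [hterm] at hsum
  have hval : ∫ t in (0 : ℝ)..1, (f t - θ 0) * halfBasis k t ^ 2 = if k = 0 then 0 else θ k := by
    refine hsum.unique ?_
    by_cases hk : k = 0
    · subst hk; simp
    · obtain ⟨k', rfl⟩ := Nat.exists_eq_succ_of_ne_zero hk
      have := hasSum_ite_eq k' (θ (k' + 1))
      simp only [Nat.succ_eq_add_one, Nat.add_right_cancel_iff, if_neg hk]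
      refine this.congr_fun fun i => ?_
      by_cases h : i = k' <;> simp [h]
  have hbase : ∫ t in (0 : ℝ)..1, halfBasis k t ^ 2 = 1 := by
    by_cases hk : k = 0
    · subst hk; simp [halfBasis_zero]
    · obtain ⟨k', rfl⟩ := Nat.exists_eq_succ_of_ne_zero hk
      simp_rw [halfBasis_sq hk]
      rw [intervalIntegral.integral_add (by simp)
        (by apply Continuous.intervalIntegrable; fun_prop), Nat.succ_eq_add_one, integral_cos_nat]
      simp
  have hc := continuous_halfBasis k
  have hi1 : IntervalIntegrable (fun t => (f t - θ 0) * halfBasis k t ^ 2) volume 0 1 :=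
    ContinuousOn.intervalIntegrable_of_Icc zero_le_one
      ((hf.sub continuousOn_const).mul (hc.pow 2).continuousOn)
  have hi2 : IntervalIntegrable (fun t => θ 0 * halfBasis k t ^ 2) volume 0 1 := by
    apply Continuous.intervalIntegrable; fun_prop
  have e : ∀ t, f t * halfBasis k t ^ 2
      = (f t - θ 0) * halfBasis k t ^ 2 + θ 0 * halfBasis k t ^ 2 := fun t => by ring
  unfold weightedMean
  simp_rw [e]
  rw [intervalIntegral.integral_add hi1 hi2, hval, intervalIntegral.integral_const_mul, hbase]
  ring

lemma sobolevS_continuousOn {α C : ℝ} (hα : 1 / 2 < α) {f : ℝ → ℝ} (hf : f ∈ sobolevS α C) :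
    ContinuousOn f (Icc 0 1) := by
  have h1 : 0 < min 1 ((α - 1 / 2) / 2) := lt_min one_pos (by linarith)
  obtain ⟨K, -, hK⟩ := sobolevS_holder (C := C) (γ := min 1 ((α - 1 / 2) / 2)) (α := α)
    h1.le (min_le_left _ _) (by linarith [min_le_right 1 ((α - 1 / 2) / 2)])
  exact continuousOn_of_holder h1 (hK f hf)

lemma sum_tail_sq_le {α C : ℝ} (hα : 0 < α) {θ : ℕ → ℝ}
    (hs : Summable (fun i : ℕ => ((i + 1 : ℕ) : ℝ) ^ (2 * α) * θ (i + 1) ^ 2))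
    (hC : ∑' i : ℕ, ((i + 1 : ℕ) : ℝ) ^ (2 * α) * θ (i + 1) ^ 2 ≤ C) {N : ℕ} (hN : 1 ≤ N) (K : ℕ) :
    ∑ i ∈ Finset.Ico N K, θ (i + 1) ^ 2 ≤ C * (N : ℝ) ^ (-(2 * α)) := by
  have hN0 : (0 : ℝ) < N := by exact_mod_cast hN
  have hp : 0 < (N : ℝ) ^ (2 * α) := Real.rpow_pos_of_pos hN0 _
  rw [Real.rpow_neg hN0.le, ← div_eq_mul_inv, le_div_iff₀ hp, Finset.sum_mul]
  refine le_trans (Finset.sum_le_sum (g := fun i : ℕ => ((i + 1 : ℕ) : ℝ) ^ (2 * α) * θ (i + 1) ^ 2)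
    fun i hi => ?_) ((hs.sum_le_tsum _ fun i _ => by positivity).trans hC)
  rw [mul_comm]
  refine mul_le_mul_of_nonneg_right (Real.rpow_le_rpow hN0.le ?_ (by linarith)) (sq_nonneg _)
  exact_mod_cast (Finset.mem_Ico.1 hi).1.trans (Nat.le_succ _)

/-- The integrated squared error of a cosine series estimator with cut-off `N`. -/
lemma lintegral_cosSeries_sub_sq_le {β Q : ℝ} (hβ : 1 / 2 < β) {v : ℝ → ℝ} (hv : v ∈ sobolevS β Q)
    {N : ℕ} (hN : 1 ≤ N) (a : ℕ → ℝ) :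
    ∫⁻ t in Icc (0 : ℝ) 1, ENNReal.ofReal ((a 0 + 2 * ∑ i ∈ Finset.Icc 1 N,
        (a i - a 0) * Real.cos (i * Real.pi * t) - v t) ^ 2)
      ≤ ENNReal.ofReal ((a 0 - weightedMean v 0) ^ 2
        + 2 * ∑ i ∈ Finset.Icc 1 N, ((a i - weightedMean v i) - (a 0 - weightedMean v 0)) ^ 2
        + 2 * Q * (N : ℝ) ^ (-(2 * β))) := by
  have hcont := sobolevS_continuousOn hβ hv
  obtain ⟨-, θ, hθ, hs, hQ⟩ := hv
  have hμ := weightedMean_eq hβ hcont hθ hs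
  set E : ℝ := (a 0 - weightedMean v 0) ^ 2
    + 2 * ∑ i ∈ Finset.Icc 1 N, ((a i - weightedMean v i) - (a 0 - weightedMean v 0)) ^ 2
    + 2 * Q * (N : ℝ) ^ (-(2 * β)) with hE
  have hIcc : ∀ f : ℕ → ℝ, ∑ i ∈ Finset.Icc 1 N, f i = ∑ i ∈ Finset.range N, f (i + 1) := by
    intro f
    rw [Finset.range_eq_Ico, Finset.sum_Ico_add' f 0 N 1]
    rfl
  -- `g K` is the estimator minus the `K`-th partial sum of the target. It is a finite cosine sum,
  -- so Parseval holds without any limit.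
  let b : ℕ → ℝ := fun i => (if i < N then a (i + 1) - a 0 else 0) - θ (i + 1)
  let g : ℕ → ℝ → ℝ := fun K t =>
    (a 0 - θ 0) + 2 * ∑ i ∈ Finset.range K, b i * Real.cos ((i + 1 : ℕ) * Real.pi * t)
  have hsplit : ∀ (c : ℕ → ℝ) (K : ℕ), N ≤ K →
      ∑ i ∈ Finset.range K, (if i < N then c i else 0) = ∑ i ∈ Finset.range N, c i := by
    intro c K hK
    rw [← Finset.sum_filter]
    congr 1
    ext i
    simp only [Finset.mem_filter, Finset.mem_range]
    omega
  have hgK : ∀ K, N ≤ K → ∀ t, g K t = (a 0 + 2 * ∑ i ∈ Finset.Icc 1 N,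
      (a i - a 0) * Real.cos (i * Real.pi * t)) - θ 0
        - ∑ i ∈ Finset.range K, 2 * θ (i + 1) * Real.cos (((i + 1 : ℕ) : ℝ) * Real.pi * t) := by
    intro K hK t
    simp only [g, b]
    have e1 : ∀ i : ℕ, ((if i < N then a (i + 1) - a 0 else 0) - θ (i + 1))
        * Real.cos ((i + 1 : ℕ) * Real.pi * t)
        = (if i < N then (a (i + 1) - a 0) * Real.cos ((i + 1 : ℕ) * Real.pi * t) else 0)
          - θ (i + 1) * Real.cos ((i + 1 : ℕ) * Real.pi * t) := fun i => by
      split_ifs <;> ring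
    simp_rw [e1]
    rw [Finset.sum_sub_distrib, hsplit (fun i => (a (i + 1) - a 0)
      * Real.cos ((i + 1 : ℕ) * Real.pi * t)) K hK, hIcc]
    have e2 : ∑ i ∈ Finset.range K, 2 * θ (i + 1) * Real.cos (((i + 1 : ℕ) : ℝ) * Real.pi * t)
        = 2 * ∑ i ∈ Finset.range K, θ (i + 1) * Real.cos (((i + 1 : ℕ) : ℝ) * Real.pi * t) := by
      rw [Finset.mul_sum]
      exact Finset.sum_congr rfl fun _ _ => by ring
    rw [e2]
    ring
  have hlim : ∀ t ∈ Icc (0 : ℝ) 1, Tendsto (fun K => g K t) atTop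
      (𝓝 (a 0 + 2 * ∑ i ∈ Finset.Icc 1 N, (a i - a 0) * Real.cos (i * Real.pi * t) - v t)) := by
    intro t ht
    have h1 := (hθ t ht).tendsto_sum_nat
    have h2 := h1.const_sub ((a 0 + 2 * ∑ i ∈ Finset.Icc 1 N,
      (a i - a 0) * Real.cos (i * Real.pi * t)) - θ 0)
    rw [sub_sub_sub_cancel_right] at h2
    refine h2.congr' ?_
    filter_upwards [eventually_ge_atTop N] with K hK
    rw [hgK K hK t]
  have hgc : ∀ K, Continuous (g K) := fun K => by fun_prop
  have hint : ∀ K, ∫⁻ t in Icc (0 : ℝ) 1, ENNReal.ofReal (g K t ^ 2)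
      = ENNReal.ofReal ((a 0 - θ 0) ^ 2 + 2 * ∑ i ∈ Finset.range K, b i ^ 2) := by
    intro K
    have hi : IntegrableOn (fun t => g K t ^ 2) (Icc 0 1) :=
      ((hgc K).pow 2).continuousOn.integrableOn_Icc
    rw [← ofReal_integral_eq_lintegral_ofReal hi (ae_of_all _ fun t => sq_nonneg _),
      integral_Icc_eq_integral_Ioc, ← intervalIntegral.integral_of_le zero_le_one,
      integral_cosSum_sq]
  have hbound : ∀ K, N ≤ K → (a 0 - θ 0) ^ 2 + 2 * ∑ i ∈ Finset.range K, b i ^ 2 ≤ E := by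
    intro K hK
    have h0 : weightedMean v 0 = θ 0 := by rw [hμ]; simp
    have h1 : ∀ i : ℕ, weightedMean v (i + 1) = θ 0 + θ (i + 1) := fun i => by rw [hμ]; simp
    have h2 : ∑ i ∈ Finset.range K, b i ^ 2
        = ∑ i ∈ Finset.range N, (a (i + 1) - a 0 - θ (i + 1)) ^ 2
          + ∑ i ∈ Finset.Ico N K, θ (i + 1) ^ 2 := by
      rw [← Finset.sum_range_add_sum_Ico _ hK]
      congr 1
      · refine Finset.sum_congr rfl fun i hi => ?_
        simp [b, Finset.mem_range.1 hi]
      · refine Finset.sum_congr rfl fun i hi => ?_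
        simp [b, (Finset.mem_Ico.1 hi).1.not_gt]
    have h3 := sum_tail_sq_le (by linarith) hs hQ hN K
    have h4 : ∑ i ∈ Finset.Icc 1 N, ((a i - weightedMean v i) - (a 0 - weightedMean v 0)) ^ 2
        = ∑ i ∈ Finset.range N, (a (i + 1) - a 0 - θ (i + 1)) ^ 2 := by
      rw [hIcc]
      refine Finset.sum_congr rfl fun i _ => ?_
      rw [h0, h1]; ring
    rw [hE, h4, h2, h0]
    linarith
  -- Fatou's lemma passes from the partial sums, which converge at every point, to the target; only
  -- an upper bound is needed.
  calc _ = ∫⁻ t in Icc (0 : ℝ) 1, liminf (fun K => ENNReal.ofReal (g K t ^ 2)) atTop := by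
        refine setLIntegral_congr_fun measurableSet_Icc fun t ht => ?_
        have := ((ENNReal.continuous_ofReal.comp (continuous_pow 2)).tendsto _).comp (hlim t ht)
        exact this.liminf_eq.symm
    _ ≤ liminf (fun K => ∫⁻ t in Icc (0 : ℝ) 1, ENNReal.ofReal (g K t ^ 2)) atTop :=
        lintegral_liminf_le fun K => by
          have := (hgc K).measurable
          fun_prop
    _ ≤ ENNReal.ofReal E := by
        refine liminf_le_of_frequently_le' (Eventually.frequently ?_)
        filter_upwards [eventually_ge_atTop N] with K hK
        rw [hint]
        exact ENNReal.ofReal_le_ofReal (hbound K hK)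

/-! ### The mean squared error of a single coefficient -/

lemma coe_designPt (n i : ℕ) : ((designPt n i : ℝ≥0) : ℝ) = (i : ℝ) / n := by
  simp [designPt]

lemma designPt_mem {n i : ℕ} (h : i ≤ n) : ((designPt n i : ℝ≥0) : ℝ) ∈ Icc (0 : ℝ) 1 := by
  rw [coe_designPt]
  refine ⟨by positivity, div_le_one_of_le₀ (by exact_mod_cast h) (by positivity)⟩

/-- The modulus of continuity of `v f_k²` at distance `1/n`, which controls the Riemann sum. The
factor `v` contributes `n^{-1/2}` by its Hölder exponent, and `f_k²` contributes `k/n ≤ n^{-1/2}`.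
-/
lemma abs_mul_halfBasis_sq_sub_le {v : ℝ → ℝ} {Kv τ : ℝ} {n k : ℕ}
    (hv0 : ∀ x ∈ Icc (0 : ℝ) 1, 0 ≤ v x) (hv : ∀ x ∈ Icc (0 : ℝ) 1, v x ≤ τ) (hKv : 0 ≤ Kv)
    (hhol : ∀ x ∈ Icc (0 : ℝ) 1, ∀ y ∈ Icc (0 : ℝ) 1, |v x - v y| ≤ Kv * |x - y| ^ (1 / 2 : ℝ))
    (hn : 0 < n) (hk : (k : ℝ) ^ 2 ≤ n) {x y : ℝ} (hx : x ∈ Icc (0 : ℝ) 1) (hy : y ∈ Icc (0 : ℝ) 1)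
    (hxy : |x - y| ≤ 1 / n) :
    |v x * halfBasis k x ^ 2 - v y * halfBasis k y ^ 2| ≤ (2 * Kv + 9 * τ) / √n := by
  have hn0 : (0 : ℝ) < n := by exact_mod_cast hn
  have hs0 : 0 < √(n : ℝ) := Real.sqrt_pos.2 hn0
  have hs2 : √(n : ℝ) ^ 2 = n := Real.sq_sqrt hn0.le
  have hτ : 0 ≤ τ := (hv0 x hx).trans (hv x hx)
  have h1 : |v x - v y| ≤ Kv / √n := by
    have h2 : |x - y| ^ (1 / 2 : ℝ) ≤ (√(n : ℝ))⁻¹ := by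
      refine (Real.rpow_le_rpow (abs_nonneg _) hxy (by norm_num)).trans (le_of_eq ?_)
      rw [← Real.sqrt_eq_rpow, one_div, Real.sqrt_inv]
    exact (hhol x hx y hy).trans (mul_le_mul_of_nonneg_left h2 hKv)
  have h2 : |halfBasis k x ^ 2 - halfBasis k y ^ 2| ≤ 9 / √n := by
    have hd : |halfBasis k x - halfBasis k y| ≤ 3 / √n := by
      have h3 := abs_halfBasis_sub_le k x y
      have h4 : (x - y) ^ 2 ≤ 1 / (n : ℝ) ^ 2 := by
        rw [← sq_abs, ← one_div_pow]
        exact pow_le_pow_left₀ (abs_nonneg _) hxy 2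
      refine abs_le_of_sq_le_sq (h3.trans ?_) (by positivity)
      rw [div_pow, hs2]
      calc _ ≤ 9 * (n : ℝ) * (1 / (n : ℝ) ^ 2) := by gcongr
        _ = 3 ^ 2 / n := by field_simp; norm_num
    have hs : |halfBasis k x + halfBasis k y| ≤ 3 := by
      refine abs_le_of_sq_le_sq ?_ (by norm_num)
      nlinarith [halfBasis_sq_le k x, halfBasis_sq_le k y,
        sq_nonneg (halfBasis k x - halfBasis k y)]
    rw [sq_sub_sq, abs_mul]
    calc _ ≤ 3 * (3 / √(n : ℝ)) := mul_le_mul hs hd (abs_nonneg _) (by norm_num)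
      _ = 9 / √n := by ring
  have e : v x * halfBasis k x ^ 2 - v y * halfBasis k y ^ 2
      = halfBasis k x ^ 2 * (v x - v y) + v y * (halfBasis k x ^ 2 - halfBasis k y ^ 2) := by ring
  rw [e]
  refine (abs_add_le _ _).trans ?_
  rw [abs_mul, abs_mul, abs_of_nonneg (sq_nonneg _), abs_of_nonneg (hv0 y hy)]
  have a1 := mul_le_mul (halfBasis_sq_le k x) h1 (abs_nonneg _) (by norm_num)
  have a2 := mul_le_mul (hv y hy) h2 (abs_nonneg _) hτ
  calc _ ≤ 2 * (Kv / √n) + τ * (9 / √n) := add_le_add a1 a2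
    _ = _ := by ring

section Coefficient

variable {Ω : Type*} [MeasurableSpace Ω] {P : Measure Ω} [IsProbabilityMeasure P]

/-- The spectral statistic `j` of the increments of the signal. -/
def signalStat (m k : ℕ) (X : Fin (m + 1) → Ω → ℝ) (j : Fin m) (ω : Ω) : ℝ :=
  √(filterWeight (m + 1) (j + 1)) *
    ∑ i : Fin m, transIncr (m + 1) k (fun i => X i ω) i * dst (m + 1) (i + 1) (j + 1)

omit [MeasurableSpace Ω] in
lemma signalStat_eq (m k : ℕ) (X : Fin (m + 1) → Ω → ℝ) (j : Fin m) :
    signalStat m k X j = fun ω => √(filterWeight (m + 1) (j + 1)) *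
      ∑ i : Fin m, (X i.succ ω - X i.castSucc ω)
        * (halfBasis k (designPt (m + 1) (i + 1)) * dst (m + 1) (i + 1) (j + 1)) := by
  funext ω
  unfold signalStat
  congr 1
  refine Finset.sum_congr rfl fun i _ => ?_
  rw [← mul_assoc]
  rfl

omit [MeasurableSpace Ω] in
-- The filter is diagonal and nonnegative, so its square root goes inside the square, and
-- `sum_by_parts` rewrites the noise increments in terms of the independent errors.
lemma tHat_eq_normSq {m k : ℕ} (hL : 2 ≤ Real.logb 2 (m + 1 : ℕ)) (v : ℝ → ℝ)
    (X e : Fin (m + 1) → Ω → ℝ) (ω : Ω) :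
    tHat (m + 1) k (fun i => X i ω + √(v (designPt (m + 1) (i + 1))) * e i ω)
      = ∑ j, (signalStat m k X j ω + ∑ p, noiseCoef m (fun p => halfBasis k (designPt (m + 1) p))
        (fun p => v (designPt (m + 1) p)) j p * e p ω) ^ 2 := by
  rw [tHat_eq_sum]
  refine Finset.sum_congr rfl fun j _ => ?_
  have hw := filterWeight_nonneg hL (j + 1)
  have h1 := sum_by_parts m
    (fun p => dst (m + 1) p (j + 1) * halfBasis k (designPt (m + 1) p))
    (fun p => √(v (designPt (m + 1) (p + 1))) * e p ω) (by simp) (by simp [dst_self_left])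
  have h2 : ∑ i : Fin m, transIncr (m + 1) k
      (fun i => X i ω + √(v (designPt (m + 1) (i + 1))) * e i ω) i * dst (m + 1) (i + 1) (j + 1)
      = ∑ i : Fin m, transIncr (m + 1) k (fun i => X i ω) i * dst (m + 1) (i + 1) (j + 1)
        + ∑ p : Fin (m + 1), (dst (m + 1) p (j + 1) * halfBasis k (designPt (m + 1) p)
          - dst (m + 1) (p + 1) (j + 1) * halfBasis k (designPt (m + 1) (p + 1)))
            * (√(v (designPt (m + 1) (p + 1))) * e p ω) := by
    rw [← h1, ← Finset.sum_add_distrib]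
    refine Finset.sum_congr rfl fun i _ => ?_
    have e1 : (i.succ : Fin (m + 1)) = ⟨(i : ℕ) + 1, by omega⟩ := rfl
    have e2 : (i.castSucc : Fin (m + 1)) = ⟨(i : ℕ), by omega⟩ := rfl
    rw [e1, e2]
    simp only [transIncr]
    ring
  have h3 : ∑ p, noiseCoef m (fun p => halfBasis k (designPt (m + 1) p))
        (fun p => v (designPt (m + 1) p)) j p * e p ω
      = √(filterWeight (m + 1) (j + 1)) * ∑ p : Fin (m + 1),
        (dst (m + 1) p (j + 1) * halfBasis k (designPt (m + 1) p)
          - dst (m + 1) (p + 1) (j + 1) * halfBasis k (designPt (m + 1) (p + 1)))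
            * (√(v (designPt (m + 1) (p + 1))) * e p ω) := by
    rw [Finset.mul_sum]
    refine Finset.sum_congr rfl fun p _ => ?_
    simp only [noiseCoef]
    ring
  rw [h2, h3, signalStat, ← mul_add, mul_pow, Real.sq_sqrt hw]

omit [MeasurableSpace Ω] in
-- The signal needs no spectral analysis: the largest filter weight is taken out, and Parseval
-- returns the sum of squared increments, with `f_k² ≤ 2`.
lemma sum_signalStat_sq_le {m k : ℕ} (hL : 2 ≤ Real.logb 2 (m + 1 : ℕ))
    (X : Fin (m + 1) → Ω → ℝ) (ω : Ω) :
    ∑ j, signalStat m k X j ω ^ 2 ≤ 4 * Real.logb 2 (m + 1 : ℕ) ^ 2 / (m + 1 : ℕ)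
      * ∑ i : Fin m, (X i.succ ω - X i.castSucc ω) ^ 2 := by
  set L := Real.logb 2 (m + 1 : ℕ)
  have h1 : ∀ j, signalStat m k X j ω ^ 2 ≤ 2 * L ^ 2 / (m + 1 : ℕ) *
      (∑ i : Fin m, transIncr (m + 1) k (fun i => X i ω) i * dst (m + 1) (i + 1) (j + 1)) ^ 2 := by
    intro j
    rw [signalStat, mul_pow, Real.sq_sqrt (filterWeight_nonneg hL _)]
    exact mul_le_mul_of_nonneg_right (filterWeight_le hL (by omega) (by omega)) (sq_nonneg _)
  refine (Finset.sum_le_sum fun j _ => h1 j).trans ?_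
  rw [← Finset.mul_sum]
  have h2 := sum_dst_sq' m (fun i : Fin m => transIncr (m + 1) k (fun i => X i ω) i)
  rw [h2]
  have h3 : ∑ i : Fin m, transIncr (m + 1) k (fun i => X i ω) i ^ 2
      ≤ ∑ i : Fin m, 2 * (X i.succ ω - X i.castSucc ω) ^ 2 := by
    refine Finset.sum_le_sum fun i _ => ?_
    have e1 : (i.succ : Fin (m + 1)) = ⟨(i : ℕ) + 1, by omega⟩ := rfl
    have e2 : (i.castSucc : Fin (m + 1)) = ⟨(i : ℕ), by omega⟩ := rfl
    rw [e1, e2]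
    simp only [transIncr, mul_pow]
    rw [mul_comm]
    exact mul_le_mul_of_nonneg_right (halfBasis_sq_le _ _) (sq_nonneg _)
  rw [← Finset.mul_sum] at h3
  calc _ ≤ 2 * L ^ 2 / (m + 1 : ℕ) * (2 * ∑ i : Fin m, (X i.succ ω - X i.castSucc ω) ^ 2) :=
        mul_le_mul_of_nonneg_left h3 (by positivity)
    _ = _ := by ring

omit [IsProbabilityMeasure P] in
lemma integral_signalStat_le {m k : ℕ} (hL : 2 ≤ Real.logb 2 (m + 1 : ℕ))
    {X : Fin (m + 1) → Ω → ℝ} (hX : ∀ i : Fin m, MemLp (fun ω => X i.succ ω - X i.castSucc ω) 4 P)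
    {r : ℝ} (hr : ∀ i : Fin m, ∫ ω, (X i.succ ω - X i.castSucc ω) ^ 4 ∂P ≤ r ^ 2) :
    (∀ j, MemLp (signalStat m k X j) 4 P) ∧
    ∫ ω, (∑ j, signalStat m k X j ω ^ 2) ^ 2 ∂P ≤ (4 * Real.logb 2 (m + 1 : ℕ) ^ 2 * r) ^ 2 := by
  set L := Real.logb 2 (m + 1 : ℕ)
  have hZ : ∀ j, MemLp (signalStat m k X j) 4 P := by
    intro j
    rw [signalStat_eq]
    exact (memLp_finsetSum _ fun i _ => (hX i).mul_const _).const_mul _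
  refine ⟨hZ, ?_⟩
  have hle : ∀ ω, (∑ j, signalStat m k X j ω ^ 2) ^ 2
      ≤ (4 * L ^ 2 / (m + 1 : ℕ)) ^ 2 * ((m + 1 : ℕ)
        * ∑ i : Fin m, (X i.succ ω - X i.castSucc ω) ^ 4) := by
    intro ω
    refine (pow_le_pow_left₀ (Finset.sum_nonneg fun _ _ => sq_nonneg _)
      (sum_signalStat_sq_le hL X ω) 2).trans ?_
    rw [mul_pow]
    refine mul_le_mul_of_nonneg_left ?_ (sq_nonneg _)
    -- Cauchy–Schwarz over the increments. No independence of the increments is used, so both models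
    -- are covered.
    have h := sq_sum_le_card_mul_sum_sq (s := (Finset.univ : Finset (Fin m)))
      (f := fun i => (X i.succ ω - X i.castSucc ω) ^ 2)
    simp only [← pow_mul, Finset.card_univ, Fintype.card_fin] at h
    refine h.trans (mul_le_mul_of_nonneg_right ?_ (Finset.sum_nonneg fun _ _ =>
      Even.pow_nonneg (by decide) _))
    push_cast; linarith
  have hint : Integrable (fun ω => ∑ i : Fin m, (X i.succ ω - X i.castSucc ω) ^ 4) P :=
    integrable_finsetSum _ fun i _ => integrable_pow_four (hX i)
  refine (integral_mono ((memLp_finsetSum _ fun j _ => memLp_two_sq (hZ j)).integrable_sq)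
    ((hint.const_mul _).const_mul _) hle).trans ?_
  rw [integral_const_mul, integral_const_mul,
    integral_finsetSum _ fun i _ => integrable_pow_four (hX i)]
  have h1 : ∑ i : Fin m, ∫ ω, (X i.succ ω - X i.castSucc ω) ^ 4 ∂P ≤ (m + 1 : ℕ) * r ^ 2 := by
    refine (Finset.sum_le_sum fun i _ => hr i).trans ?_
    rw [Finset.sum_const, Finset.card_univ, Fintype.card_fin, nsmul_eq_mul]
    refine mul_le_mul_of_nonneg_right ?_ (sq_nonneg _)
    push_cast; linarith
  calc _ ≤ (4 * L ^ 2 / (m + 1 : ℕ)) ^ 2 * ((m + 1 : ℕ) * ((m + 1 : ℕ) * r ^ 2)) := by gcongr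
    _ = (4 * L ^ 2 * r) ^ 2 := by field_simp

/-- The constant in the bound for the mean squared error of the coefficients. -/
def mseConst (M τ Kv B : ℝ) : ℝ :=
  4 * (8 * M * (44 * τ * (62 * τ))) + 4 * (60 * τ + (2 * Kv + 9 * τ)) ^ 2
    + 16 * (44 * τ * (4 * B)) + 4 * (4 * B) ^ 2

/-- The mean squared error of `t̂_{k,0}` is of order `1/n`. -/
lemma integral_tHat_sub_sq_le {m k : ℕ} (hL : 2 ≤ Real.logb 2 (m + 1 : ℕ))
    (hkL : (k : ℝ) ^ 2 * Real.logb 2 (m + 1 : ℕ) ^ 2 ≤ (m + 1 : ℕ))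
    {e : Fin (m + 1) → Ω → ℝ} (hind : iIndepFun e P) (h4 : ∀ i, MemLp (e i) 4 P)
    (hmean : ∀ i, ∫ ω, e i ω ∂P = 0) (hvar : ∀ i, ∫ ω, e i ω ^ 2 ∂P = 1) {M : ℝ} (hM1 : 1 ≤ M)
    (hM : ∀ i, ∫ ω, e i ω ^ 4 ∂P ≤ M)
    {v : ℝ → ℝ} {Kv τ : ℝ} (hv0 : ∀ x ∈ Icc (0 : ℝ) 1, 0 ≤ v x)
    (hv : ∀ x ∈ Icc (0 : ℝ) 1, v x ≤ τ) (hKv : 0 ≤ Kv)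
    (hhol : ∀ x ∈ Icc (0 : ℝ) 1, ∀ y ∈ Icc (0 : ℝ) 1, |v x - v y| ≤ Kv * |x - y| ^ (1 / 2 : ℝ))
    {X : Fin (m + 1) → Ω → ℝ} (hXe : IndepFun (fun ω i => X i ω) (fun ω i => e i ω) P)
    (hX : ∀ i : Fin m, MemLp (fun ω => X i.succ ω - X i.castSucc ω) 4 P) {r : ℝ} (hr0 : 0 ≤ r)
    (hr : ∀ i : Fin m, ∫ ω, (X i.succ ω - X i.castSucc ω) ^ 4 ∂P ≤ r ^ 2) {B : ℝ}
    (hB : Real.logb 2 (m + 1 : ℕ) ^ 2 * r ≤ B / √(m + 1 : ℕ)) :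
    Integrable (fun ω => (tHat (m + 1) k
      (fun i => X i ω + √(v (designPt (m + 1) (i + 1))) * e i ω) - weightedMean v k) ^ 2) P ∧
    ∫ ω, (tHat (m + 1) k
      (fun i => X i ω + √(v (designPt (m + 1) (i + 1))) * e i ω) - weightedMean v k) ^ 2 ∂P
      ≤ mseConst M τ Kv B / (m + 1 : ℕ) := by
  have hn4 := four_le_of_logb hL
  simp only [tHat_eq_normSq hL v X e]
  set n : ℝ := ((m + 1 : ℕ) : ℝ) with hn
  set L := Real.logb 2 n with hLdef
  have hn0 : (0 : ℝ) < n := by linarith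
  have hs0 : 0 < √n := Real.sqrt_pos.2 hn0
  have hs2 : √n ^ 2 = n := Real.sq_sqrt hn0.le
  have hs1 : 1 ≤ √n := by rw [Real.one_le_sqrt]; linarith
  have hτ : 0 ≤ τ := (hv0 0 (by simp)).trans (hv 0 (by simp))
  set F : ℕ → ℝ := fun p => halfBasis k (designPt (m + 1) p) with hFdef
  set v' : ℕ → ℝ := fun p => v (designPt (m + 1) p) with hv'def
  have hF : ∀ p, F p ^ 2 ≤ 2 := fun p => halfBasis_sq_le _ _
  have hdF : ∀ p, (F (p + 1) - F p) ^ 2 ≤ 9 * (k : ℝ) ^ 2 / n ^ 2 := by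
    intro p
    refine (abs_halfBasis_sub_le k _ _).trans (le_of_eq ?_)
    rw [coe_designPt, coe_designPt, ← hn]
    push_cast
    field_simp
    ring
  have hv0' : ∀ p : Fin (m + 1), 0 ≤ v' (p + 1) := fun p => hv0 _ (designPt_mem (by omega))
  have hv' : ∀ p : Fin (m + 1), v' (p + 1) ≤ τ := fun p => hv _ (designPt_mem (by omega))
  have hop := sum_noiseCoef_mul_sq_le hL hkL hF hdF hv0' hv'
  have htr := abs_sum_noiseCoef_sq_sub_le hL hkL hF hdF hv0' hv'
  obtain ⟨hZ, hZr⟩ := integral_signalStat_le (k := k) hL hX hr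
  have hZe : IndepFun (fun ω j => signalStat m k X j ω) (fun ω i => e i ω) P := by
    refine hXe.comp (φ := fun (x : Fin (m + 1) → ℝ) (j : Fin m) =>
      √(filterWeight (m + 1) (j + 1)) *
        ∑ i : Fin m, transIncr (m + 1) k x i * dst (m + 1) (i + 1) (j + 1)) (ψ := id) ?_
        measurable_id
    simp only [transIncr]
    fun_prop
  have hρ0 : 0 ≤ 4 * L ^ 2 * r := by positivity
  have key := integral_normSq_sub_sq_le hind h4 hmean hvar hM1 hM (signalStat m k X) hZ hZe
    (noiseCoef m F v') hop (by positivity) hρ0 hZr (weightedMean v k)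
  refine ⟨key.1, key.2.trans ?_⟩
  set T := ∑ j, ∑ p, noiseCoef m F v' j p ^ 2 with hT
  -- the trace
  have hk2 : (k : ℝ) ^ 2 ≤ n := by
    refine le_trans ?_ hkL
    have : 1 ≤ L ^ 2 := by nlinarith
    nlinarith [sq_nonneg (k : ℝ)]
  have hcont : ContinuousOn (fun x => v x * halfBasis k x ^ 2) (Icc 0 1) :=
    (continuousOn_of_holder (by norm_num) hhol).mul
      ((continuous_halfBasis k).pow 2).continuousOn
  have hriem := abs_riemannSum_sub_integral_le hcont (n := m + 1) (by omega)
    (fun x hx y hy hxy => abs_mul_halfBasis_sq_sub_le hv0 hv hKv hhol (by omega) hk2 hx hy hxy)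
  have hsum : ∑ p ∈ Finset.range (m + 1), v ((p + 1 : ℕ) / n) * halfBasis k ((p + 1 : ℕ) / n) ^ 2
      = ∑ p : Fin (m + 1), v' (p + 1) * F (p + 1) ^ 2 := by
    rw [← Fin.sum_univ_eq_sum_range
      (fun p => v ((p + 1 : ℕ) / n) * halfBasis k ((p + 1 : ℕ) / n) ^ 2)]
    refine Finset.sum_congr rfl fun p _ => ?_
    simp only [hv'def, hFdef, coe_designPt, ← hn]
  rw [hsum] at hriem
  change |_ - weightedMean v k| ≤ _ at hriem
  have hTμ : |T - weightedMean v k| ≤ (60 * τ + (2 * Kv + 9 * τ)) / √n := by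
    rw [add_div]
    refine le_trans ?_ (add_le_add htr hriem)
    refine le_trans (le_of_eq ?_) (abs_add_le _ _)
    congr 1
    ring
  -- The Riemann sum is at most `2τ`, and the trace deviates from it by at most `60τ`.
  have hTle : T ≤ 62 * τ := by
    have h1 : 1 / n * ∑ p : Fin (m + 1), v' (p + 1) * F (p + 1) ^ 2 ≤ 2 * τ := by
      have : ∑ p : Fin (m + 1), v' (p + 1) * F (p + 1) ^ 2 ≤ n * (2 * τ) := by
        refine (Finset.sum_le_sum (g := fun _ => 2 * τ) fun p _ => ?_).trans ?_
        · exact (mul_le_mul (hv' p) (hF _) (sq_nonneg _) hτ).trans (by linarith)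
        · simp [hn]
      rw [one_div, inv_mul_le_iff₀ hn0]
      exact this
    have h2 : 60 * τ / √n ≤ 60 * τ := div_le_self (by positivity) hs1
    linarith [(abs_le.1 htr).2]
  have hTμ2 : (T - weightedMean v k) ^ 2 ≤ (60 * τ + (2 * Kv + 9 * τ)) ^ 2 / n := by
    rw [← hs2, ← div_pow]
    exact sq_le_sq.2 (hTμ.trans (le_abs_self _))
  have hρ : 4 * L ^ 2 * r ≤ 4 * B / √n := by
    calc _ = 4 * (L ^ 2 * r) := by ring
      _ ≤ 4 * (B / √n) := by linarith
      _ = _ := by ring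
  have hρ2 : (4 * L ^ 2 * r) ^ 2 ≤ (4 * B) ^ 2 / n := by
    rw [← hs2, ← div_pow]
    exact pow_le_pow_left₀ hρ0 hρ 2
  have hB0 : 0 ≤ B := by
    have h := (by positivity : 0 ≤ L ^ 2 * r).trans hB
    by_contra hneg
    exact absurd h (not_le.2 (div_neg_of_neg_of_pos (not_le.1 hneg) hs0))
  -- The factor `1/n` already comes from the operator norm, so boundedness of the signal term
  -- suffices here.
  have hκρ : 44 * τ / n * (4 * L ^ 2 * r) ≤ 44 * τ * (4 * B) / n := by
    calc _ ≤ 44 * τ / n * (4 * B / 1) := by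
          refine mul_le_mul_of_nonneg_left (hρ.trans ?_) (by positivity)
          exact div_le_div_of_nonneg_left (by positivity) one_pos hs1
      _ = _ := by ring
  have hκT : 44 * τ / n * T ≤ 44 * τ * (62 * τ) / n := by
    calc _ ≤ 44 * τ / n * (62 * τ) := mul_le_mul_of_nonneg_left hTle (by positivity)
      _ = _ := by ring
  have hMκT := mul_le_mul_of_nonneg_left hκT (by positivity : 0 ≤ 8 * M)
  calc _ ≤ 4 * (8 * M * (44 * τ * (62 * τ) / n)) + 4 * ((60 * τ + (2 * Kv + 9 * τ)) ^ 2 / n)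
        + 16 * (44 * τ * (4 * B) / n) + 4 * ((4 * B) ^ 2 / n) := by linarith
    _ = _ := by unfold mseConst; ring

end Coefficient

/-! ### Gaussian fourth moments and the Wiener integral -/

/-- The fourth moment of the standard normal distribution. -/
def gaussFour : ℝ := ∫ x, x ^ 4 ∂(gaussianReal 0 1)

lemma gaussFour_nonneg : 0 ≤ gaussFour := integral_nonneg fun _ => by positivity

/-- By scaling from the standard normal distribution; the numerical value of `gaussFour` is
irrelevant for the rates. -/
lemma integral_pow_four_gaussianReal (v : ℝ≥0) :
    ∫ x, x ^ 4 ∂(gaussianReal 0 v) = gaussFour * (v : ℝ) ^ 2 := by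
  have h := gaussianReal_map_const_mul (μ := 0) (v := 1) (√(v : ℝ))
  have hv : (⟨√(v : ℝ) ^ 2, sq_nonneg _⟩ : ℝ≥0) * 1 = v := by
    ext; simp
  rw [mul_zero] at h
  have h' : (gaussianReal 0 1).map (fun x => √(v : ℝ) * x) = gaussianReal 0 v := by
    rw [h]; congr 1
  rw [← h', integral_map (by fun_prop) (by fun_prop)]
  simp_rw [mul_pow]
  rw [integral_const_mul, gaussFour, mul_comm]
  congr 1
  rw [show √(v : ℝ) ^ 4 = (√(v : ℝ) ^ 2) ^ 2 by ring, Real.sq_sqrt (NNReal.coe_nonneg v)]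

lemma sum_mul_sq_expand {ι : Type*} [Fintype ι] (c z : ι → ℝ) :
    (∑ j, c j * z j) ^ 2 = ∑ j, ∑ k, (c j * c k) * (z j * z k) := by
  rw [sq, Finset.sum_mul_sum]
  exact Finset.sum_congr rfl fun _ _ => Finset.sum_congr rfl fun _ _ => by ring

section Wiener

variable {Ω : Type*} [MeasurableSpace Ω] {P : Measure Ω} {W : ℝ≥0 → Ω → ℝ}

lemma hasLaw_integral_pow_four {X : Ω → ℝ} {v : ℝ≥0} (hX : HasLaw X (gaussianReal 0 v) P) :
    ∫ ω, X ω ^ 4 ∂P = gaussFour * (v : ℝ) ^ 2 := by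
  rw [← integral_pow_four_gaussianReal, ← hX.map_eq, integral_map hX.aemeasurable (by fun_prop)]

section Combination

variable {ι : Type*} [Fintype ι] (hW : IsPreBrownianReal W P) (c : ι → ℝ) (a b : ι → ℝ≥0)

include hW

lemma hasGaussianLaw_combination :
    HasGaussianLaw (fun ω => ∑ j, c j * (W (b j) ω - W (a j) ω)) P := by
  classical
  have hproc : IsGaussianProcess (fun (j : ι) ω => c j * (W (b j) ω - W (a j) ω)) P := by
    apply hW.isGaussianProcess.of_isGaussianProcess
    intro j
    exact ⟨{b j, a j},
      { toFun x := c j * (x ⟨b j, by simp⟩ - x ⟨a j, by simp⟩)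
        map_add' x y := by simp; ring
        map_smul' r x := by simp; ring }, by simp⟩
  exact hproc.hasGaussianLaw_fun_sum (I := Finset.univ)

/-- Both sides are the length of the overlap of the two intervals: on the left through the
covariance `min`, on the right by intersecting. The isometry for step functions follows by
bilinearity. -/
lemma integral_increment_mul_increment {s t u w : ℝ≥0} (hst : s ≤ t) (huw : u ≤ w) :
    ∫ ω, (W t ω - W s ω) * (W w ω - W u ω) ∂P
      = ∫ x, (Ioc (s : ℝ) t).indicator (fun _ => (1 : ℝ)) x
        * (Ioc (u : ℝ) w).indicator (fun _ => (1 : ℝ)) x := by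
  have := hW.isGaussianProcess.isProbabilityMeasure
  have h2 : ∀ t, MemLp (W t) 2 P := fun t => (hW.isGaussianProcess.hasGaussianLaw_eval t).memLp_two
  have hm : ∀ s t, ∫ ω, (W t ω - W s ω) ∂P = 0 := fun s t => by
    rw [integral_sub (hW.integrable_eval t) (hW.integrable_eval s), hW.integral_eval,
      hW.integral_eval, sub_zero]
  have hcov := covariance_eq_sub (μ := P) ((h2 t).sub (h2 s)) ((h2 w).sub (h2 u))
  have e1 : ∫ ω, (W t ω - W s ω) * (W w ω - W u ω) ∂P = cov[W t - W s, W w - W u; P] := by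
    rw [hcov]
    have z : P[W t - W s] = 0 := hm s t
    rw [z, zero_mul, sub_zero]
    rfl
  rw [e1, covariance_sub_left (h2 _) (h2 _) ((h2 _).sub (h2 _)),
    covariance_sub_right (h2 _) (h2 _) (h2 _), covariance_sub_right (h2 _) (h2 _) (h2 _),
    hW.covariance_eval, hW.covariance_eval, hW.covariance_eval, hW.covariance_eval]
  have e2 : (fun x => (Ioc (s : ℝ) t).indicator (fun _ => (1 : ℝ)) x
      * (Ioc (u : ℝ) w).indicator (fun _ => (1 : ℝ)) x)
      = (Ioc (max (s : ℝ) u) (min (t : ℝ) w)).indicator (fun _ => (1 : ℝ)) := by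
    funext x
    rw [← Ioc_inter_Ioc]
    have := inter_indicator_mul (s := Ioc (s : ℝ) t) (t := Ioc (u : ℝ) w)
      (fun _ => (1 : ℝ)) (fun _ => 1) x
    rw [← this, mul_one]
  rw [e2, integral_indicator_const _ measurableSet_Ioc, Real.volume_real_Ioc, smul_eq_mul, mul_one]
  have hst' : (s : ℝ) ≤ t := hst
  have huw' : (u : ℝ) ≤ w := huw
  push_cast
  simp only [min_def, max_def]
  split_ifs <;> linarith

lemma memLp_combination [IsProbabilityMeasure P] {p : ℝ≥0∞} (hp : p ≠ ∞) :
    MemLp (fun ω => ∑ j, c j * (W (b j) ω - W (a j) ω)) p P :=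
  (hasGaussianLaw_combination hW c a b).memLp hp

lemma integral_combination_sq (hab : ∀ j, a j ≤ b j) :
    ∫ ω, (∑ j, c j * (W (b j) ω - W (a j) ω)) ^ 2 ∂P
      = ∫ x, (∑ j, c j * (Ioc (a j : ℝ) (b j)).indicator (fun _ => (1 : ℝ)) x) ^ 2 := by
  have := hW.isGaussianProcess.isProbabilityMeasure
  have h2 : ∀ j, MemLp (fun ω => W (b j) ω - W (a j) ω) 2 P := fun j =>
    (hW.isGaussianProcess.hasGaussianLaw_eval _).memLp_two.sub
      (hW.isGaussianProcess.hasGaussianLaw_eval _).memLp_two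
  have h2' : ∀ j, MemLp ((Ioc (a j : ℝ) (b j)).indicator (fun _ => (1 : ℝ))) 2 volume := fun j =>
    memLp_indicator_const 2 measurableSet_Ioc _ (Or.inr (by simp))
  simp_rw [sum_mul_sq_expand]
  have i1 : ∀ j k, Integrable (fun ω => (c j * c k)
      * ((W (b j) ω - W (a j) ω) * (W (b k) ω - W (a k) ω))) P := fun j k =>
    (integrable_mul_of_two (h2 j) (h2 k)).const_mul _
  have i2 : ∀ j k, Integrable (fun x => (c j * c k)
      * ((Ioc (a j : ℝ) (b j)).indicator (fun _ => (1 : ℝ)) x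
        * (Ioc (a k : ℝ) (b k)).indicator (fun _ => (1 : ℝ)) x)) volume := fun j k =>
    (integrable_mul_of_two (h2' j) (h2' k)).const_mul _
  rw [integral_finsetSum _ fun j _ => integrable_finsetSum _ fun k _ => i1 j k,
    integral_finsetSum _ fun j _ => integrable_finsetSum _ fun k _ => i2 j k]
  refine Finset.sum_congr rfl fun j _ => ?_
  rw [integral_finsetSum _ fun k _ => i1 j k, integral_finsetSum _ fun k _ => i2 j k]
  refine Finset.sum_congr rfl fun k _ => ?_
  rw [integral_const_mul, integral_const_mul,
    integral_increment_mul_increment hW (hab j) (hab k)]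

/-- A linear combination of Brownian increments is a centered Gaussian variable, so its fourth
moment is determined by its variance. -/
lemma integral_combination_pow_four :
    ∫ ω, (∑ j, c j * (W (b j) ω - W (a j) ω)) ^ 4 ∂P
      = gaussFour * (∫ ω, (∑ j, c j * (W (b j) ω - W (a j) ω)) ^ 2 ∂P) ^ 2 := by
  have := hW.isGaussianProcess.isProbabilityMeasure
  set G : Ω → ℝ := fun ω => ∑ j, c j * (W (b j) ω - W (a j) ω) with hG
  have hlaw := hasGaussianLaw_combination hW c a b
  have hmean : ∫ ω, G ω ∂P = 0 := by
    have hi : ∀ j, Integrable (fun ω => W (b j) ω - W (a j) ω) P := fun j =>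
      (hW.integrable_eval _).sub (hW.integrable_eval _)
    simp only [hG]
    rw [integral_finsetSum _ fun j _ => (hi j).const_mul _]
    refine Finset.sum_eq_zero fun j _ => ?_
    rw [integral_const_mul, integral_sub (hW.integrable_eval _) (hW.integrable_eval _),
      hW.integral_eval, hW.integral_eval, sub_zero, mul_zero]
  have hvar : Var[G; P] = ∫ ω, G ω ^ 2 ∂P := by
    rw [variance_eq_sub hlaw.memLp_two, hmean]
    simp [hG]
  have h := hlaw.map_eq_gaussianReal
  rw [hmean] at h
  have hl : HasLaw G (gaussianReal 0 Var[G; P].toNNReal) P := ⟨hlaw.aemeasurable, h⟩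
  rw [hasLaw_integral_pow_four hl, Real.coe_toNNReal _ (variance_nonneg _ _), hvar]

end Combination

/-! ### Itô isometry and fourth-moment bound for step integrands -/

lemma eLpNorm_two_eq {α : Type*} [MeasurableSpace α] {μ : Measure α} {f : α → ℝ}
    (hf : MemLp f 2 μ) : eLpNorm f 2 μ = ENNReal.ofReal (√(∫ x, f x ^ 2 ∂μ)) := by
  rw [hf.eLpNorm_eq_integral_rpow_norm (by norm_num) (by norm_num), Real.sqrt_eq_rpow]
  congr 3
  · simp
  · norm_num

lemma eLpNorm_four_eq {α : Type*} [MeasurableSpace α] {μ : Measure α} {f : α → ℝ}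
    (hf : MemLp f 4 μ) : eLpNorm f 4 μ = ENNReal.ofReal ((∫ x, f x ^ 4 ∂μ) ^ (1 / 4 : ℝ)) := by
  have h4 : (4 : ℝ≥0∞).toReal = ((4 : ℕ) : ℝ) := by norm_num
  have h : ∀ x, ‖f x‖ ^ (4 : ℝ≥0∞).toReal = f x ^ 4 := fun x => by
    rw [h4, Real.rpow_natCast, Real.norm_eq_abs, Even.pow_abs (by decide)]
  rw [hf.eLpNorm_eq_integral_rpow_norm (by norm_num) (by norm_num)]
  simp_rw [h, h4]
  norm_num

omit [MeasurableSpace Ω] in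
/-- The combination of increments that represents the difference of two elementary integrals. -/
lemma StepIntegrand.integral_sub_eq (φ ψ : StepIntegrand) (W : ℝ≥0 → Ω → ℝ) (ω : Ω) :
    φ.integral W ω - ψ.integral W ω = ∑ j : Fin φ.m ⊕ Fin ψ.m,
      Sum.elim (fun i : Fin φ.m => φ.c i) (fun i : Fin ψ.m => -ψ.c i) j
        * (W (Sum.elim (fun i : Fin φ.m => φ.t (i + 1)) (fun i : Fin ψ.m => ψ.t (i + 1)) j) ω
          - W (Sum.elim (fun i : Fin φ.m => φ.t i) (fun i : Fin ψ.m => ψ.t i) j) ω) := by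
  rw [Fintype.sum_sum_type, StepIntegrand.integral, StepIntegrand.integral,
    ← Fin.sum_univ_eq_sum_range (fun j => φ.c j * (W (φ.t (j + 1)) ω - W (φ.t j) ω)),
    ← Fin.sum_univ_eq_sum_range (fun j => ψ.c j * (W (ψ.t (j + 1)) ω - W (ψ.t j) ω)),
    sub_eq_add_neg, ← Finset.sum_neg_distrib]
  simp only [Sum.elim_inl, Sum.elim_inr, neg_mul]

/-- The same index type and coefficients as in `StepIntegrand.integral_sub_eq`. Overlapping
intervals are allowed there, so the two partitions need no common refinement. -/
lemma StepIntegrand.eval_sub_eq (φ ψ : StepIntegrand) (x : ℝ) :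
    φ.eval x - ψ.eval x = ∑ j : Fin φ.m ⊕ Fin ψ.m,
      Sum.elim (fun i : Fin φ.m => φ.c i) (fun i : Fin ψ.m => -ψ.c i) j
        * (Ioc ((Sum.elim (fun i : Fin φ.m => φ.t i) (fun i : Fin ψ.m => ψ.t i) j : ℝ≥0) : ℝ)
          ((Sum.elim (fun i : Fin φ.m => φ.t (i + 1)) (fun i : Fin ψ.m => ψ.t (i + 1)) j : ℝ≥0) :
            ℝ)).indicator
            (fun _ => (1 : ℝ)) x := by
  have h : ∀ (s : Set ℝ) (c : ℝ), s.indicator (fun _ => c) x = c * s.indicator (fun _ => 1) x := by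
    intro s c
    by_cases hx : x ∈ s <;> simp [hx]
  rw [Fintype.sum_sum_type, StepIntegrand.eval, StepIntegrand.eval,
    ← Fin.sum_univ_eq_sum_range
      (fun j => (Ioc (φ.t j : ℝ) (φ.t (j + 1) : ℝ)).indicator (fun _ => φ.c j) x),
    ← Fin.sum_univ_eq_sum_range
      (fun j => (Ioc (ψ.t j : ℝ) (ψ.t (j + 1) : ℝ)).indicator (fun _ => ψ.c j) x),
    sub_eq_add_neg, ← Finset.sum_neg_distrib]
  simp only [Sum.elim_inl, Sum.elim_inr, neg_mul, h _ (φ.c _), h _ (ψ.c _)]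

lemma StepIntegrand.memLp_eval (φ : StepIntegrand) : MemLp φ.eval 2 volume :=
  memLp_finsetSum _ fun _ _ => memLp_indicator_const 2 measurableSet_Ioc _ (Or.inr (by simp))

section Isometry

variable (hW : IsPreBrownianReal W P) (φ ψ : StepIntegrand)

include hW

lemma memLp_integral_sub {p : ℝ≥0∞} (hp : p ≠ ∞) :
    MemLp (fun ω => φ.integral W ω - ψ.integral W ω) p P := by
  have := hW.isGaussianProcess.isProbabilityMeasure
  simp_rw [StepIntegrand.integral_sub_eq]
  exact memLp_combination hW _ _ _ hp

/-- The Itô isometry for differences of step functions. -/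
lemma eLpNorm_integral_sub :
    eLpNorm (fun ω => φ.integral W ω - ψ.integral W ω) 2 P
      = eLpNorm (fun x => φ.eval x - ψ.eval x) 2 volume := by
  have h : MemLp (fun x => φ.eval x - ψ.eval x) 2 volume := φ.memLp_eval.sub ψ.memLp_eval
  rw [eLpNorm_two_eq (memLp_integral_sub hW φ ψ (by norm_num)), eLpNorm_two_eq h]
  simp_rw [StepIntegrand.integral_sub_eq, StepIntegrand.eval_sub_eq]
  rw [integral_combination_sq hW]
  rintro (i | i)
  · exact φ.mono (Nat.le_succ _)
  · exact ψ.mono (Nat.le_succ _)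

lemma eLpNorm_four_integral_sub_le :
    eLpNorm (fun ω => φ.integral W ω - ψ.integral W ω) 4 P
      ≤ ENNReal.ofReal (gaussFour ^ (1 / 4 : ℝ)) * eLpNorm (fun x => φ.eval x - ψ.eval x) 2 volume := by
  rw [← eLpNorm_integral_sub hW, eLpNorm_two_eq (memLp_integral_sub hW φ ψ (by norm_num)),
    eLpNorm_four_eq (memLp_integral_sub hW φ ψ (by norm_num)),
    ← ENNReal.ofReal_mul (Real.rpow_nonneg gaussFour_nonneg _)]
  simp_rw [StepIntegrand.integral_sub_eq]
  rw [integral_combination_pow_four hW]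
  refine ENNReal.ofReal_le_ofReal (le_of_eq ?_)
  set V := ∫ ω, (∑ j : Fin φ.m ⊕ Fin ψ.m,
      Sum.elim (fun i : Fin φ.m => φ.c i) (fun i : Fin ψ.m => -ψ.c i) j
        * (W (Sum.elim (fun i : Fin φ.m => φ.t (i + 1)) (fun i : Fin ψ.m => ψ.t (i + 1)) j) ω
          - W (Sum.elim (fun i : Fin φ.m => φ.t i) (fun i : Fin ψ.m => ψ.t i) j) ω)) ^ 2 ∂P
  have hV : 0 ≤ V := integral_nonneg fun _ => sq_nonneg _
  rw [Real.mul_rpow gaussFour_nonneg (sq_nonneg _), Real.sqrt_eq_rpow, ← Real.rpow_natCast,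
    ← Real.rpow_mul hV]
  norm_num

end Isometry

end Wiener

/-! ### The Wiener integral: fourth moments of increments, dependence on the path on `[0,1]` -/

lemma tendsto_eLpNorm_sub_sub {A : Type*} [MeasurableSpace A] {μ : Measure A} {f g : A → ℝ}
    {u v : ℕ → A → ℝ} (hf : AEStronglyMeasurable f μ) (hg : AEStronglyMeasurable g μ)
    (hu : ∀ r, AEStronglyMeasurable (u r) μ) (hv : ∀ r, AEStronglyMeasurable (v r) μ)
    (h1 : Tendsto (fun r => eLpNorm (fun x => f x - u r x) 2 μ) atTop (𝓝 0))
    (h2 : Tendsto (fun r => eLpNorm (fun x => g x - v r x) 2 μ) atTop (𝓝 0)) :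
    Tendsto (fun r => eLpNorm (fun x => (f x - g x) - (u r x - v r x)) 2 μ) atTop (𝓝 0) := by
  have h := h1.add h2
  rw [add_zero] at h
  refine tendsto_of_tendsto_of_tendsto_of_le_of_le tendsto_const_nhds h (fun _ => zero_le)
    fun r => ?_
  have e : (fun x => (f x - g x) - (u r x - v r x))
      = (fun x => f x - u r x) - fun x => g x - v r x := by
    funext x; simp only [Pi.sub_apply]; ring
  rw [e]
  exact eLpNorm_sub_le (hf.sub (hu r)) (hg.sub (hv r)) (by norm_num)

/-- An `L²`-convergent sequence converges almost surely along a subsequence. -/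
lemma exists_seq_tendsto_ae_of_eLpNorm_two {A : Type*} [MeasurableSpace A] {μ : Measure A}
    {f : A → ℝ} {u : ℕ → A → ℝ} (hf : AEStronglyMeasurable f μ)
    (hu : ∀ r, AEStronglyMeasurable (u r) μ)
    (h : Tendsto (fun r => eLpNorm (fun x => f x - u r x) 2 μ) atTop (𝓝 0)) :
    ∃ ns : ℕ → ℕ, StrictMono ns ∧ ∀ᵐ x ∂μ, Tendsto (fun i => u (ns i) x) atTop (𝓝 (f x)) := by
  refine (tendstoInMeasure_of_tendsto_eLpNorm (p := 2) (by norm_num) hu hf ?_).exists_seq_tendsto_ae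
  refine h.congr fun r => ?_
  rw [eLpNorm_sub_comm]
  rfl

/-- Fatou's lemma along an almost surely convergent subsequence. The exponent `p` need not be `2`:
this carries `L⁴` bounds through an `L²` limit. -/
lemma eLpNorm_le_of_tendsto_eLpNorm_two {A : Type*} [MeasurableSpace A] {μ : Measure A}
    {f : A → ℝ} {u : ℕ → A → ℝ} {p : ℝ≥0∞} {w : ℕ → ℝ≥0∞} {c : ℝ≥0∞}
    (hf : AEStronglyMeasurable f μ) (hu : ∀ r, AEStronglyMeasurable (u r) μ)
    (h : Tendsto (fun r => eLpNorm (fun x => f x - u r x) 2 μ) atTop (𝓝 0))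
    (hw : ∀ r, eLpNorm (u r) p μ ≤ w r) (hc : Tendsto w atTop (𝓝 c)) :
    eLpNorm f p μ ≤ c := by
  obtain ⟨ns, hns, hae⟩ := exists_seq_tendsto_ae_of_eLpNorm_two hf hu h
  refine (Lp.eLpNorm_lim_le_liminf_eLpNorm (fun r => hu (ns r)) f hae).trans ?_
  rw [← (hc.comp hns.tendsto_atTop).liminf_eq]
  exact liminf_le_liminf (Eventually.of_forall fun r => hw (ns r))

/-- The step function `φ` restricted to `[0,1]`. -/
def StepIntegrand.truncate (φ : StepIntegrand) : StepIntegrand where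
  m := φ.m
  t j := min (φ.t j) 1
  mono _ _ h := min_le_min_right 1 (φ.mono h)
  c := φ.c

lemma StepIntegrand.truncate_eval (φ : StepIntegrand) :
    φ.truncate.eval = (Iic (1 : ℝ)).indicator φ.eval := by
  funext x
  have h : ∀ a b : ℝ≥0, ∀ c : ℝ, (Ioc ((min a 1 : ℝ≥0) : ℝ) ((min b 1 : ℝ≥0) : ℝ)).indicator
      (fun _ => c) x
      = (Iic (1 : ℝ)).indicator (fun x => (Ioc (a : ℝ) b).indicator (fun _ => c) x) x := by
    intro a b c
    simp only [indicator, mem_Ioc, mem_Iic, NNReal.coe_min, NNReal.coe_one, min_lt_iff, le_min_iff]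
    by_cases h1 : x ≤ 1
    · simp [h1, not_lt.2 h1]
    · simp [h1]
  simp only [StepIntegrand.eval, StepIntegrand.truncate, h]
  by_cases h1 : x ∈ Iic (1 : ℝ) <;> simp [h1, StepIntegrand.eval]

section Wiener

variable {Ω : Type*} [MeasurableSpace Ω] {P : Measure Ω} {W : ℝ≥0 → Ω → ℝ}

omit [MeasurableSpace Ω] in
lemma StepIntegrand.exists_measurable_truncate_integral (φ : StepIntegrand) :
    ∃ Ψ : (Icc (0 : ℝ≥0) 1 → ℝ) → ℝ, Measurable Ψ ∧
      ∀ (W : ℝ≥0 → Ω → ℝ) ω, φ.truncate.integral W ω = Ψ fun t => W t ω := by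
  refine ⟨fun w => ∑ j ∈ Finset.range φ.m, φ.c j
    * (w ⟨min (φ.t (j + 1)) 1, zero_le, min_le_right _ _⟩
      - w ⟨min (φ.t j) 1, zero_le, min_le_right _ _⟩), by fun_prop, fun W ω => rfl⟩

lemma aestronglyMeasurable_integral (hW : IsPreBrownianReal W P) (φ : StepIntegrand) :
    AEStronglyMeasurable (fun ω => φ.integral W ω) P := by
  have h : ∀ t, AEMeasurable (W t) P := fun t => (hW.hasLaw_eval t).aemeasurable
  refine AEMeasurable.aestronglyMeasurable ?_
  unfold StepIntegrand.integral
  exact Finset.aemeasurable_fun_sum _ fun j _ => ((h _).sub (h _)).const_mul _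

/-- The increment is the `L²`-limit of differences of elementary integrals, whose `L⁴`-norms are
bounded by `gaussFour^{1/4}` times the `L²`-norms of the differences of the integrands. The latter
converge to the norm of `f` on `(b₁, b₂]`. -/
lemma IsWienerIntegral.eLpNorm_sub_le (hW : IsPreBrownianReal W P) {f : ℝ → ℝ} {b₁ b₂ : ℝ≥0}
    {X₁ X₂ : Ω → ℝ} (h : b₁ ≤ b₂) (h1 : IsWienerIntegral P W f b₁ X₁)
    (h2 : IsWienerIntegral P W f b₂ X₂) :
    eLpNorm (fun ω => X₂ ω - X₁ ω) 4 P ≤ ENNReal.ofReal (gaussFour ^ (1 / 4 : ℝ))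
      * eLpNorm ((Ioc (b₁ : ℝ) b₂).indicator f) 2 volume := by
  obtain ⟨hf1, hX1, φ₁, hφ1, hI1⟩ := h1
  obtain ⟨hf2, hX2, φ₂, hφ2, hI2⟩ := h2
  have hF : (Ioc (b₁ : ℝ) b₂).indicator f
      = fun x => (Ioc (0 : ℝ) b₂).indicator f x - (Ioc (0 : ℝ) b₁).indicator f x := by
    funext x
    have h' : (b₁ : ℝ) ≤ b₂ := h
    have h0 : (0 : ℝ) ≤ b₁ := b₁.2
    simp only [indicator, mem_Ioc]
    split_ifs <;> grind
  have hD := tendsto_eLpNorm_sub_sub hX2.1 hX1.1 (fun r => aestronglyMeasurable_integral hW (φ₂ r))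
    (fun r => aestronglyMeasurable_integral hW (φ₁ r)) hI2 hI1
  have hE := tendsto_eLpNorm_sub_sub hf2.1 hf1.1 (fun r => (φ₂ r).memLp_eval.1)
    (fun r => (φ₁ r).memLp_eval.1) hφ2 hφ1
  refine eLpNorm_le_of_tendsto_eLpNorm_two (hX2.1.sub hX1.1)
    (fun r => (aestronglyMeasurable_integral hW (φ₂ r)).sub (aestronglyMeasurable_integral hW (φ₁ r)))
    hD (w := fun r => ENNReal.ofReal (gaussFour ^ (1 / 4 : ℝ))
      * (eLpNorm ((Ioc (b₁ : ℝ) b₂).indicator f) 2 volume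
        + eLpNorm (fun x => ((Ioc (0 : ℝ) b₂).indicator f x - (Ioc (0 : ℝ) b₁).indicator f x)
          - ((φ₂ r).eval x - (φ₁ r).eval x)) 2 volume)) (fun r => ?_) ?_
  · refine (eLpNorm_four_integral_sub_le hW (φ₂ r) (φ₁ r)).trans (mul_le_mul_right ?_ _)
    rw [hF]
    refine le_trans (le_of_eq ?_) (MeasureTheory.eLpNorm_sub_le (hf2.1.sub hf1.1)
      ((hf2.1.sub hf1.1).sub ((φ₂ r).memLp_eval.1.sub (φ₁ r).memLp_eval.1)) (by norm_num))
    congr 1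
    funext x
    simp
  · have := ENNReal.Tendsto.const_mul (a := ENNReal.ofReal (gaussFour ^ (1 / 4 : ℝ)))
      (hE.const_add (eLpNorm ((Ioc (b₁ : ℝ) b₂).indicator f) 2 volume))
      (Or.inr ENNReal.ofReal_ne_top)
    rwa [add_zero] at this

/-- Up to a null set, a Wiener integral over a subinterval of `[0,1]` is a measurable function of
the path on `[0,1]`. -/
lemma IsWienerIntegral.exists_measurable (hW : IsPreBrownianReal W P) {f : ℝ → ℝ} {b : ℝ≥0}
    {X : Ω → ℝ} (hb : b ≤ 1) (h : IsWienerIntegral P W f b X) :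
    ∃ Φ : (Icc (0 : ℝ≥0) 1 → ℝ) → ℝ, Measurable Φ ∧ X =ᵐ[P] fun ω => Φ fun t => W t ω := by
  obtain ⟨hf, hX, φ, hφ, hI⟩ := h
  set F := (Ioc (0 : ℝ) b).indicator f with hF
  have hF1 : F = (Iic (1 : ℝ)).indicator F := by
    rw [hF, indicator_indicator]
    congr 1
    ext x
    have : (b : ℝ) ≤ 1 := hb
    simp only [mem_Ioc, mem_inter_iff, mem_Iic]
    grind
  -- The approximating step functions may reach beyond time `1`. Since `F` vanishes there,
  -- truncation only decreases the error, and by the isometry the truncated integrals have the same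
  -- limit `X`.
  have hT : Tendsto (fun r => eLpNorm (fun x => F x - (φ r).truncate.eval x) 2 volume)
      atTop (𝓝 0) := by
    refine tendsto_of_tendsto_of_tendsto_of_le_of_le tendsto_const_nhds hφ (fun _ => zero_le)
      fun r => ?_
    have e : (fun x => F x - (φ r).truncate.eval x)
        = (Iic (1 : ℝ)).indicator fun x => F x - (φ r).eval x := by
      rw [StepIntegrand.truncate_eval]
      funext x
      have := congrFun hF1 x
      by_cases hx : x ∈ Iic (1 : ℝ)
      · simp [hx]
      · rw [this]; simp [hx]
    rw [e]
    exact eLpNorm_indicator_le _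
  have hE : Tendsto (fun r => eLpNorm (fun ω => X ω - (φ r).truncate.integral W ω) 2 P)
      atTop (𝓝 0) := by
    have hs := hI.add (tendsto_eLpNorm_sub_sub hf.1 hf.1 (fun r => (φ r).memLp_eval.1)
      (fun r => (φ r).truncate.memLp_eval.1) hφ hT)
    rw [add_zero] at hs
    refine tendsto_of_tendsto_of_tendsto_of_le_of_le tendsto_const_nhds hs (fun _ => zero_le)
      fun r => ?_
    have e : (fun ω => X ω - (φ r).truncate.integral W ω)
        = (fun ω => X ω - (φ r).integral W ω)
          + fun ω => (φ r).integral W ω - (φ r).truncate.integral W ω := by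
      funext ω; simp
    rw [e]
    refine (eLpNorm_add_le (hX.1.sub (aestronglyMeasurable_integral hW _))
      (memLp_integral_sub hW (φ r) (φ r).truncate (p := 2) (by norm_num)).1 (by norm_num)).trans ?_
    rw [eLpNorm_integral_sub hW, ← eLpNorm_neg (fun x => (φ r).eval x - (φ r).truncate.eval x)]
    refine add_le_add le_rfl (le_of_eq ?_)
    congr 1
    funext x
    simp
  obtain ⟨ns, -, hae⟩ := exists_seq_tendsto_ae_of_eLpNorm_two hX.1
    (fun r => aestronglyMeasurable_integral hW (φ r).truncate) hE
  choose Ψ hΨ hΨW using fun r => (φ r).exists_measurable_truncate_integral (Ω := Ω)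
  -- `limUnder` takes a default value on paths where the sequence diverges; these form a null set.
  refine ⟨fun w => limUnder atTop fun r => Ψ (ns r) w,
    (StronglyMeasurable.limUnder fun r => (hΨ (ns r)).stronglyMeasurable).measurable, ?_⟩
  filter_upwards [hae] with ω hω
  simp only [hΨW] at hω
  exact hω.limUnder_eq.symm

end Wiener

/-! ### The signal in the two models -/

lemma designPt_le_one {n i : ℕ} (h : i ≤ n) : designPt n i ≤ 1 := by
  have := (designPt_mem h).2
  exact_mod_cast this

lemma designPt_mono {n i j : ℕ} (h : i ≤ j) : designPt n i ≤ designPt n j := by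
  unfold designPt
  gcongr

lemma designPt_succ_sub (n i : ℕ) : (designPt n (i + 1) : ℝ) - designPt n i = 1 / n := by
  rw [coe_designPt, coe_designPt]
  push_cast
  ring

lemma pow_four_add_le (a b : ℝ) : (a + b) ^ 4 ≤ 8 * (a ^ 4 + b ^ 4) := by
  nlinarith [sq_nonneg (a - b), sq_nonneg (a + b), sq_nonneg (a ^ 2 - b ^ 2),
    mul_nonneg (sq_nonneg (a - b)) (sq_nonneg (a + b)), sq_nonneg ((a - b) ^ 2)]

lemma abs_sqrt_sub_sqrt_le {a b l : ℝ} (hl : 0 < l) (ha : l ≤ a) (hb : l ≤ b) :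
    |√a - √b| ≤ |a - b| / √l := by
  have h1 : √l ≤ √a := Real.sqrt_le_sqrt ha
  have h2 : 0 < √l := Real.sqrt_pos.2 hl
  have h3 : a - b = (√a - √b) * (√a + √b) := by
    have e1 := Real.mul_self_sqrt (hl.le.trans ha)
    have e2 := Real.mul_self_sqrt (hl.le.trans hb)
    linear_combination -e1 + e2
  rw [le_div_iff₀ h2, h3, abs_mul]
  refine mul_le_mul_of_nonneg_left ?_ (abs_nonneg _)
  exact (h1.trans (le_add_of_nonneg_right (Real.sqrt_nonneg b))).trans (le_abs_self _)

section Signal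

variable {Ω : Type*} [MeasurableSpace Ω] {P : Measure Ω} {W : ℝ≥0 → Ω → ℝ}

/-- The errors are assumed independent of the path on `[0,1]` only, so the signal has to be
exhibited as a measurable function of that path, up to null sets. -/
lemma IsNoiseRow.indepFun_of_path {n : ℕ} {e : Fin n → Ω → ℝ} (he : IsNoiseRow P W e)
    {X : Fin n → Ω → ℝ}
    (hX : ∀ i, ∃ Φ : (Icc (0 : ℝ≥0) 1 → ℝ) → ℝ, Measurable Φ ∧ X i =ᵐ[P] fun ω => Φ fun t => W t ω) :
    IndepFun (fun ω i => X i ω) (fun ω i => e i ω) P := by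
  choose Φ hΦ hXΦ using hX
  have h := he.indep_brownian.comp (φ := fun w i => Φ i w) (measurable_pi_lambda _ hΦ) measurable_id
  refine h.congr ?_ EventuallyEq.rfl
  filter_upwards [ae_all_iff.2 hXΦ] with ω hω
  funext i
  exact (hω i).symm

/-- The integrand `√s` is at most `√u` on `(b₁, b₂]`, so its `L²`-norm there is at most `√(u (b₂ -
b₁))`; the fourth power of the `L⁴` estimate is the claim. -/
lemma IsWienerIntegral.increment_four (hW : IsPreBrownianReal W P) {s : ℝ → ℝ} {b₁ b₂ : ℝ≥0}
    {X₁ X₂ : Ω → ℝ} {u : ℝ} (h : b₁ ≤ b₂) (hs : ∀ x ∈ Ioc (b₁ : ℝ) b₂, s x ≤ u) (hu : 0 ≤ u)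
    (h1 : IsWienerIntegral P W (fun x => √(s x)) b₁ X₁)
    (h2 : IsWienerIntegral P W (fun x => √(s x)) b₂ X₂) :
    MemLp (fun ω => X₂ ω - X₁ ω) 4 P
      ∧ ∫ ω, (X₂ ω - X₁ ω) ^ 4 ∂P ≤ gaussFour * (u * ((b₂ : ℝ) - b₁)) ^ 2 := by
  have hd : (0 : ℝ) ≤ (b₂ : ℝ) - b₁ := sub_nonneg.2 h
  have hF : eLpNorm ((Ioc (b₁ : ℝ) b₂).indicator fun x => √(s x)) 2 volume
      ≤ ENNReal.ofReal (√(u * ((b₂ : ℝ) - b₁))) := by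
    have hm : eLpNorm ((Ioc (b₁ : ℝ) b₂).indicator fun x => √(s x)) 2 volume
        ≤ eLpNorm ((Ioc (b₁ : ℝ) b₂).indicator fun _ => √u) 2 volume := by
      refine eLpNorm_mono fun x => ?_
      by_cases hx : x ∈ Ioc (b₁ : ℝ) b₂
      · simp only [indicator_of_mem hx, Real.norm_eq_abs, abs_of_nonneg (Real.sqrt_nonneg _)]
        exact Real.sqrt_le_sqrt (hs x hx)
      · simp [hx]
    refine hm.trans (le_of_eq ?_)
    rw [eLpNorm_indicator_const measurableSet_Ioc (by norm_num) (by norm_num), Real.volume_Ioc,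
      Real.enorm_of_nonneg (Real.sqrt_nonneg _), ENNReal.ofReal_rpow_of_nonneg hd (by norm_num),
      ← ENNReal.ofReal_mul (Real.sqrt_nonneg _), Real.sqrt_mul hu, Real.sqrt_eq_rpow ((b₂ : ℝ) - b₁)]
    norm_num
  have hle : eLpNorm (fun ω => X₂ ω - X₁ ω) 4 P
      ≤ ENNReal.ofReal (gaussFour ^ (1 / 4 : ℝ) * √(u * ((b₂ : ℝ) - b₁))) := by
    rw [ENNReal.ofReal_mul (Real.rpow_nonneg gaussFour_nonneg _)]
    exact (IsWienerIntegral.eLpNorm_sub_le hW h h1 h2).trans (by gcongr)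
  have hmem : MemLp (fun ω => X₂ ω - X₁ ω) 4 P :=
    ⟨h2.2.1.1.sub h1.2.1.1, hle.trans_lt ENNReal.ofReal_lt_top⟩
  refine ⟨hmem, ?_⟩
  have hI : 0 ≤ ∫ ω, (X₂ ω - X₁ ω) ^ 4 ∂P := integral_nonneg fun _ => by positivity
  have hR : 0 ≤ gaussFour ^ (1 / 4 : ℝ) * √(u * ((b₂ : ℝ) - b₁)) :=
    mul_nonneg (Real.rpow_nonneg gaussFour_nonneg _) (Real.sqrt_nonneg _)
  rw [eLpNorm_four_eq hmem, ENNReal.ofReal_le_ofReal_iff hR] at hle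
  have h4 := pow_le_pow_left₀ (Real.rpow_nonneg hI _) hle 4
  rw [mul_pow, show √(u * ((b₂ : ℝ) - b₁)) ^ 4 = (√(u * ((b₂ : ℝ) - b₁)) ^ 2) ^ 2 by ring,
    Real.sq_sqrt (mul_nonneg hu hd), ← Real.rpow_natCast, ← Real.rpow_natCast (gaussFour ^ _),
    ← Real.rpow_mul hI, ← Real.rpow_mul gaussFour_nonneg] at h4
  norm_num at h4
  exact h4

lemma memLp_four_brownian (hW : IsPreBrownianReal W P) (t : ℝ≥0) : MemLp (W t) 4 P :=
  (hW.isGaussianProcess.hasGaussianLaw_eval t).memLp (by norm_num)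

/-- `c W_s - d W_t = c (W_s - W_t) + (c - d) W_t`: a Brownian increment plus the change of the
scale, the latter multiplied by a variable with bounded fourth moment. -/
lemma scaled_increment_four (hW : IsPreBrownianReal W P) {s t : ℝ≥0} (ht : t ≤ 1)
    (c d : ℝ) :
    MemLp (fun ω => c * W s ω - d * W t ω) 4 P
      ∧ ∫ ω, (c * W s ω - d * W t ω) ^ 4 ∂P
        ≤ 8 * gaussFour * (c ^ 4 * ((s : ℝ) - t) ^ 2 + (c - d) ^ 4) := by
  have hsub : MemLp (fun ω => W s ω - W t ω) 4 P :=
    (memLp_four_brownian hW s).sub (memLp_four_brownian hW t)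
  have hmem : MemLp (fun ω => c * W s ω - d * W t ω) 4 P :=
    ((memLp_four_brownian hW s).const_mul c).sub ((memLp_four_brownian hW t).const_mul d)
  refine ⟨hmem, ?_⟩
  have i1 : Integrable (fun ω => (W s ω - W t ω) ^ 4) P := integrable_pow_four hsub
  have i2 : Integrable (fun ω => W t ω ^ 4) P := integrable_pow_four (memLp_four_brownian hW t)
  have e1 : ∫ ω, (W s ω - W t ω) ^ 4 ∂P = gaussFour * ((s : ℝ) - t) ^ 2 := by
    have h : ((nndist (s : ℝ) (t : ℝ) : ℝ≥0) : ℝ) ^ 2 = ((s : ℝ) - t) ^ 2 := by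
      rw [coe_nndist, Real.dist_eq, sq_abs]
    exact (hasLaw_integral_pow_four (hW.hasLaw_sub s t)).trans (congrArg _ h)
  have e2 : ∫ ω, W t ω ^ 4 ∂P ≤ gaussFour := by
    rw [hasLaw_integral_pow_four (hW.hasLaw_eval t)]
    have h1 : (t : ℝ) ≤ 1 := ht
    exact mul_le_of_le_one_right gaussFour_nonneg (pow_le_one₀ t.2 h1)
  calc ∫ ω, (c * W s ω - d * W t ω) ^ 4 ∂P
      ≤ ∫ ω, (8 * c ^ 4) * (W s ω - W t ω) ^ 4 + (8 * (c - d) ^ 4) * W t ω ^ 4 ∂P := by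
        refine integral_mono (integrable_pow_four hmem) ((i1.const_mul _).add (i2.const_mul _))
          fun ω => ?_
        have := pow_four_add_le (c * (W s ω - W t ω)) ((c - d) * W t ω)
        simp only
        calc (c * W s ω - d * W t ω) ^ 4 = (c * (W s ω - W t ω) + (c - d) * W t ω) ^ 4 := by ring
          _ ≤ _ := this
          _ = _ := by ring
    _ = (8 * c ^ 4) * (gaussFour * ((s : ℝ) - t) ^ 2) + (8 * (c - d) ^ 4) * ∫ ω, W t ω ^ 4 ∂P := by
        rw [integral_add (i1.const_mul _) (i2.const_mul _), integral_const_mul, integral_const_mul,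
          e1]
    _ ≤ (8 * c ^ 4) * (gaussFour * ((s : ℝ) - t) ^ 2) + (8 * (c - d) ^ 4) * gaussFour := by
        have : 0 ≤ 8 * (c - d) ^ 4 := by positivity
        gcongr
    _ = _ := by ring

/-- In both models a sample is signal plus noise, where the signal is independent of the noise and
has increments whose fourth moments are `O(n^{-4γ})` for some `γ > 1/4`. -/
lemma IsSample.exists_signal (hW : IsPreBrownianReal W P) (mod : VolModel)
    {α Q l u : ℝ} (hl : 0 < l) (hlu : l ≤ u)
    (hα : (mod = .timeTransformed ∧ 1 / 2 < α) ∨ (mod = .spaceTransformed ∧ 3 / 4 < α)) :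
    ∃ γ C : ℝ, 1 / 4 < γ ∧ 0 ≤ C ∧ ∀ (m : ℕ) (e : Fin (m + 1) → Ω → ℝ), IsNoiseRow P W e →
      ∀ s ∈ sobolevSBdd α Q l u, ∀ (v : ℝ → ℝ) (Y : Fin (m + 1) → Ω → ℝ),
        IsSample mod P W e s v Y →
        ∃ X : Fin (m + 1) → Ω → ℝ,
          (∀ i ω, Y i ω = X i ω + √(v (designPt (m + 1) (i + 1))) * e i ω) ∧
          IndepFun (fun ω i => X i ω) (fun ω i => e i ω) P ∧
          (∀ i : Fin m, MemLp (fun ω => X i.succ ω - X i.castSucc ω) 4 P) ∧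
          ∀ i : Fin m, ∫ ω, (X i.succ ω - X i.castSucc ω) ^ 4 ∂P
            ≤ (C * ((m + 1 : ℕ) : ℝ) ^ (-(2 * γ))) ^ 2 := by
  have hu : 0 ≤ u := hl.le.trans hlu
  have hdes : ∀ (m : ℕ) (i : Fin (m + 1)), designPt (m + 1) (i + 1) ≤ 1 := fun m i =>
    designPt_le_one (by omega)
  rcases hα with ⟨rfl, -⟩ | ⟨rfl, hα⟩
  -- Here increments are of the Brownian order `n^{-1/2}`.
  · refine ⟨1 / 2, √gaussFour * u, by norm_num, by positivity, ?_⟩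
    rintro m e he s ⟨-, hs⟩ v Y ⟨X, hX, hY⟩
    have key : ∀ i : Fin m, _ := fun i => IsWienerIntegral.increment_four hW (u := u)
      (designPt_mono (n := m + 1) (i := (i.castSucc : ℕ) + 1) (j := (i.succ : ℕ) + 1) (by simp))
      (fun x hx => (hs x ⟨(NNReal.coe_nonneg _).trans hx.1.le,
        hx.2.trans (designPt_mem (by omega)).2⟩).2) hu (hX i.castSucc) (hX i.succ)
    refine ⟨X, hY, he.indepFun_of_path fun i => (hX i).exists_measurable hW (hdes m i),
      fun i => (key i).1, fun i => (key i).2.trans (le_of_eq ?_)⟩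
    rw [Fin.val_castSucc, Fin.val_succ, designPt_succ_sub, mul_pow, mul_pow, mul_pow,
      Real.sq_sqrt gaussFour_nonneg, mul_assoc]
    congr 3
    rw [show -(2 * (1 / 2 : ℝ)) = -1 by norm_num, Real.rpow_neg_one, one_div]
  -- `(α - 1/4)/2` is the midpoint of `1/4` and `α - 1/2`, hence an admissible Hölder exponent above
  -- `1/4` exactly when `α > 3/4`. The cap `1/2` makes the Brownian part `1/n` no larger than
  -- `n^{-2γ}`.
  · have hγ0 : 1 / 4 < min (1 / 2 : ℝ) ((α - 1 / 4) / 2) := lt_min (by norm_num) (by linarith)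
    set γ := min (1 / 2 : ℝ) ((α - 1 / 4) / 2) with hγ
    have hγ1 : γ ≤ 1 / 2 := min_le_left _ _
    have hγ2 : γ ≤ (α - 1 / 4) / 2 := min_le_right _ _
    obtain ⟨K, hK, hol⟩ := sobolevS_holder (α := α) (γ := γ) (C := Q) (by linarith) (by linarith)
      (by linarith)
    refine ⟨γ, √(8 * gaussFour * (u ^ 2 + K ^ 4 / l ^ 2)), hγ0, Real.sqrt_nonneg _, ?_⟩
    rintro m e he s ⟨hsS, hs⟩ v Y hY
    have hn : (1 : ℝ) ≤ ((m + 1 : ℕ) : ℝ) := by simp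
    have hmem : ∀ i : Fin (m + 1), (designPt (m + 1) (i + 1) : ℝ) ∈ Icc (0 : ℝ) 1 := fun i =>
      designPt_mem (by omega)
    have key : ∀ i : Fin m, _ := fun i => scaled_increment_four hW
      (s := designPt (m + 1) ((i.succ : ℕ) + 1)) (hdes m i.castSucc)
      (√(s (designPt (m + 1) ((i.succ : ℕ) + 1)))) (√(s (designPt (m + 1) ((i.castSucc : ℕ) + 1))))
    refine ⟨fun i ω => √(s (designPt (m + 1) (i + 1))) * W (designPt (m + 1) (i + 1)) ω, hY,
      he.indepFun_of_path fun i => ?_, fun i => (key i).1, fun i => (key i).2.trans ?_⟩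
    · exact ⟨fun w => √(s (designPt (m + 1) (i + 1)))
        * w ⟨designPt (m + 1) (i + 1), zero_le, hdes m i⟩, by fun_prop, EventuallyEq.rfl⟩
    · have hg := gaussFour_nonneg
      rw [mul_pow, Real.sq_sqrt (by positivity), ← Real.rpow_natCast (_ ^ (-(2 * γ))),
        ← Real.rpow_mul (by positivity), mul_assoc (8 * gaussFour)]
      refine mul_le_mul_of_nonneg_left ?_ (by positivity)
      set a := s (designPt (m + 1) ((i.succ : ℕ) + 1))
      set b := s (designPt (m + 1) ((i.castSucc : ℕ) + 1))
      obtain ⟨ha, ha'⟩ := hs _ (hmem i.succ)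
      obtain ⟨hb, -⟩ := hs _ (hmem i.castSucc)
      have hd : (designPt (m + 1) ((i.succ : ℕ) + 1) : ℝ) - designPt (m + 1) ((i.castSucc : ℕ) + 1)
          = 1 / ((m + 1 : ℕ) : ℝ) := by
        rw [Fin.val_castSucc, Fin.val_succ, designPt_succ_sub]
      have hab : |a - b| ≤ K * (((m + 1 : ℕ) : ℝ)) ^ (-γ) := by
        have := hol s hsS _ (hmem i.succ) _ (hmem i.castSucc)
        rwa [hd, abs_of_pos (show (0 : ℝ) < 1 / ((m + 1 : ℕ) : ℝ) by positivity), one_div, Real.inv_rpow (by positivity),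
          ← Real.rpow_neg (by positivity)] at this
      have h1 : √a ^ 4 ≤ u ^ 2 := by
        rw [show √a ^ 4 = (√a ^ 2) ^ 2 by ring, Real.sq_sqrt (hl.le.trans ha)]
        exact pow_le_pow_left₀ (hl.le.trans ha) ha' 2
      have h2 : (√a - √b) ^ 4 ≤ K ^ 4 / l ^ 2 * ((m + 1 : ℕ) : ℝ) ^ (-(2 * γ) * (2 : ℕ)) := by
        have h := (abs_sqrt_sub_sqrt_le hl ha hb).trans
          (div_le_div_of_nonneg_right hab (Real.sqrt_nonneg l))
        calc (√a - √b) ^ 4 = |√a - √b| ^ 4 := (Even.pow_abs (by decide) _).symm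
          _ ≤ (K * ((m + 1 : ℕ) : ℝ) ^ (-γ) / √l) ^ 4 := pow_le_pow_left₀ (abs_nonneg _) h 4
          _ = K ^ 4 / l ^ 2 * (((m + 1 : ℕ) : ℝ) ^ (-γ)) ^ 4 := by
            rw [div_pow, mul_pow, show √l ^ 4 = (√l ^ 2) ^ 2 by ring, Real.sq_sqrt hl.le]
            ring
          _ = _ := by
            rw [← Real.rpow_natCast (((m + 1 : ℕ) : ℝ) ^ (-γ)), ← Real.rpow_mul (by positivity)]
            congr 2
            push_cast
            ring
      have h3 : (1 / ((m + 1 : ℕ) : ℝ)) ^ 2 ≤ ((m + 1 : ℕ) : ℝ) ^ (-(2 * γ) * (2 : ℕ)) := by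
        rw [one_div, inv_pow, ← Real.rpow_natCast, ← Real.rpow_neg (by positivity)]
        refine Real.rpow_le_rpow_of_exponent_le hn ?_
        push_cast
        linarith
      rw [hd, add_mul]
      exact add_le_add (mul_le_mul h1 h3 (by positivity) (by positivity)) h2

end Signal

/-! ### The bound on the MISE -/

section Risk

variable {Ω : Type*} [MeasurableSpace Ω] {P : Measure Ω} [IsProbabilityMeasure P]

/-- The error of coefficient `0` enters every estimated Fourier coefficient. Splitting by `(x - y)²
≤ 2x² + 2y²` counts it `1 + 4N` times and the other errors four times each, in total `1 + 8N`. -/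
lemma MISE_le_of_integral_le {n N : ℕ} {β Q c : ℝ} (hβ : 1 / 2 < β) {v : ℝ → ℝ}
    (hv : v ∈ sobolevS β Q) (hN : 1 ≤ N) (Y : Fin n → Ω → ℝ) (hQ : 0 ≤ Q)
    (hd : ∀ k ≤ N, Integrable (fun ω => (tHat n k (fun i => Y i ω) - weightedMean v k) ^ 2) P ∧
      ∫ ω, (tHat n k (fun i => Y i ω) - weightedMean v k) ^ 2 ∂P ≤ c) :
    MISE P N Y v ≤ ENNReal.ofReal ((1 + 8 * N) * c + 2 * Q * (N : ℝ) ^ (-(2 * β))) := by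
  set d : ℕ → Ω → ℝ := fun k ω => tHat n k (fun i => Y i ω) - weightedMean v k with hddef
  have hi : ∀ k ≤ N, Integrable (fun ω => d k ω ^ 2) P := fun k hk => (hd k hk).1
  have hc : ∀ k ≤ N, ∫ ω, d k ω ^ 2 ∂P ≤ c := fun k hk => (hd k hk).2
  set R : ℝ := 2 * Q * (N : ℝ) ^ (-(2 * β)) with hR
  have hR0 : 0 ≤ R := by positivity
  set G : Ω → ℝ := fun ω => (1 + 4 * N) * d 0 ω ^ 2 + 4 * ∑ i ∈ Finset.Icc 1 N, d i ω ^ 2 + R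
    with hG
  have hle : ∀ i ∈ Finset.Icc 1 N, i ≤ N := fun i h => (Finset.mem_Icc.1 h).2
  have i0 : Integrable (fun ω => (1 + 4 * (N : ℝ)) * d 0 ω ^ 2) P := (hi 0 (by omega)).const_mul _
  have i1 : Integrable (fun ω => 4 * ∑ i ∈ Finset.Icc 1 N, d i ω ^ 2) P :=
    (integrable_finsetSum _ fun i h => hi i (hle i h)).const_mul _
  have i01 : Integrable (fun ω => (1 + 4 * (N : ℝ)) * d 0 ω ^ 2
      + 4 * ∑ i ∈ Finset.Icc 1 N, d i ω ^ 2) P := i0.add i1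
  have hGi : Integrable G P := i01.add (integrable_const R)
  have hG0 : ∀ ω, 0 ≤ G ω := fun ω => by positivity
  have hpt : ∀ ω, ∫⁻ t in Icc (0 : ℝ) 1,
      ENNReal.ofReal ((tauSqEst n N (fun i => Y i ω) t - v t) ^ 2) ≤ ENNReal.ofReal (G ω) := by
    intro ω
    refine (lintegral_cosSeries_sub_sq_le hβ hv hN fun k => tHat n k fun i => Y i ω).trans
      (ENNReal.ofReal_le_ofReal ?_)
    have hs : ∑ i ∈ Finset.Icc 1 N, (d i ω - d 0 ω) ^ 2
        ≤ ∑ i ∈ Finset.Icc 1 N, (2 * d i ω ^ 2 + 2 * d 0 ω ^ 2) :=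
      Finset.sum_le_sum fun i _ => by nlinarith [sq_nonneg (d i ω + d 0 ω)]
    rw [Finset.sum_add_distrib, ← Finset.mul_sum, Finset.sum_const, Nat.card_Icc, nsmul_eq_mul,
      Nat.add_sub_cancel] at hs
    change d 0 ω ^ 2 + 2 * ∑ i ∈ Finset.Icc 1 N, (d i ω - d 0 ω) ^ 2 + R ≤ G ω
    simp only [hG]
    linarith
  refine (lintegral_mono hpt).trans ?_
  rw [← ofReal_integral_eq_lintegral_ofReal hGi (ae_of_all _ hG0)]
  refine ENNReal.ofReal_le_ofReal ?_
  simp only [hG]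
  rw [integral_add i01 (integrable_const R), integral_add i0 i1, integral_const_mul,
    integral_const_mul, integral_finsetSum _ fun i h => hi i (hle i h)]
  have hs : ∑ i ∈ Finset.Icc 1 N, ∫ ω, d i ω ^ 2 ∂P ≤ N * c := by
    refine (Finset.sum_le_sum fun i h => hc i (hle i h)).trans (le_of_eq ?_)
    simp
  have h0 := mul_le_mul_of_nonneg_left (hc 0 (by omega)) (show (0 : ℝ) ≤ 1 + 4 * N by positivity)
  simp only [integral_const, probReal_univ, one_smul]
  linarith

end Risk

/-! ### Asymptotics -/

/-- `log² n = o(n^{2γ - 1/2})` because `γ > 1/4`. This makes the signal part of each coefficient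
negligible. -/
lemma eventually_logb_sq_mul_rpow_le {γ : ℝ} (C : ℝ) (hγ : 1 / 4 < γ) :
    ∀ᶠ n : ℕ in atTop, Real.logb 2 n ^ 2 * (C * (n : ℝ) ^ (-(2 * γ))) ≤ 1 / √(n : ℝ) := by
  have h := (((isLittleO_log_rpow_atTop (sub_pos.2 hγ)).pow (n := 2) (by norm_num)).const_mul_left
    (C / Real.log 2 ^ 2)).comp_tendsto tendsto_natCast_atTop_atTop
  filter_upwards [h.def one_pos, eventually_ge_atTop 1] with n hn h1
  have hn0 : (0 : ℝ) < n := by exact_mod_cast h1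
  simp only [Function.comp, one_mul, Real.norm_eq_abs] at hn
  rw [abs_of_nonneg (by positivity : 0 ≤ ((n : ℝ) ^ (γ - 1 / 4)) ^ 2)] at hn
  have hn' := (le_abs_self _).trans hn
  have e : (n : ℝ) ^ (-(2 * γ)) * ((n : ℝ) ^ (γ - 1 / 4)) ^ 2 = 1 / √(n : ℝ) := by
    rw [one_div √(n : ℝ), Real.sqrt_eq_rpow, ← Real.rpow_neg hn0.le, ← Real.rpow_natCast,
      ← Real.rpow_mul hn0.le, ← Real.rpow_add hn0]
    congr 1
    push_cast
    ring
  calc Real.logb 2 n ^ 2 * (C * (n : ℝ) ^ (-(2 * γ)))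
      = (n : ℝ) ^ (-(2 * γ)) * (C / Real.log 2 ^ 2 * Real.log n ^ 2) := by
        rw [Real.logb, div_pow]; ring
    _ ≤ (n : ℝ) ^ (-(2 * γ)) * ((n : ℝ) ^ (γ - 1 / 4)) ^ 2 :=
        mul_le_mul_of_nonneg_left hn' (by positivity)
    _ = _ := e

/-- Shows that cut-offs of the optimal order satisfy the growth condition of the general bound. -/
lemma rpow_isLittleO_sqrt_div_logb {a : ℝ} (ha : a < 1 / 2) :
    (fun n : ℕ => (n : ℝ) ^ a) =o[atTop] fun n : ℕ => (n : ℝ) ^ (1 / 2 : ℝ) / Real.logb 2 n := by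
  have h := ((isLittleO_log_rpow_atTop (sub_pos.2 ha)).const_mul_left
    (Real.log 2)⁻¹).comp_tendsto tendsto_natCast_atTop_atTop
  have h' := (isBigO_refl (fun n : ℕ => (n : ℝ) ^ a / Real.logb 2 n) atTop).mul_isLittleO h
  refine h'.congr' ?_ ?_
  · filter_upwards [eventually_ge_atTop 2] with n hn
    have : 0 < Real.log n := Real.log_pos (by exact_mod_cast hn)
    have : 0 < Real.log 2 := Real.log_pos (by norm_num)
    simp only [Function.comp, Real.logb]
    field_simp
  · filter_upwards [eventually_ge_atTop 1] with n hn
    have hn0 : (0 : ℝ) < n := by exact_mod_cast hn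
    simp only [Function.comp]
    rw [div_mul_eq_mul_div, ← Real.rpow_add hn0]
    congr 2
    ring

/-! ### Minimization of the risk bound -/

lemma rpow_neg_eq_div {β x : ℝ} (hx : 0 < x) : x / x ^ (2 * β + 1) = x ^ (-(2 * β)) := by
  nth_rewrite 1 [← Real.rpow_one x]
  rw [← Real.rpow_sub hx]
  congr 1
  ring

lemma rpow_one_div_rpow {β : ℝ} (hβ : 0 < β) {n : ℝ} (hn : 0 ≤ n) :
    (n ^ (1 / (2 * β + 1))) ^ (2 * β + 1) = n := by
  rw [← Real.rpow_mul hn, one_div_mul_cancel (by positivity), Real.rpow_one]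

/-- A cut-off that does at least as well as `⌈n^{1/(2β+1)}⌉` is of the order `n^{1/(2β+1)}`. -/
lemma bounds_of_riskBound_le {β : ℝ} (hβ : 0 < β) {n N : ℕ} (hn : 1 ≤ n) (hN : 1 ≤ N)
    (h : riskBound β n N ≤ riskBound β n ⌈(n : ℝ) ^ (1 / (2 * β + 1))⌉₊) :
    (N : ℝ) ≤ 3 * (n : ℝ) ^ (1 / (2 * β + 1)) ∧
      (3 : ℝ) ^ (-(1 / (2 * β))) * (n : ℝ) ^ (1 / (2 * β + 1)) ≤ N := by
  have hn1 : (1 : ℝ) ≤ n := by exact_mod_cast hn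
  have hN1 : (0 : ℝ) < N := by exact_mod_cast hN
  set x := (n : ℝ) ^ (1 / (2 * β + 1)) with hx
  have hx1 : 1 ≤ x := Real.one_le_rpow hn1 (by positivity)
  have hx0 : 0 < x := by linarith
  have hxn : x ^ (2 * β + 1) = n := rpow_one_div_rpow hβ (by positivity)
  have hK1 : x ≤ ⌈x⌉₊ := Nat.le_ceil x
  have hK2 : (⌈x⌉₊ : ℝ) ≤ 2 * x := (Nat.ceil_lt_add_one hx0.le).le.trans (by linarith)
  -- `x = n^{1/(2β+1)}` balances the terms: `x / n = x^{-2β}`. Rounding up costs at most a factor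
  -- `2` in the second one, hence `1 + 2 = 3`. Each of the two terms of the bound at `N` is then at
  -- most this, which bounds `N` from both sides.
  have hK : riskBound β n ⌈x⌉₊ ≤ 3 * x ^ (-(2 * β)) := by
    have h1 : ((⌈x⌉₊ : ℕ) : ℝ) ^ (-(2 * β)) ≤ x ^ (-(2 * β)) :=
      Real.rpow_le_rpow_of_nonpos hx0 hK1 (by linarith)
    have h2 : (⌈x⌉₊ : ℝ) / n ≤ 2 * x ^ (-(2 * β)) := by
      rw [← rpow_neg_eq_div hx0, hxn, ← mul_div_assoc]
      gcongr
    unfold riskBound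
    linarith
  have hr := h.trans hK
  unfold riskBound at hr
  constructor
  · have h1 : (N : ℝ) / n ≤ 3 * x ^ (-(2 * β)) := by
      have : 0 ≤ (N : ℝ) ^ (-(2 * β)) := by positivity
      linarith
    rw [← rpow_neg_eq_div hx0, hxn, ← mul_div_assoc] at h1
    exact (div_le_div_iff_of_pos_right (by linarith)).1 h1
  · by_contra! hlt
    have h1 := Real.rpow_lt_rpow_of_neg hN1 hlt (show -(2 * β) < 0 by linarith)
    rw [Real.mul_rpow (by positivity) hx0.le, ← Real.rpow_mul (by norm_num),
      neg_mul_neg, one_div_mul_cancel (by positivity), Real.rpow_one] at h1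
    have : 0 ≤ (N : ℝ) / n := by positivity
    linarith

lemma isTheta_of_minimizer {β : ℝ} (hβ : 0 < β) {N : ℕ → ℕ}
    (h : ∀ᶠ n in atTop, 1 ≤ N n ∧ ∀ K : ℕ, 1 ≤ K → riskBound β n (N n) ≤ riskBound β n K) :
    (fun n => (N n : ℝ)) =Θ[atTop] fun n : ℕ => (n : ℝ) ^ (1 / (2 * β + 1)) := by
  have hb : ∀ᶠ n : ℕ in atTop, (N n : ℝ) ≤ 3 * (n : ℝ) ^ (1 / (2 * β + 1)) ∧
      (3 : ℝ) ^ (-(1 / (2 * β))) * (n : ℝ) ^ (1 / (2 * β + 1)) ≤ N n := by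
    filter_upwards [h, eventually_ge_atTop 1] with n hn h1
    refine bounds_of_riskBound_le hβ h1 hn.1 (hn.2 _ (Nat.one_le_ceil_iff.2 ?_))
    have : (0 : ℝ) < n := by exact_mod_cast h1
    positivity
  constructor
  · refine IsBigO.of_bound 3 (hb.mono fun n hn => ?_)
    rw [Real.norm_of_nonneg (by positivity), Real.norm_of_nonneg (by positivity)]
    exact hn.1
  · refine IsBigO.of_bound (((3 : ℝ) ^ (-(1 / (2 * β))))⁻¹) (hb.mono fun n hn => ?_)
    rw [Real.norm_of_nonneg (by positivity), Real.norm_of_nonneg (by positivity)]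
    rw [← div_eq_inv_mul, le_div_iff₀ (by positivity), mul_comm]
    exact hn.2

lemma eventually_riskBound_le_of_isTheta {β : ℝ} (hβ : 0 < β) {N : ℕ → ℕ}
    (h : (fun n => (N n : ℝ)) =Θ[atTop] fun n : ℕ => (n : ℝ) ^ (1 / (2 * β + 1))) :
    ∃ C : ℝ, ∀ᶠ n in atTop, 1 ≤ N n ∧
      riskBound β n (N n) ≤ C * (n : ℝ) ^ (-(2 * β) / (2 * β + 1)) := by
  obtain ⟨c₂, hc₂, h2⟩ := h.1.exists_pos
  obtain ⟨c₁, hc₁, h1⟩ := h.2.exists_pos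
  refine ⟨c₁⁻¹ ^ (-(2 * β)) + c₂, ?_⟩
  filter_upwards [h1.bound, h2.bound, eventually_ge_atTop 1] with n hn1 hn2 hn
  have hn0 : (0 : ℝ) < n := by exact_mod_cast hn
  rw [Real.norm_of_nonneg (by positivity), Real.norm_of_nonneg (by positivity)] at hn1 hn2
  have hxe : (n : ℝ) ^ (-(2 * β) / (2 * β + 1)) = ((n : ℝ) ^ (1 / (2 * β + 1))) ^ (-(2 * β)) := by
    rw [← Real.rpow_mul hn0.le]
    congr 1
    ring
  set x := (n : ℝ) ^ (1 / (2 * β + 1)) with hx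
  have hx0 : 0 < x := by positivity
  have hxn : x ^ (2 * β + 1) = n := rpow_one_div_rpow hβ hn0.le
  -- The lower half of the order relation excludes `N n = 0`, so positivity of the cut-off is not a
  -- separate assumption.
  have hN0 : 0 < N n := by
    rcases Nat.eq_zero_or_pos (N n) with h0 | h0
    · rw [h0] at hn1
      simp only [Nat.cast_zero, mul_zero] at hn1
      exact absurd hn1 (not_le.2 hx0)
    · exact h0
  refine ⟨hN0, ?_⟩
  have hlow : c₁⁻¹ * x ≤ N n := by rwa [inv_mul_le_iff₀ hc₁]
  have e1 : (N n : ℝ) ^ (-(2 * β)) ≤ c₁⁻¹ ^ (-(2 * β)) * x ^ (-(2 * β)) := by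
    rw [← Real.mul_rpow (by positivity) hx0.le]
    exact Real.rpow_le_rpow_of_nonpos (by positivity) hlow (by linarith)
  have e2 : (N n : ℝ) / n ≤ c₂ * x ^ (-(2 * β)) := by
    rw [← rpow_neg_eq_div hx0, hxn, ← mul_div_assoc]
    gcongr
  rw [hxe, riskBound]
  linarith

/-! ### The uniform risk bound and the theorem -/

lemma mseConst_nonneg {M τ Kv B : ℝ} (hM : 0 ≤ M) (hτ : 0 ≤ τ) (hB : 0 ≤ B) :
    0 ≤ mseConst M τ Kv B := by
  unfold mseConst
  positivity

/-- All constants (`γ`, `C₀`, the Hölder constant `K` of `τ²`, the moment bound) depend on the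
classes only, so the bound for one pair of functions passes to the supremum. The constant is
nonnegative so that further upper bounds on `riskBound` can be inserted. -/
theorem exists_supMISE_le {Ω : Type*} [MeasurableSpace Ω] {P : Measure Ω} [IsProbabilityMeasure P]
    {W : ℝ≥0 → Ω → ℝ} (hW : IsPreBrownianReal W P) {ε : (n : ℕ) → Fin n → Ω → ℝ}
    (hε : ∀ n, IsNoiseRow P W (ε n)) {M : ℝ} (hM : ∀ n i, ∫ ω, ε n i ω ^ 4 ∂P ≤ M)
    {α β Q Q' l u τl τu : ℝ} (hβ : 1 < β) (hQ' : 0 < Q') (hl : 0 < l) (hlu : l ≤ u)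
    (hτl : 0 < τl) (hτ : τl ≤ τu) {mod : VolModel}
    (hα : (mod = .timeTransformed ∧ 1 / 2 < α) ∨ (mod = .spaceTransformed ∧ 3 / 4 < α))
    {N : ℕ → ℕ} (hN : ∀ᶠ n in atTop, 1 ≤ N n)
    (hNo : (fun n => (N n : ℝ)) =o[atTop] fun n : ℕ => (n : ℝ) ^ (1 / 2 : ℝ) / Real.logb 2 n) :
    ∃ C : ℝ, 0 ≤ C ∧ ∀ᶠ n in atTop,
      supMISE mod P W (ε n) (sobolevSBdd α Q l u) (sobolevSBdd β Q' τl τu) (N n)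
        ≤ ENNReal.ofReal (C * riskBound β n (N n)) := by
  obtain ⟨γ, C₀, hγ, hC₀, hsig⟩ := IsSample.exists_signal (Q := Q) hW mod hl hlu hα
  -- Order `1/2` matches the accuracy `n^{-1/2}` required of the Riemann sums; it is available since
  -- `β > 1`.
  obtain ⟨K, hK, hhol⟩ := sobolevS_holder (α := β) (γ := 1 / 2) (C := Q') (by norm_num)
    (by norm_num) (by linarith)
  have hτu : 0 ≤ τu := hτl.le.trans hτ
  have hc0 : 0 ≤ mseConst (max M 1) τu K 1 := mseConst_nonneg (by positivity) hτu zero_le_one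
  -- `9` from `1 + 8N ≤ 9N`, and `2 * Q'` from the tail of the series. The last argument of
  -- `mseConst` is the constant `1` in `eventually_logb_sq_mul_rpow_le`.
  refine ⟨9 * mseConst (max M 1) τu K 1 + 2 * Q', by positivity, ?_⟩
  filter_upwards [hN, hNo.def one_pos, eventually_logb_sq_mul_rpow_le C₀ hγ,
    eventually_ge_atTop 4] with n hN1 hNn hB hn
  obtain ⟨m, rfl⟩ : ∃ m, n = m + 1 := ⟨n - 1, by omega⟩
  have hn4 : (4 : ℝ) ≤ ((m + 1 : ℕ) : ℝ) := by exact_mod_cast hn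
  have hL : 2 ≤ Real.logb 2 (m + 1 : ℕ) := by
    rw [Real.le_logb_iff_rpow_le (by norm_num) (by linarith)]
    norm_num at hn4 ⊢
    linarith
  -- The growth condition on the cut-off, squared: every frequency in use satisfies the hypothesis
  -- of the coefficient bound.
  have hkL : ∀ k ≤ N (m + 1),
      (k : ℝ) ^ 2 * Real.logb 2 (m + 1 : ℕ) ^ 2 ≤ (m + 1 : ℕ) := by
    intro k hk
    have hk' : (k : ℝ) ≤ N (m + 1) := by exact_mod_cast hk
    rw [one_mul, Real.norm_of_nonneg (by positivity),
      Real.norm_of_nonneg (div_nonneg (by positivity) (by linarith)),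
      le_div_iff₀ (by linarith), ← Real.sqrt_eq_rpow] at hNn
    have h1 : (k : ℝ) * Real.logb 2 (m + 1 : ℕ) ≤ √((m + 1 : ℕ) : ℝ) :=
      (mul_le_mul_of_nonneg_right hk' (by linarith)).trans hNn
    calc (k : ℝ) ^ 2 * Real.logb 2 (m + 1 : ℕ) ^ 2
        = ((k : ℝ) * Real.logb 2 (m + 1 : ℕ)) ^ 2 := by ring
      _ ≤ √((m + 1 : ℕ) : ℝ) ^ 2 :=
        pow_le_pow_left₀ (mul_nonneg (by positivity) (by linarith)) h1 2
      _ = _ := Real.sq_sqrt (by positivity)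
  refine iSup_le fun s => iSup_le fun hs => iSup_le fun v => iSup_le fun hv => iSup_le fun Y =>
    iSup_le fun hY => ?_
  obtain ⟨X, hYX, hXe, hX, hr⟩ := hsig m (ε (m + 1)) (hε _) s hs v Y hY
  have hY' : ∀ ω, (fun i => Y i ω)
      = fun i => X i ω + √(v (designPt (m + 1) (i + 1))) * ε (m + 1) i ω :=
    fun ω => funext fun i => hYX i ω
  have he := hε (m + 1)
  refine (MISE_le_of_integral_le (c := mseConst (max M 1) τu K 1 / (m + 1 : ℕ)) (by linarith) hv.1
    hN1 Y hQ'.le fun k hk => ?_).trans (ENNReal.ofReal_le_ofReal ?_)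
  · simp only [hY']
    exact integral_tHat_sub_sq_le hL (hkL k hk) he.indep he.memLp_four he.mean_zero he.variance_one
      (le_max_right M 1) (fun i => (hM _ i).trans (le_max_left M 1))
      (fun x hx => hτl.le.trans (hv.2 x hx).1) (fun x hx => (hv.2 x hx).2) hK (hhol v hv.1) hXe hX
      (by positivity) hr hB
  · unfold riskBound
    set c := mseConst (max M 1) τu K 1
    have hN1' : (1 : ℝ) ≤ N (m + 1) := by exact_mod_cast hN1
    have hp : 0 ≤ (N (m + 1) : ℝ) ^ (-(2 * β)) := by positivity
    have h1 : (1 + 8 * (N (m + 1) : ℝ)) * (c / (m + 1 : ℕ))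
        ≤ 9 * c * ((N (m + 1) : ℝ) / (m + 1 : ℕ)) := by
      have h0 : 0 ≤ c / ((m + 1 : ℕ) : ℝ) := by positivity
      calc (1 + 8 * (N (m + 1) : ℝ)) * (c / (m + 1 : ℕ))
          ≤ (9 * (N (m + 1) : ℝ)) * (c / (m + 1 : ℕ)) :=
            mul_le_mul_of_nonneg_right (by linarith) h0
        _ = _ := by ring
    have h2 : 0 ≤ 9 * c * (N (m + 1) : ℝ) ^ (-(2 * β)) := by positivity
    have h3 : 0 ≤ 2 * Q' * ((N (m + 1) : ℝ) / (m + 1 : ℕ)) := by positivity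
    linarith

end NoisyVolatility

end

theorem theorem1 {Ω : Type*} [MeasurableSpace Ω] (P : Measure Ω) [IsProbabilityMeasure P]
    -- the Brownian motion and the triangular array of errors, with bounded fourth moments
    (W : ℝ≥0 → Ω → ℝ) (hW : IsBrownianReal W P)
    (ε : (n : ℕ) → Fin n → Ω → ℝ) (hε : ∀ n, NoisyVolatility.IsNoiseRow P W (ε n))
    (M : ℝ) (hM : ∀ n i, ∫ ω, ε n i ω ^ 4 ∂P ≤ M)
    -- the smoothness classes
    (α β Q Qbar σmin σmax τmin τmax : ℝ) (hβ : 1 < β) (hQ : 0 < Q) (hQbar : 0 < Qbar)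
    (hσmin : 0 < σmin) (hσ : σmin ≤ σmax) (hτmin : 0 < τmin) (hτ : τmin ≤ τmax)
    -- the model
    (mod : NoisyVolatility.VolModel)
    (hα : (mod = .timeTransformed ∧ 1 / 2 < α) ∨ (mod = .spaceTransformed ∧ 3 / 4 < α)) :
    -- the bound for a general cut-off
    (∀ N : ℕ → ℕ, (∀ᶠ n in atTop, 1 ≤ N n) →
      ((fun n => (N n : ℝ)) =o[atTop] fun n : ℕ => (n : ℝ) ^ (1 / 2 : ℝ) / Real.logb 2 n) →
      ∃ C : ℝ, ∀ᶠ n in atTop,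
        NoisyVolatility.supMISE mod P W (ε n) (NoisyVolatility.sobolevSBdd α Q σmin σmax)
            (NoisyVolatility.sobolevSBdd β Qbar τmin τmax) (N n)
          ≤ ENNReal.ofReal (C * NoisyVolatility.riskBound β n (N n))) ∧
    -- minimizers of the bound are of exact order `n ^ (1 / (2β + 1))`
    (∀ N : ℕ → ℕ,
      (∀ᶠ n in atTop, 1 ≤ N n ∧ ∀ K : ℕ, 1 ≤ K →
        NoisyVolatility.riskBound β n (N n) ≤ NoisyVolatility.riskBound β n K) →
      (fun n => (N n : ℝ)) =Θ[atTop] fun n : ℕ => (n : ℝ) ^ (1 / (2 * β + 1))) ∧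
    -- the rate for every cut-off of this order
    (∀ N : ℕ → ℕ,
      ((fun n => (N n : ℝ)) =Θ[atTop] fun n : ℕ => (n : ℝ) ^ (1 / (2 * β + 1))) →
      ∃ C : ℝ, ∀ᶠ n in atTop,
        NoisyVolatility.supMISE mod P W (ε n) (NoisyVolatility.sobolevSBdd α Q σmin σmax)
            (NoisyVolatility.sobolevSBdd β Qbar τmin τmax) (N n)
          ≤ ENNReal.ofReal (C * (n : ℝ) ^ (-(2 * β) / (2 * β + 1)))) := by
  have hpre := hW.toIsPreBrownianReal
  refine ⟨fun N hN hNo => ?_, fun N hN => ?_, fun N hN => ?_⟩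
  · obtain ⟨C, -, hC⟩ := NoisyVolatility.exists_supMISE_le (Q := Q) hpre hε hM hβ hQbar hσmin hσ
      hτmin hτ hα hN hNo
    exact ⟨C, hC⟩
  · exact NoisyVolatility.isTheta_of_minimizer (by linarith) hN
  · obtain ⟨C₁, hC₁⟩ := NoisyVolatility.eventually_riskBound_le_of_isTheta (by linarith) hN
    -- The optimal cut-off grows more slowly than `√n / log n`, so the general bound applies to it.
    have ha : 1 / (2 * β + 1) < 1 / 2 := one_div_lt_one_div_of_lt (by norm_num) (by linarith)
    obtain ⟨C, hC0, hC⟩ := NoisyVolatility.exists_supMISE_le (Q := Q) hpre hε hM hβ hQbar hσmin hσ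
      hτmin hτ hα (hC₁.mono fun _ h => h.1)
      (hN.1.trans_isLittleO (NoisyVolatility.rpow_isLittleO_sqrt_div_logb ha))
    refine ⟨C * C₁, ?_⟩
    filter_upwards [hC, hC₁] with n h1 h2
    refine h1.trans (ENNReal.ofReal_le_ofReal ?_)
    rw [mul_assoc]
    exact mul_le_mul_of_nonneg_left h2.2 hC0
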